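/- **Setting.** A *learning task* $(\Theta,\ell,\mathcal D)$ consists of a non-empty parameter set $\Theta\subseteq\mathbb R^{d}$, $d\ge 1$, measurable losses $\ell_\theta:\mathcal Z\to[0,\infty)$ for $\theta\in\Theta$ (extended by $\ell_\theta(\bot)=0$), and a probability distribution $\mathcal D$ on $\mathcal Z$. For a dataset $Z\in(\mathcal Z\cup\{\bot\})^n$ let $L_\theta(Z)=\frac1n\sum_{i=1}^n\ell_\theta(z_i)$, $L(Z)=\inf_{\theta\in\Theta}L_\theta(Z)$, and, for $A\subseteq\mathbb R$ and $w\in\mathbb R$, $L^{(A)}(Z)=\inf\{L_\theta(Z):\theta\in\Theta,\ \theta_1\in A\}$ and $L^{(w)}=L^{(\{w\})}$. Let $\theta(Z)$ be a minimizer of $L_\theta(Z)$ over $\Theta$ (arbitrary if there is none), $\theta(\mathcal D)\in\Theta$ a minimizer of $\mathbb E_{z\sim\mathcal D}\,\ell_\theta(z)$, $\Theta|_1=\{\theta_1:\theta\in\Theta\}$, and let $Z_{-i}$ be $Z$ with its $i$-th entry replaced by $\bot$. **Assumption (identifiability, concentration, stability)** with $N:\mathbb R\to[0,\infty)$ and $M,K,\lambda,\mu,\sigma>0$: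 for all $a,b>0$, 1. if $n\ge N(a)+K\log(1/b)/a^2$, then $\Pr_{Z\sim\mathcal D^n}\big[|\theta(Z)_1-\theta(\mathcal D)_1|\ge a\mu^{-1/2}\big]\le b$; 2. if $n\ge M+K\log(1/b)$, then with probability at least $1-b$ over $Z\sim\mathcal D^n$, for all $w\in\Theta|_1$: $\frac{\mu}{2}(w-\theta(Z)_1)^2\le L^{(w)}(Z)-L(Z)\le 2\mu(w-\theta(Z)_1)^2$; 3. if $n\ge M+K\log(1/b)$ and $i\in[n]$, then $\Pr_{Z\sim\mathcal D^n}\big[|L(Z)-L(Z_{-i})|\ge\lambda\log(2/b)/n\big]\le b$; 4. for all $n\ge1$, $\Pr_{Z\sim\mathcal D^n}\big[L(Z)\ge\sigma^2(1+\log(1/b)/n)\big]\le b$. **Computational model.** A mechanism is one fixed program of a randomized real random access machine. Unit-time steps are: loading a rational constant, $+,-,\times,/$, $\exp$, $\log$, floor, indirect reading and writing, comparison, a coin of given bias, a uniformly random integer from $\{0,\dots,k\}$, drawing a subsample $S$ of the dataset $Z$ that keeps each entry independently with a given probability (the other entries become $\bot$), and querying $L^{(\pi_i)}(S)$ for the current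 subsample $S$ and an index $i$. The dataset is accessed only in this way. The program gets $\kappa,n,\varepsilon,\delta,\beta,\alpha,\rho,p$ as input and outputs the index of an interval. **Theorem.** There are a mechanism $\mathcal M$ and a constant $C$ such that the following holds for all $\Theta,\ell$ as above, all partitions $\Pi=\{\pi_1<\dots<\pi_\kappa\}$ of $\Theta|_1$ into non-empty intervals listed from left to right, and all $\varepsilon,\delta,\alpha>0$, $\beta\in(0,1)$, $p\in(0,\frac14)$ and $\rho\ge\alpha^2$. * *Privacy.* For every $n$, $\mathcal M$ is $(\varepsilon,\delta)$-differentially private on $\mathcal Z^n$ (neighbors differ in exactly one entry). * *Running time.* On every dataset $\mathcal M$ outputs an interval of $\Pi$ with probability $1$, in expected time at most $$C\exp\!\Big(C\,\frac p\varepsilon\log\frac2\beta\,\log\frac{\kappa\rho}{\alpha^2}\Big)\cdot\kappa\cdot\Big(\frac{\log(\kappa(2+1/\delta))\,\log(2/\beta)}{p}\Big)^{C}.$$ * *Accuracy.* If $(\Theta,\ell,\mathcal D)$ satisfies the assumption with $N,M,K,\lambda,\mu,\sigma$, if $\rho\ge2\sigma^2+\alpha^2$, and if $$n\ \ge\ C\left(\frac{N(\alpha/2)+M}{p}+\Big(\frac{K(1+\alpha^2)}{\alpha^2}+\frac{\rho^2+\lambda^2}{\alpha^4}\Big)\Big(\frac{p^2}{\varepsilon^3}+\frac1p\Big)\big(1+\log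 X\big)^{C}\right),\qquad X=\frac{n\,\kappa\,\rho\,(2+1/\varepsilon)\log(2+1/\delta)}{\alpha^2\,\beta},$$ then with probability at least $1-\beta$ over $Z\sim\mathcal D^n$ and the coins of $\mathcal M$, the output $\pi$ satisfies $\inf_{w\in\pi}|\theta(\mathcal D)_1-w|<10\,\alpha\,\mu^{-1/2}$. -/

import Mathlib

open MeasureTheory
open scoped ENNReal

noncomputable section

namespace PrivEst

/-! ## Learning tasks -/

/-- A parameter set `Θ ⊆ ℝ^(d+1)` (the first coordinate of `θ` is `θ 0`) with non-negative
loss functions `ℓ_θ`, `θ ∈ Θ`, on the data universe `𝒵`. -/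
structure LossModel (d : ℕ) (𝒵 : Type*) [MeasurableSpace 𝒵] where
  params : Set (Fin (d + 1) → ℝ)
  loss : (Fin (d + 1) → ℝ) → 𝒵 → ℝ
  params_nonempty : params.Nonempty
  loss_nonneg : ∀ θ ∈ params, ∀ z, 0 ≤ loss θ z
  loss_measurable : ∀ θ ∈ params, Measurable (loss θ)

/-- The dataset `Z`, regarded as a dataset over `𝒵 ∪ {⊥}` (`⊥` is `none`). -/
def full {𝒵 : Type*} {n : ℕ} (Z : Fin n → 𝒵) : Fin n → Option 𝒵 := fun i => some (Z i)

/-- The subsample of `Z` that keeps the entries in `S` and replaces the others by `⊥`. -/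
def subsample {𝒵 : Type*} {n : ℕ} (Z : Fin n → 𝒵) (S : Finset (Fin n)) : Fin n → Option 𝒵 :=
  fun i => if i ∈ S then some (Z i) else none

/-- The dataset `Z_{-i}`: the `i`-th entry is replaced by `⊥`. -/
def dropEntry {𝒵 : Type*} {n : ℕ} (Z : Fin n → 𝒵) (i : Fin n) : Fin n → Option 𝒵 :=
  fun j => if j = i then none else some (Z j)

namespace LossModel

variable {d : ℕ} {𝒵 : Type*} [MeasurableSpace 𝒵]

/-- The set of first coordinates of the parameters, `Θ|₁`. -/
def firstCoords (T : LossModel d 𝒵) : Set ℝ := (fun θ => θ 0) '' T.params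

/-- Empirical loss `L_θ(Z) = (1/n) ∑ ℓ_θ(z_i)`, with `ℓ_θ(⊥) = 0`; `n` counts the `⊥` entries. -/
def empLoss (T : LossModel d 𝒵) (θ : Fin (d + 1) → ℝ) {n : ℕ} (Z : Fin n → Option 𝒵) : ℝ :=
  (1 / (n : ℝ)) * ∑ i, (Z i).elim 0 (T.loss θ)

/-- `L^{(A)}(Z)`: the least empirical loss among the parameters with first coordinate in `A`. -/
def minLossOn (T : LossModel d 𝒵) (A : Set ℝ) {n : ℕ} (Z : Fin n → Option 𝒵) : ℝ :=
  sInf ((fun θ => T.empLoss θ Z) '' {θ | θ ∈ T.params ∧ θ 0 ∈ A})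

/-- `L(Z)`: the least empirical loss. -/
def minLoss (T : LossModel d 𝒵) {n : ℕ} (Z : Fin n → Option 𝒵) : ℝ :=
  T.minLossOn Set.univ Z

/-- `θ` is an empirical risk minimizer for `Z`. -/
def IsEmpMinimizer (T : LossModel d 𝒵) {n : ℕ} (Z : Fin n → 𝒵) (θ : Fin (d + 1) → ℝ) : Prop :=
  θ ∈ T.params ∧ ∀ θ' ∈ T.params, T.empLoss θ (full Z) ≤ T.empLoss θ' (full Z)

/-- `θ` minimizes the population loss `E_{z ∼ D} ℓ_θ(z)` (an element of `[0, ∞]`). -/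
def IsPopMinimizer (T : LossModel d 𝒵) (D : Measure 𝒵) (θ : Fin (d + 1) → ℝ) : Prop :=
  θ ∈ T.params ∧ ∀ θ' ∈ T.params,
    ∫⁻ z, ENNReal.ofReal (T.loss θ z) ∂D ≤ ∫⁻ z, ENNReal.ofReal (T.loss θ' z) ∂D

end LossModel

/-- The distribution `D^n` of `n` i.i.d. samples. -/
def iid {𝒵 : Type*} [MeasurableSpace 𝒵] (D : Measure 𝒵) (n : ℕ) : Measure (Fin n → 𝒵) :=
  Measure.pi fun _ => D

/-- Identifiability, concentration and stability of the task `(Θ, ℓ, D)` with population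
minimizer `θD = θ(D)` and empirical minimizer `θE n Z = θ(Z)` (a minimizer whenever there is
one), with the quantities `N, M, K, lam, mu, sig`. Probabilities are of the failure events. -/
structure IdentConcStab {d : ℕ} {𝒵 : Type*} [MeasurableSpace 𝒵] (T : LossModel d 𝒵)
    (D : Measure 𝒵) (θD : Fin (d + 1) → ℝ) (θE : (n : ℕ) → (Fin n → 𝒵) → Fin (d + 1) → ℝ)
    (N : ℝ → ℝ) (M K lam mu sig : ℝ) : Prop where
  pop_min : T.IsPopMinimizer D θD
  emp_min : ∀ (n : ℕ) (Z : Fin n → 𝒵), (∃ θ, T.IsEmpMinimizer Z θ) → T.IsEmpMinimizer Z (θE n Z)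
  N_nonneg : ∀ a, 0 ≤ N a
  M_pos : 0 < M
  K_pos : 0 < K
  lam_pos : 0 < lam
  mu_pos : 0 < mu
  sig_pos : 0 < sig
  /-- concentration of the first coordinate of the empirical minimizer -/
  param_conc : ∀ a b : ℝ, 0 < a → 0 < b → ∀ n : ℕ, N a + K * Real.log (1 / b) / a ^ 2 ≤ n →
    iid D n {Z | a / Real.sqrt mu ≤ |θE n Z 0 - θD 0|} ≤ ENNReal.ofReal b
  /-- typical smoothness and strong convexity -/
  smooth_convex : ∀ b : ℝ, 0 < b → ∀ n : ℕ, M + K * Real.log (1 / b) ≤ n →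
    iid D n {Z | ¬ ∀ w ∈ T.firstCoords,
      mu * (w - θE n Z 0) ^ 2 / 2 ≤ T.minLossOn {w} (full Z) - T.minLoss (full Z) ∧
      T.minLossOn {w} (full Z) - T.minLoss (full Z) ≤ 2 * mu * (w - θE n Z 0) ^ 2}
      ≤ ENNReal.ofReal b
  /-- leave-one-out stability -/
  leave_one_out : ∀ b : ℝ, 0 < b → ∀ n : ℕ, M + K * Real.log (1 / b) ≤ n → ∀ i : Fin n,
    iid D n {Z | lam * Real.log (2 / b) / n ≤ |T.minLoss (full Z) - T.minLoss (dropEntry Z i)|}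
      ≤ ENNReal.ofReal b
  /-- upper tail of the least empirical loss -/
  tail : ∀ b : ℝ, 0 < b → ∀ n : ℕ, 0 < n →
    iid D n {Z | sig ^ 2 * (1 + Real.log (1 / b) / n) ≤ T.minLoss (full Z)} ≤ ENNReal.ofReal b

/-- `I 0 < I 1 < ⋯ < I (κ-1)` are non-empty intervals, listed from left to right, that
partition the set `A` of reals. -/
structure IsIntervalPartition {κ : ℕ} (I : Fin κ → Set ℝ) (A : Set ℝ) : Prop where
  nonempty : ∀ i, (I i).Nonempty
  interval : ∀ i, (I i).OrdConnected
  ordered : ∀ i j, i < j → ∀ a ∈ I i, ∀ b ∈ I j, a < b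
  cover : ⋃ i, I i = A

/-! ## Randomized real random access programs with subsampling and an oracle

Memory cells hold real numbers. Every instruction and every test of a branch or loop takes unit
time, also the drawing of a subsample and the call of the oracle. A program is a finite
object; it sees the dataset only through the oracle. -/

/-- Unit-time instructions; `x, y, z` are addresses of memory cells. -/
inductive Instr where
  /-- `mem[x] := q` -/
  | const (x : ℕ) (q : ℚ)
  /-- `mem[x] := mem[y] + mem[z]` -/
  | add (x y z : ℕ)
  /-- `mem[x] := mem[y] - mem[z]` -/
  | sub (x y z : ℕ)
  /-- `mem[x] := mem[y] * mem[z]` -/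
  | mul (x y z : ℕ)
  /-- `mem[x] := mem[y] / mem[z]` -/
  | div (x y z : ℕ)
  /-- `mem[x] := exp mem[y]` -/
  | exp (x y : ℕ)
  /-- `mem[x] := log mem[y]` -/
  | log (x y : ℕ)
  /-- `mem[x] := ⌊mem[y]⌋` -/
  | floor (x y : ℕ)
  /-- indirect read: `mem[x] := mem[⌊mem[y]⌋]` -/
  | load (x y : ℕ)
  /-- indirect write: `mem[⌊mem[x]⌋] := mem[y]` -/
  | store (x y : ℕ)
  /-- `mem[x] := 1` with probability `mem[y]` (clamped to `[0,1]`), and `mem[x] := 0` otherwise -/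
  | flip (x y : ℕ)
  /-- `mem[x] :=` a uniformly random element of `{0, 1, …, ⌊mem[y]⌋}` -/
  | unif (x y : ℕ)
  /-- draw a new subsample that keeps each entry of the dataset independently with
  probability `mem[y]` (clamped to `[0,1]`); it replaces the current subsample -/
  | draw (y : ℕ)
  /-- `mem[x] :=` the oracle's answer for the index `⌊mem[y]⌋` and the current subsample -/
  | query (x y : ℕ)

/-- Structured programs. -/
inductive Prog where
  | instr (c : Instr)
  | seq (P Q : Prog)
  /-- if `mem[x] < mem[y]` then `P` else `Q` -/
  | ite (x y : ℕ) (P Q : Prog)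
  /-- while `mem[x] < mem[y]` do `P` -/
  | loop (x y : ℕ) (P : Prog)

/-- A store: the memory and the current subsample (the set of kept positions). -/
structure Store (n : ℕ) where
  mem : ℕ → ℝ
  sel : Finset (Fin n)

def Store.set {n : ℕ} (s : Store n) (x : ℕ) (v : ℝ) : Store n :=
  { s with mem := Function.update s.mem x v }

/-- A real number clamped to `[0,1]`, as a probability. -/
def clampProb (q : ℝ) : ℝ≥0∞ := ENNReal.ofReal (max 0 (min 1 q))

theorem clampProb_le_one (q : ℝ) : clampProb q ≤ 1 := by
  unfold clampProb
  rw [← ENNReal.ofReal_one]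
  exact ENNReal.ofReal_le_ofReal (max_le zero_le_one (min_le_left _ _))

/-- A coin that shows `true` with probability `q` (clamped to `[0,1]`). -/
def coin (q : ℝ) : PMF Bool :=
  PMF.ofFintype (fun b => if b then clampProb q else 1 - clampProb q) (by
    simp [add_tsub_cancel_of_le (clampProb_le_one q)])

/-- The random subset of `Fin n` that contains each position independently with probability `q`
(clamped to `[0,1]`). -/
def randomSubset (n : ℕ) (q : ℝ) : PMF (Finset (Fin n)) :=
  PMF.ofFintype (fun S => clampProb q ^ S.card * (1 - clampProb q) ^ (n - S.card)) (by
    have h := Finset.sum_pow_mul_eq_add_pow (clampProb q) (1 - clampProb q)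
      (Finset.univ : Finset (Fin n))
    rw [add_tsub_cancel_of_le (clampProb_le_one q)] at h
    simpa using h)

/-- Effect of an instruction; `orc i S` is the oracle's answer for index `i` and subsample `S`. -/
def Instr.exec {n : ℕ} (orc : ℕ → Finset (Fin n) → ℝ) (s : Store n) : Instr → PMF (Store n)
  | .const x q => PMF.pure (s.set x (q : ℝ))
  | .add x y z => PMF.pure (s.set x (s.mem y + s.mem z))
  | .sub x y z => PMF.pure (s.set x (s.mem y - s.mem z))
  | .mul x y z => PMF.pure (s.set x (s.mem y * s.mem z))
  | .div x y z => PMF.pure (s.set x (s.mem y / s.mem z))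
  | .exp x y => PMF.pure (s.set x (Real.exp (s.mem y)))
  | .log x y => PMF.pure (s.set x (Real.log (s.mem y)))
  | .floor x y => PMF.pure (s.set x (⌊s.mem y⌋ : ℝ))
  | .load x y => PMF.pure (s.set x (s.mem ⌊s.mem y⌋₊))
  | .store x y => PMF.pure (s.set ⌊s.mem x⌋₊ (s.mem y))
  | .flip x y => (coin (s.mem y)).map fun b => s.set x (if b then 1 else 0)
  | .unif x y => (PMF.uniformOfFintype (Fin (⌊s.mem y⌋₊ + 1))).map fun k => s.set x ((k : ℕ) : ℝ)
  | .draw y => (randomSubset n (s.mem y)).map fun S => { s with sel := S }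
  | .query x y => PMF.pure (s.set x (orc ⌊s.mem y⌋₊ s.sel))

/-- A configuration: the programs that remain to be executed, first one first, and the store.
The computation has halted when nothing remains. -/
abbrev Config (n : ℕ) := List Prog × Store n

/-- One step of computation. -/
def step {n : ℕ} (orc : ℕ → Finset (Fin n) → ℝ) : Config n → PMF (Config n)
  | ([], s) => PMF.pure ([], s)
  | (.instr c :: k, s) => (c.exec orc s).map fun s' => (k, s')
  | (.seq P Q :: k, s) => PMF.pure (P :: Q :: k, s)
  | (.ite x y P Q :: k, s) => PMF.pure ((if s.mem x < s.mem y then P else Q) :: k, s)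
  | (.loop x y P :: k, s) =>
      PMF.pure (if s.mem x < s.mem y then P :: .loop x y P :: k else k, s)

/-- Distribution of the configuration after `t` steps. -/
def runFor {n : ℕ} (orc : ℕ → Finset (Fin n) → ℝ) (c : Config n) : ℕ → PMF (Config n)
  | 0 => PMF.pure c
  | t + 1 => (runFor orc c t).bind (step orc)

/-- The initial configuration with input `inp` in memory and an empty subsample. -/
def initConfig (n : ℕ) (P : Prog) (inp : ℕ → ℝ) : Config n := ([P], ⟨inp, ∅⟩)

/-- Expected number of steps until the program halts, `∑_t Pr[not halted after t steps]`
(which is `∞` if the program fails to halt with positive probability). -/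
def expectedTime {n : ℕ} (orc : ℕ → Finset (Fin n) → ℝ) (P : Prog) (inp : ℕ → ℝ) : ℝ≥0∞ :=
  ∑' t : ℕ, (runFor orc (initConfig n P inp) t).toOuterMeasure {c | c.1 ≠ []}

/-- Probability that the program halts and that its output, the number in cell `0` rounded down,
is in `E`. -/
def outputProb {n : ℕ} (orc : ℕ → Finset (Fin n) → ℝ) (P : Prog) (inp : ℕ → ℝ)
    (E : Set ℕ) : ℝ≥0∞ :=
  ⨆ t : ℕ, (runFor orc (initConfig n P inp) t).toOuterMeasure
    {c | c.1 = [] ∧ ⌊c.2.mem 0⌋₊ ∈ E}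

/-! ## Mechanisms and privacy -/

/-- Query access to the functions `S ↦ L^{(π)}(S)` on subsamples `S` of `Z`, for the intervals `π`
of a family. -/
def lossOracle {d : ℕ} {𝒵 : Type*} [MeasurableSpace 𝒵] (T : LossModel d 𝒵) {κ : ℕ}
    (I : Fin κ → Set ℝ) {n : ℕ} (Z : Fin n → 𝒵) : ℕ → Finset (Fin n) → ℝ :=
  fun i S => if h : i < κ then T.minLossOn (I ⟨i, h⟩) (subsample Z S) else 0

/-- Input memory: the public parameters in the first eight cells, zeros elsewhere. -/
def inputMem (κ n : ℕ) (ε δ β α ρ p : ℝ) : ℕ → ℝ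
  | 0 => κ
  | 1 => n
  | 2 => ε
  | 3 => δ
  | 4 => β
  | 5 => α
  | 6 => ρ
  | 7 => p
  | _ => 0

/-- Two datasets are neighbors if they differ in exactly one position. -/
def Neighbors {𝒵 : Type*} {n : ℕ} (Z Z' : Fin n → 𝒵) : Prop := ∃! i, Z i ≠ Z' i

/-- `(ε, δ)`-differential privacy of a mechanism with outputs in `ℕ`; `A Z E` is the probability
of an output in `E` on the dataset `Z`. -/
def IsDP {𝒵 : Type*} {n : ℕ} (ε δ : ℝ) (A : (Fin n → 𝒵) → Set ℕ → ℝ≥0∞) : Prop :=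
  ∀ Z Z' : Fin n → 𝒵, Neighbors Z Z' → ∀ E : Set ℕ,
    A Z E ≤ ENNReal.ofReal (Real.exp ε) * A Z' E + ENNReal.ofReal δ

end PrivEst

end

open PrivEst

open MeasureTheory
open scoped ENNReal
open PrivEst

noncomputable section

namespace PrivEst

/-! ### Runs that halt within a fixed number of steps -/

section Semantics

variable {n : ℕ} {orc : ℕ → Finset (Fin n) → ℝ}

/-! The mechanism draws `N = numSamples` independent subsamples, each keeping every entry with
probability `p`, and records for each subsample the loss of every interval together with the least
of these losses, which is `L(S)`. An interval is scored by comparing sizes of lower level sets: its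
score is small if, at some threshold `t`, many subsamples have `L(S) ≤ t` but few have an interval
loss of at most `t + 8pα²`. Sizes below `r = minCount` are rounded up to `r`, so scores lie between
`1` and `N/r`. An index is output with probability proportional to `score ^ c`, where `c = ε / (2
log (1/(1-2p)))`.

Privacy. Compare each subsample with the one where the changed entry `i₀` is erased. Erasing lowers
losses (`lossOracle_erase_le`), and the erased lists look the same for both neighbors. The level
sets of the erased list are chosen independently of which subsamples contain `i₀`, so by
`chernoff_membership` a fraction of at most `2p` of each level set of size at least `r` contains
`i₀`, except with probability `δ` (`sum_not_mostlyMissing`). Outside that event all rounded counts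
of the two neighbors agree up to a factor `1/(1-2p)` (`cnt_comparison`), and hence so do the scores
(`score_le_mul`). Weights then change by at most `exp (ε/2)` and selection probabilities by at most
`exp ε` (`selProb_le_mul`).

Accuracy. The entries kept by a fixed `S` are an i.i.d. sample of size `|S|`, so the assumption
applies to each subsample of typical size. The interval of `θ(D)` then has loss at most `L(S) + pα²`
(`minLossOn_le_of_mem`), and a far interval at least `L(S) + 20pα²` (`le_minLossOn_of_far`). It
remains to compare different subsamples: `L(S)` must stay within `7pα²/2` of a fixed number.
Leave-one-out stability bounds the effect of single entries only with high probability, so ordinary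
bounded differences do not apply; `exists_subgaussian_modification` changes the function on few
subsets to make it sub-Gaussian. If all subsamples are typical, the right interval has score `N/r`,
all far ones have score `1`, and `N/r` is large enough for the right interval to dominate
(`mechProb_ge`).

Running time. The number of steps has a bound that does not depend on the coins (`mechanism_ends`).
It is of order `κ N²`, and `N` is about `r` times the exponential that makes `(N/r) ^ c` at least
`2κ/β` when `κ ≥ 2`. -/

theorem runFor_succ_head (c : Config n) (t : ℕ) :
    runFor orc c (t + 1) = (step orc c).bind fun c' => runFor orc c' t := by
  induction t generalizing c with
  | zero => simp [runFor]
  | succ t ih =>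
    rw [runFor, ih, PMF.bind_bind]
    rfl

theorem toOuterMeasure_bind_eq_tsum {α β : Type*} (p : PMF α) (f : α → PMF β) (s : Set β) :
    (p.bind f).toOuterMeasure s = ∑' a, p a * (f a).toOuterMeasure s :=
  PMF.toOuterMeasure_bind_apply p f s

/-- From the configuration `c` the program halts within `τ` steps, and its output lies in `E` with
probability `v E`. -/
def Ends (orc : ℕ → Finset (Fin n) → ℝ) (c : Config n) (τ : ℕ) (v : Set ℕ → ℝ≥0∞) : Prop :=
  ∀ t, τ ≤ t → ∀ E : Set ℕ,
    (runFor orc c t).toOuterMeasure {c | c.1 = [] ∧ ⌊c.2.mem 0⌋₊ ∈ E} = v E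

theorem Ends.mono {c : Config n} {τ τ' : ℕ} {v : Set ℕ → ℝ≥0∞} (h : Ends orc c τ v)
    (hτ : τ ≤ τ') : Ends orc c τ' v := fun t ht E => h t (hτ.trans ht) E

theorem Ends.congr {c : Config n} {τ : ℕ} {v v' : Set ℕ → ℝ≥0∞} (h : Ends orc c τ v)
    (hv : ∀ E, v E = v' E) : Ends orc c τ v' := fun t ht E => (h t ht E).trans (hv E)

theorem runFor_nil (s : Store n) (t : ℕ) : runFor orc ([], s) t = PMF.pure ([], s) := by
  induction t with
  | zero => rfl
  | succ t ih => rw [runFor_succ_head]; simp [step, ih]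

open Classical in
theorem ends_nil (s : Store n) :
    Ends orc ([], s) 0 fun E => if ⌊s.mem 0⌋₊ ∈ E then 1 else 0 := by
  intro t _ E
  rw [runFor_nil, PMF.toOuterMeasure_pure_apply]
  simp

theorem Ends.bind {c : Config n} {τ : ℕ} {α : Type*} {q : PMF α} {f : α → Config n}
    (hc : step orc c = q.map f) {v : α → Set ℕ → ℝ≥0∞} (h : ∀ a, Ends orc (f a) τ (v a)) :
    Ends orc c (τ + 1) fun E => ∑' a, q a * v a E := by
  intro t ht E
  obtain ⟨t, rfl⟩ : ∃ t', t = t' + 1 := ⟨t - 1, by omega⟩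
  rw [runFor_succ_head, hc, PMF.bind_map, toOuterMeasure_bind_eq_tsum]
  refine tsum_congr fun a => ?_
  rw [Function.comp_apply, h a t (by omega) E]

theorem Ends.pure {c c' : Config n} {τ : ℕ} {v : Set ℕ → ℝ≥0∞}
    (hc : step orc c = PMF.pure c') (h : Ends orc c' τ v) : Ends orc c (τ + 1) v := by
  intro t ht E
  obtain ⟨t, rfl⟩ : ∃ t', t = t' + 1 := ⟨t - 1, by omega⟩
  rw [runFor_succ_head, hc, PMF.pure_bind]
  exact h t (by omega) E

/-- A halted configuration is a fixed point of `step`, so no mass leaves the event. The supremum in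
`outputProb` is therefore the eventual value. -/
theorem toOuterMeasure_halted_mono (c : Config n) (E : Set ℕ) :
    Monotone fun t => (runFor orc c t).toOuterMeasure {c | c.1 = [] ∧ ⌊c.2.mem 0⌋₊ ∈ E} := by
  refine monotone_nat_of_le_succ fun t => ?_
  change _ ≤ ((runFor orc c t).bind (step orc)).toOuterMeasure _
  rw [toOuterMeasure_bind_eq_tsum, PMF.toOuterMeasure_apply]
  refine ENNReal.tsum_le_tsum fun c' => ?_
  obtain ⟨k, s⟩ := c'
  by_cases hc : (k, s) ∈ {c : Config n | c.1 = [] ∧ ⌊c.2.mem 0⌋₊ ∈ E}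
  · rw [Set.indicator_of_mem hc]
    obtain ⟨rfl, h2⟩ : k = [] ∧ ⌊s.mem 0⌋₊ ∈ E := hc
    simp [step, PMF.toOuterMeasure_pure_apply, h2]
  · rw [Set.indicator_of_notMem hc]
    exact zero_le

theorem Ends.outputProb_eq {P : Prog} {inp : ℕ → ℝ} {τ : ℕ} {v : Set ℕ → ℝ≥0∞}
    (h : Ends orc (initConfig n P inp) τ v) (E : Set ℕ) : outputProb orc P inp E = v E := by
  apply le_antisymm
  · refine iSup_le fun t => ?_
    rw [← h (t + τ) (by omega) E]
    exact toOuterMeasure_halted_mono _ _ (by omega)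
  · rw [← h τ le_rfl E]
    exact le_iSup (fun t => (runFor orc (initConfig n P inp) t).toOuterMeasure
      {c | c.1 = [] ∧ ⌊c.2.mem 0⌋₊ ∈ E}) τ

/-- Total output mass `1` means that everything has halted by time `τ`; only `τ` terms of the series
survive, each at most `1`. -/
theorem Ends.expectedTime_le {P : Prog} {inp : ℕ → ℝ} {τ : ℕ} {v : Set ℕ → ℝ≥0∞}
    (h : Ends orc (initConfig n P inp) τ v) (hv : v Set.univ = 1) :
    expectedTime orc P inp ≤ τ := by
  have hle : ∀ t (E : Set (Config n)), (runFor orc (initConfig n P inp) t).toOuterMeasure E ≤ 1 := by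
    intro t E
    rw [PMF.toOuterMeasure_apply, ← (runFor orc (initConfig n P inp) t).tsum_coe]
    exact ENNReal.tsum_le_tsum fun c => Set.indicator_le_self _ _ _
  have hzero : ∀ t, t ∉ Finset.range τ →
      (runFor orc (initConfig n P inp) t).toOuterMeasure {c | c.1 ≠ []} = 0 := by
    intro t ht
    have h1 := h t (by simpa using ht) Set.univ
    rw [hv, PMF.toOuterMeasure_apply_eq_one_iff] at h1
    rw [PMF.toOuterMeasure_apply_eq_zero_iff, Set.disjoint_left]
    intro c hc hc'
    exact hc' (h1 hc).1
  unfold expectedTime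
  rw [tsum_eq_sum hzero]
  calc _ ≤ ∑ t ∈ Finset.range τ, (1 : ℝ≥0∞) := Finset.sum_le_sum fun t _ => hle t _
    _ = τ := by simp

/-! ### Deterministic program fragments -/

/-- Started from `s`, the program `P` reaches the store `s'` deterministically, within `a` steps. -/
def Det (orc : ℕ → Finset (Fin n) → ℝ) (P : Prog) (s s' : Store n) (a : ℕ) : Prop :=
  ∀ (k : List Prog) (τ : ℕ) (v : Set ℕ → ℝ≥0∞), Ends orc (k, s') τ v →
    Ends orc (P :: k, s) (τ + a) v

theorem Det.mono {P : Prog} {s s' : Store n} {a b : ℕ} (h : Det orc P s s' a) (hab : a ≤ b) :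
    Det orc P s s' b := fun k τ v hv => (h k τ v hv).mono (by omega)

theorem Det.seq {P Q : Prog} {s s₁ s₂ : Store n} {a b : ℕ} (hP : Det orc P s s₁ a)
    (hQ : Det orc Q s₁ s₂ b) : Det orc (.seq P Q) s s₂ (a + b + 1) := by
  intro k τ v hv
  exact (Ends.pure (c' := (P :: Q :: k, s)) rfl (hP _ _ _ (hQ _ _ _ hv))).mono (by omega)

theorem Det.ite {x y : ℕ} {P Q : Prog} {s s' : Store n} {a : ℕ}
    (h : Det orc (if s.mem x < s.mem y then P else Q) s s' a) :
    Det orc (.ite x y P Q) s s' (a + 1) := by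
  intro k τ v hv
  exact Ends.pure rfl (h _ _ _ hv)

/-- The store after a deterministic instruction. -/
def Instr.after (orc : ℕ → Finset (Fin n) → ℝ) (s : Store n) : Instr → Store n
  | .const x q => s.set x (q : ℝ)
  | .add x y z => s.set x (s.mem y + s.mem z)
  | .sub x y z => s.set x (s.mem y - s.mem z)
  | .mul x y z => s.set x (s.mem y * s.mem z)
  | .div x y z => s.set x (s.mem y / s.mem z)
  | .exp x y => s.set x (Real.exp (s.mem y))
  | .log x y => s.set x (Real.log (s.mem y))
  | .floor x y => s.set x (⌊s.mem y⌋ : ℝ)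
  | .load x y => s.set x (s.mem ⌊s.mem y⌋₊)
  | .store x y => s.set ⌊s.mem x⌋₊ (s.mem y)
  | .flip _ _ => s
  | .unif _ _ => s
  | .draw _ => s
  | .query x y => s.set x (orc ⌊s.mem y⌋₊ s.sel)

/-- Instructions that do not use randomness. -/
def Instr.IsDet : Instr → Prop
  | .flip _ _ => False
  | .unif _ _ => False
  | .draw _ => False
  | _ => True

theorem Instr.exec_eq_pure {c : Instr} (hc : c.IsDet) (s : Store n) :
    c.exec orc s = PMF.pure (c.after orc s) := by
  cases c <;> first | rfl | exact hc.elim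

theorem Det.instr {c : Instr} (hc : c.IsDet) (s : Store n) :
    Det orc (.instr c) s (c.after orc s) 1 := by
  intro k τ v hv
  refine Ends.pure ?_ hv
  change (c.exec orc s).map _ = _
  rw [Instr.exec_eq_pure hc, PMF.pure_map]

/-- A sequence of programs. -/
def Prog.block (P : Prog) : List Prog → Prog
  | [] => P
  | Q :: l => .seq P (Prog.block Q l)

/-- A sequence of instructions. -/
def Prog.line (c : Instr) : List Instr → Prog
  | [] => .instr c
  | c' :: l => .seq (.instr c) (Prog.line c' l)

theorem Det.line (c : Instr) (l : List Instr) (hc : c.IsDet) (hl : ∀ c ∈ l, c.IsDet)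
    (s : Store n) :
    Det orc (Prog.line c l) s (l.foldl (Instr.after orc) (c.after orc s)) (2 * l.length + 1) := by
  induction l generalizing c s with
  | nil => exact Det.instr hc s
  | cons c' l ih =>
    refine ((Det.instr hc s).seq (ih c' (hl c' (by simp)) (fun d hd => hl d (by simp [hd]))
      (c.after orc s))).mono ?_
    simp only [List.length_cons]
    omega

/-- A loop whose guard holds exactly during the first `N` rounds. -/
theorem Det.loop {x y : ℕ} {P : Prog} {N a : ℕ} (Inv : ℕ → Store n → Prop)
    (hguard : ∀ i s, i ≤ N → Inv i s → (s.mem x < s.mem y ↔ i < N))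
    (hbody : ∀ i s, i < N → Inv i s → ∃ s', Det orc P s s' a ∧ Inv (i + 1) s')
    (s : Store n) (h0 : Inv 0 s) :
    ∃ s', Det orc (.loop x y P) s s' (N * (a + 1) + 1) ∧ Inv N s' := by
  -- Induction on the number `m` of remaining rounds, because the loop unfolds from its front.
  have key : ∀ m i s, i + m = N → Inv i s →
      ∃ s', Det orc (.loop x y P) s s' (m * (a + 1) + 1) ∧ Inv N s' := by
    intro m
    induction m with
    | zero =>
      intro i s hi hs
      obtain rfl : i = N := by omega
      refine ⟨s, fun k τ v hv => ?_, hs⟩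
      have hg : ¬ s.mem x < s.mem y := by rw [hguard i s le_rfl hs]; simp
      refine (Ends.pure (c' := (k, s)) ?_ hv).mono (by omega)
      simp [step, hg]
    | succ m ih =>
      intro i s hi hs
      obtain ⟨s₁, hd, hs₁⟩ := hbody i s (by omega) hs
      obtain ⟨s₂, hd', hs₂⟩ := ih (i + 1) s₁ (by omega) hs₁
      refine ⟨s₂, fun k τ v hv => ?_, hs₂⟩
      have hg : s.mem x < s.mem y := by rw [hguard i s (by omega) hs]; omega
      refine (Ends.pure (c' := (P :: .loop x y P :: k, s)) ?_ (hd _ _ _ (hd' _ _ _ hv))).mono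
        (by ring_nf; omega)
      simp [step, hg]
  exact key N 0 s (by omega) h0

end Semantics

/-! ### The mechanism -/

section Scores

variable {σ : Type*}

/-- The least of the answers for the indices below `i` (and the index `0`). -/
def rowMin (orc : ℕ → σ → ℝ) (S : σ) : ℕ → ℝ
  | 0 => orc 0 S
  | i + 1 => min (orc i S) (rowMin orc S i)

/-- The answers for the indices below `κ`, followed by their minimum. -/
def column (orc : ℕ → σ → ℝ) (κ : ℕ) (i : ℕ) (S : σ) : ℝ :=
  if i = κ then rowMin orc S κ else orc i S

/-- The number of entries `x 0, …, x (N-1)` that are at most `t`. -/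
def cnt (N : ℕ) (x : ℕ → ℝ) (t : ℝ) : ℕ := ((Finset.range N).filter fun j => x j ≤ t).card

/-- Both quantities that bound the score, at the threshold `t`: how large the lower level set of `y`
at `t + h` is, and how small that of `x` at `t` is, where sizes below `r` are rounded up to `r`. -/
def level (N : ℕ) (r h : ℝ) (x y : ℕ → ℝ) (t : ℝ) : ℝ :=
  max (max (cnt N y (t + h) : ℝ) r / r) (N / max (cnt N x t : ℝ) r)

/-- The least value of `level` at the thresholds `x 0, …, x (m-1)`, but at most `N / r`. -/
def scoreTo (N : ℕ) (r h : ℝ) (x y : ℕ → ℝ) : ℕ → ℝ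
  | 0 => N / r
  | m + 1 => min (scoreTo N r h x y m) (level N r h x y (x m))

/-- The score that compares the samples `y` to the samples `x`. -/
def score (N : ℕ) (r h : ℝ) (x y : ℕ → ℝ) : ℝ := scoreTo N r h x y N

/-- The weight of the index `i` for the list `ω` of subsamples. -/
def weight (orc : ℕ → σ → ℝ) (κ N : ℕ) (r h c : ℝ) (ω : ℕ → σ) (i : ℕ) : ℝ :=
  Real.exp (c * Real.log
    (score N r h (fun j => column orc κ κ (ω j)) (fun j => column orc κ i (ω j))))

end Scores

/-- `log (1 / (1 - 2p))`. -/
def logGap (p : ℝ) : ℝ := 0 - Real.log (1 - 2 * p)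

/-- The least number of subsamples in a level set for which privacy can be ensured. -/
def minCount (κ : ℕ) (δ p : ℝ) : ℝ := 8 / p * Real.log (16 * (κ + 1) * (1 + 1 / δ) / p)

/-- The number of subsamples, as a real number before rounding. -/
def rawCount (κ : ℕ) (ε δ β p : ℝ) : ℝ :=
  minCount κ δ p * Real.exp (8 / ε * logGap p * Real.log κ * Real.log (2 / β))

/-- The number of subsamples. -/
def numSamples (κ : ℕ) (ε δ β p : ℝ) : ℕ := ⌊rawCount κ ε δ β p⌋₊ + 1

/-- No effect but on cell `36`. -/
def nop : Prog := .instr (.add 36 9 9)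

/-- Computation of the constants. -/
def setupProg : Prog := Prog.line (.const 8 1) [.const 9 0, .add 10 0 8, .const 15 64,
  .const 30 2, .mul 31 30 7, .sub 31 8 31, .log 31 31, .sub 31 9 31,
  .const 32 16, .mul 33 32 10, .div 34 8 3, .add 34 8 34, .mul 33 33 34, .div 33 33 7,
  .log 33 33, .const 32 8, .div 34 32 7, .mul 11 34 33,
  .div 34 32 2, .mul 34 34 31, .log 33 0, .mul 34 34 33, .div 33 30 4, .log 33 33, .mul 34 34 33,
  .exp 34 34, .mul 34 11 34, .floor 34 34, .add 12 34 8,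
  .mul 13 32 7, .mul 13 13 5, .mul 13 13 5, .div 14 2 30, .div 14 14 31, .div 17 12 11,
  .const 18 0]

/-- Query of one index; maintains the minimum. -/
def queryBody : Prog := Prog.block (.instr (.query 32 31)) [.ite 32 30 (.instr (.add 30 32 9)) nop,
  Prog.line (.mul 33 18 10) [.add 33 33 31, .add 33 33 15, .store 33 32, .add 31 31 8]]

/-- Drawing of one subsample, and all queries to it. -/
def drawBody : Prog := Prog.block (.instr (.draw 7)) [Prog.line (.query 30 9) [.const 31 0],
  .loop 31 0 queryBody,
  Prog.line (.mul 33 18 10) [.add 33 33 0, .add 33 33 15, .store 33 30, .add 18 18 8]]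

/-- Counting of one subsample. -/
def countBody : Prog := Prog.block
  (Prog.line (.mul 33 32 10) [.add 33 33 15, .add 34 33 0, .load 35 34])
  [.ite 27 35 nop (.instr (.add 30 30 8)), Prog.line (.add 34 33 19) [.load 35 34],
   .ite 28 35 nop (.instr (.add 31 31 8)), .instr (.add 32 32 8)]

/-- Update of the score by one threshold. -/
def scoreBody : Prog := Prog.block
  (Prog.line (.mul 26 25 10) [.add 26 26 0, .add 26 26 15, .load 27 26, .add 28 27 13,
    .const 30 0, .const 31 0, .const 32 0])
  [.loop 32 12 countBody, .ite 30 11 (.instr (.add 30 11 9)) nop,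
   .ite 31 11 (.instr (.add 31 11 9)) nop, Prog.line (.div 31 31 11) [.div 30 12 30],
   .ite 31 30 (.instr (.add 31 30 9)) nop, .ite 31 24 (.instr (.add 24 31 9)) nop,
   .instr (.add 25 25 8)]

/-- Computation of the weight of one index. -/
def weightProg : Prog := Prog.block (Prog.line (.add 24 17 9) [.const 25 0])
  [.loop 25 12 scoreBody, Prog.line (.log 24 24) [.mul 24 14 24, .exp 24 24, .add 20 20 24,
    .div 24 24 20]]

/-- Reservoir sampling, one index. -/
def selectBody : Prog := Prog.block weightProg [.instr (.flip 24 24),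
  .ite 9 24 (.instr (.add 21 19 9)) nop, .instr (.add 19 19 8)]

/-- The mechanism. -/
def mechanism : Prog := Prog.block setupProg [.loop 18 12 drawBody,
  Prog.line (.const 19 0) [.const 20 0, .const 21 0], .loop 19 0 selectBody, .instr (.add 0 21 9)]

/-! ### The machine code computes the scores and weights -/

section Spec

variable {n : ℕ} {orc : ℕ → Finset (Fin n) → ℝ}

theorem exists_det_line {c : Instr} {l : List Instr} (hc : c.IsDet) (hl : ∀ c ∈ l, c.IsDet)
    {s : Store n} {Q : Store n → Prop} {a : ℕ} (ha : 2 * l.length + 1 ≤ a)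
    (h : Q (l.foldl (Instr.after orc) (c.after orc s))) :
    ∃ s', Det orc (Prog.line c l) s s' a ∧ Q s' :=
  ⟨_, (Det.line c l hc hl s).mono ha, h⟩

/-- Cell 9 holds zero so that adding it copies a cell. Cell 15 is the base address of the matrix of
answers and cell 10 the length of its rows, one row per subsample. Cell 17 is the cap of the score.
-/
structure Constants (s : Store n) (κ N : ℕ) (p r h c : ℝ) : Prop where
  h0 : s.mem 0 = κ
  h7 : s.mem 7 = p
  h8 : s.mem 8 = 1
  h9 : s.mem 9 = 0
  h10 : s.mem 10 = κ + 1
  h11 : s.mem 11 = r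
  h12 : s.mem 12 = N
  h13 : s.mem 13 = h
  h14 : s.mem 14 = c
  h15 : s.mem 15 = 64
  h17 : s.mem 17 = N / r

theorem setup_spec {κ : ℕ} {ε δ β α ρ p : ℝ} (hr : 0 ≤ rawCount κ ε δ β p) :
    ∃ s' : Store n, Det orc setupProg ⟨inputMem κ n ε δ β α ρ p, ∅⟩ s' 75 ∧
      Constants s' κ (numSamples κ ε δ β p) p (minCount κ δ p) (8 * p * α * α)
        (ε / 2 / logGap p) ∧ s'.mem 18 = 0 := by
  -- The machine rounds to an integer and `numSamples` to a natural number; they agree because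
  -- `rawCount` is non-negative.
  have hN : ((⌊rawCount κ ε δ β p⌋ : ℤ) : ℝ) + 1 = (numSamples κ ε δ β p : ℕ) := by
    rw [numSamples, ← natCast_floor_eq_intCast_floor hr]
    push_cast
    rfl
  unfold setupProg
  refine exists_det_line (c := .const 8 1) trivial ?_ ?_ ?_
  · simp [Instr.IsDet]
  · simp
  refine ⟨⟨?_, ?_, ?_, ?_, ?_, ?_, ?_, ?_, ?_, ?_, ?_⟩, ?_⟩ <;>
    simp [Instr.after, Store.set, inputMem, ← hN, rawCount, minCount, logGap]

theorem nop_det (s : Store n) : ∃ s', Det orc nop s s' 1 ∧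
    s'.sel = s.sel ∧ ∀ a, a ≠ 36 → s'.mem a = s.mem a := by
  refine ⟨_, Det.instr (c := .add 36 9 9) trivial s, rfl, fun a ha => ?_⟩
  simp [Instr.after, Store.set, ha]

theorem Instr.after_sel (c : Instr) (s : Store n) : (c.after orc s).sel = s.sel := by
  cases c <;> rfl

theorem iteL_spec (c : Instr) (hc : c.IsDet) (x y : ℕ) (s : Store n) :
    ∃ s', Det orc (.ite x y (.instr c) nop) s s' 2 ∧ s'.sel = s.sel ∧ ∀ a, a ≠ 36 →
      s'.mem a = if s.mem x < s.mem y then (c.after orc s).mem a else s.mem a := by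
  by_cases h : s.mem x < s.mem y
  · exact ⟨_, Det.ite (by rw [if_pos h]; exact Det.instr hc s), c.after_sel s, fun a _ => by simp [h]⟩
  · obtain ⟨s', h1, h2, h3⟩ := nop_det (orc := orc) s
    exact ⟨s', Det.ite (by rwa [if_neg h]), h2, fun a ha => by simp [h, h3 a ha]⟩

theorem iteR_spec (c : Instr) (hc : c.IsDet) (x y : ℕ) (s : Store n) :
    ∃ s', Det orc (.ite x y nop (.instr c)) s s' 2 ∧ s'.sel = s.sel ∧ ∀ a, a ≠ 36 →
      s'.mem a = if s.mem x < s.mem y then s.mem a else (c.after orc s).mem a := by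
  by_cases h : s.mem x < s.mem y
  · obtain ⟨s', h1, h2, h3⟩ := nop_det (orc := orc) s
    exact ⟨s', Det.ite (by rwa [if_pos h]), h2, fun a ha => by simp [h, h3 a ha]⟩
  · exact ⟨_, Det.ite (by rw [if_neg h]; exact Det.instr hc s), c.after_sel s, fun a _ => by simp [h]⟩

/-- The column of the matrix of answers that is stored in memory. -/
def Stored (s : Store n) (orc : ℕ → Finset (Fin n) → ℝ) (κ m : ℕ) (ω : ℕ → Finset (Fin n)) : Prop :=
  ∀ j < m, ∀ i ≤ κ, s.mem (64 + (j * (κ + 1) + i)) = column orc κ i (ω j)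

theorem cnt_succ (N : ℕ) (x : ℕ → ℝ) (t : ℝ) :
    cnt (N + 1) x t = cnt N x t + if x N ≤ t then 1 else 0 := by
  unfold cnt
  rw [Finset.range_add_one, Finset.filter_insert]
  split_ifs with h
  · rw [Finset.card_insert_of_notMem (by simp)]
  · simp

theorem floor_address (κ j i : ℕ) :
    ⌊(j : ℝ) * ((κ : ℝ) + 1) + 64 + i⌋₊ = 64 + (j * (κ + 1) + i) := by
  rw [show (j : ℝ) * ((κ : ℝ) + 1) + 64 + i = ((64 + (j * (κ + 1) + i) : ℕ) : ℝ) by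
    push_cast; ring, Nat.floor_natCast]

theorem floor_address' (κ j i : ℕ) :
    ⌊(j : ℝ) * ((κ : ℝ) + 1) + i + 64⌋₊ = 64 + (j * (κ + 1) + i) := by
  rw [← floor_address]
  ring_nf

/-- The frame condition leaves only cells 30 to 39 free to change. It protects the constants, the
two thresholds in cells 27 and 28, and the matrix, which starts at cell 64. -/
theorem countBody_spec {κ N i π : ℕ} {p r h c t u a b : ℝ} {ω : ℕ → Finset (Fin n)} {s : Store n}
    (hs : Constants s κ N p r h c) (hst : Stored s orc κ N ω) (hi : i < N) (hπ : π < κ)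
    (h19 : s.mem 19 = π) (h27 : s.mem 27 = t) (h28 : s.mem 28 = u) (h30 : s.mem 30 = a)
    (h31 : s.mem 31 = b) (h32 : s.mem 32 = i) :
    ∃ s', Det orc countBody s s' 25 ∧ (∀ x, x < 30 ∨ 40 ≤ x → s'.mem x = s.mem x) ∧
      s'.mem 30 = a + (if column orc κ κ (ω i) ≤ t then 1 else 0) ∧
      s'.mem 31 = b + (if column orc κ π (ω i) ≤ u then 1 else 0) ∧ s'.mem 32 = i + 1 := by
  obtain ⟨s₁, d₁, f₁, g₁, v₁⟩ : ∃ s', Det orc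
      (Prog.line (.mul 33 32 10) [.add 33 33 15, .add 34 33 0, .load 35 34]) s s' 7 ∧
      (∀ x, x < 33 ∨ 35 < x → s'.mem x = s.mem x) ∧ s'.mem 33 = i * (κ + 1) + 64 ∧
      s'.mem 35 = column orc κ κ (ω i) := by
    refine exists_det_line (c := .mul 33 32 10) trivial ?_ (by simp) ⟨?_, ?_, ?_⟩
    · simp [Instr.IsDet]
    · intro x hx
      have h1 : x ≠ 33 := by omega
      have h2 : x ≠ 34 := by omega
      have h3 : x ≠ 35 := by omega
      simp [Instr.after, Store.set, h1, h2, h3]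
    · simp [Instr.after, Store.set, h32, hs.h10, hs.h15]
    · simp [Instr.after, Store.set, h32, hs.h10, hs.h15, hs.h0, floor_address]
      rw [Function.update_of_ne (by omega), Function.update_of_ne (by omega), hst i hi κ le_rfl]
  obtain ⟨s₂, d₂, -, f₂⟩ := iteR_spec (orc := orc) (.add 30 30 8) trivial 27 35 s₁
  obtain ⟨s₃, d₃, f₃, v₃⟩ : ∃ s', Det orc (Prog.line (.add 34 33 19) [.load 35 34]) s₂ s' 3 ∧
      (∀ x, x < 34 ∨ 35 < x → s'.mem x = s₂.mem x) ∧ s'.mem 35 = column orc κ π (ω i) := by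
    refine exists_det_line (c := .add 34 33 19) trivial ?_ (by simp) ⟨?_, ?_⟩
    · simp [Instr.IsDet]
    · intro x hx
      have h2 : x ≠ 34 := by omega
      have h3 : x ≠ 35 := by omega
      simp [Instr.after, Store.set, h2, h3]
    · have m33 : s₂.mem 33 = i * (κ + 1) + 64 := by
        rw [f₂ 33 (by simp)]; simp [Instr.after, Store.set, g₁]
      have m19 : s₂.mem 19 = π := by
        rw [f₂ 19 (by simp)]; simp [Instr.after, Store.set, f₁ 19, h19]
      have mx : ∀ x, 64 ≤ x → s₂.mem x = s.mem x := by
        intro x hx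
        have h1 : x ≠ 30 := by omega
        rw [f₂ x (by omega)]; simp [Instr.after, Store.set, f₁ x (by omega), h1]
      simp [Instr.after, Store.set, m33, m19, floor_address]
      rw [Function.update_of_ne (by omega), mx _ (by omega), hst i hi π hπ.le]
  obtain ⟨s₄, d₄, -, f₄⟩ := iteR_spec (orc := orc) (.add 31 31 8) trivial 28 35 s₃
  refine ⟨_, (d₁.seq (d₂.seq (d₃.seq (d₄.seq (Det.instr (c := .add 32 32 8) trivial s₄))))).mono
    (by norm_num), ?_, ?_, ?_, ?_⟩
  · intro x hx
    have h1 : x ≠ 30 := by omega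
    have h2 : x ≠ 31 := by omega
    have h3 : x ≠ 32 := by omega
    simp [Instr.after, Store.set, h1, h2, h3, f₄ x (by omega), f₃ x (by omega), f₂ x (by omega),
      f₁ x (by omega)]
  · simp [Instr.after, Store.set, f₄ 30, f₃ 30, f₂ 30, f₁ 30, f₁ 27, f₁ 8, v₁, h27, h30, hs.h8]
    split_ifs <;> first | rfl | (exfalso; linarith) | simp
  · simp [Instr.after, Store.set, f₄ 31, f₃ 31, f₂ 31, f₁ 31, f₃ 28, f₂ 28, f₁ 28, f₃ 8, f₂ 8, f₁ 8,
      v₃, h28, h31, hs.h8]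
    split_ifs <;> first | rfl | (exfalso; linarith) | simp
  · simp [Instr.after, Store.set, f₄ 32, f₃ 32, f₂ 32, f₁ 32, f₄ 8, f₃ 8, f₂ 8, f₁ 8, h32, hs.h8]

theorem Constants.of_eq {κ N : ℕ} {p r h c : ℝ} {s s' : Store n} (hs : Constants s κ N p r h c)
    (hx : ∀ x < 18, s'.mem x = s.mem x) : Constants s' κ N p r h c :=
  ⟨by rw [hx 0 (by simp), hs.h0], by rw [hx 7 (by simp), hs.h7], by rw [hx 8 (by simp), hs.h8],
    by rw [hx 9 (by simp), hs.h9], by rw [hx 10 (by simp), hs.h10], by rw [hx 11 (by simp), hs.h11],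
    by rw [hx 12 (by simp), hs.h12], by rw [hx 13 (by simp), hs.h13],
    by rw [hx 14 (by simp), hs.h14], by rw [hx 15 (by simp), hs.h15],
    by rw [hx 17 (by simp), hs.h17]⟩

theorem Stored.of_eq {κ m : ℕ} {ω : ℕ → Finset (Fin n)} {s s' : Store n} (hs : Stored s orc κ m ω)
    (h : ∀ x, 64 ≤ x → s'.mem x = s.mem x) : Stored s' orc κ m ω := by
  intro j hj i hi
  rw [h _ (by omega), hs j hj i hi]

theorem countLoop_spec {κ N π : ℕ} {p r h c t u : ℝ} {ω : ℕ → Finset (Fin n)} {s : Store n}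
    (hs : Constants s κ N p r h c) (hst : Stored s orc κ N ω) (hπ : π < κ)
    (h19 : s.mem 19 = π) (h27 : s.mem 27 = t) (h28 : s.mem 28 = u) (h30 : s.mem 30 = 0)
    (h31 : s.mem 31 = 0) (h32 : s.mem 32 = 0) :
    ∃ s', Det orc (.loop 32 12 countBody) s s' (N * 26 + 1) ∧
      (∀ x, x < 30 ∨ 40 ≤ x → s'.mem x = s.mem x) ∧
      s'.mem 30 = cnt N (fun j => column orc κ κ (ω j)) t ∧
      s'.mem 31 = cnt N (fun j => column orc κ π (ω j)) u := by
  obtain ⟨s', hd, hi, h1, h2, -⟩ := Det.loop (orc := orc) (x := 32) (y := 12) (P := countBody)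
    (N := N) (a := 25)
    (fun i s' => (∀ x, x < 30 ∨ 40 ≤ x → s'.mem x = s.mem x) ∧
      s'.mem 30 = cnt i (fun j => column orc κ κ (ω j)) t ∧
      s'.mem 31 = cnt i (fun j => column orc κ π (ω j)) u ∧ s'.mem 32 = i)
    (fun i s' _ ⟨h1, _, _, h2⟩ => by
      rw [h2, h1 12 (by norm_num), hs.h12]
      exact Nat.cast_lt)
    (fun i s₁ hi ⟨e1, e2, e3, e4⟩ => by
      obtain ⟨s₂, d, f, g1, g2, g3⟩ := countBody_spec (hs.of_eq fun x hx => e1 x (by omega))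
        (hst.of_eq fun x hx => e1 x (by omega)) hi hπ ((e1 19 (by norm_num)).trans h19)
        ((e1 27 (by norm_num)).trans h27) ((e1 28 (by norm_num)).trans h28) e2 e3 e4
      refine ⟨s₂, d, fun x hx => (f x hx).trans (e1 x hx), ?_, ?_, ?_⟩
      · rw [g1, cnt_succ]; push_cast; rfl
      · rw [g2, cnt_succ]; push_cast; rfl
      · rw [g3]; push_cast; rfl)
    s ⟨fun _ _ => rfl, by simp [cnt, h30], by simp [cnt, h31], by simp [h32]⟩
  exact ⟨s', hd, hi, h1, h2⟩

end Spec

section Spec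

variable {n : ℕ} {orc : ℕ → Finset (Fin n) → ℝ}

/-- Each of the four conditional copies realizes a maximum or minimum: two round the counts up to
`r`, the third takes the larger ratio, and the last updates the running minimum. -/
theorem scoreBody_spec {κ N j π : ℕ} {p r h c e : ℝ} {ω : ℕ → Finset (Fin n)} {s : Store n}
    (hs : Constants s κ N p r h c) (hst : Stored s orc κ N ω) (hj : j < N) (hπ : π < κ)
    (h19 : s.mem 19 = π) (h24 : s.mem 24 = e) (h25 : s.mem 25 = j) :
    ∃ s', Det orc scoreBody s s' (N * 26 + 40) ∧ (∀ x, x < 24 ∨ 40 ≤ x → s'.mem x = s.mem x) ∧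
      s'.mem 24 = min e (level N r h (fun j => column orc κ κ (ω j))
        (fun j => column orc κ π (ω j)) (column orc κ κ (ω j))) ∧ s'.mem 25 = j + 1 := by
  obtain ⟨s₁, d₁, f₁, v27, v28, v30, v31, v32, v25⟩ : ∃ s', Det orc
      (Prog.line (.mul 26 25 10) [.add 26 26 0, .add 26 26 15, .load 27 26, .add 28 27 13,
        .const 30 0, .const 31 0, .const 32 0]) s s' 15 ∧
      (∀ x, x < 25 ∨ 40 ≤ x → s'.mem x = s.mem x) ∧ s'.mem 27 = column orc κ κ (ω j) ∧
      s'.mem 28 = column orc κ κ (ω j) + h ∧ s'.mem 30 = 0 ∧ s'.mem 31 = 0 ∧ s'.mem 32 = 0 ∧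
      s'.mem 25 = j := by
    have key : s.mem (64 + (j * (κ + 1) + κ)) = column orc κ κ (ω j) := hst j hj κ le_rfl
    refine exists_det_line (c := .mul 26 25 10) trivial ?_ (by simp) ⟨?_, ?_, ?_, ?_, ?_, ?_, ?_⟩
    · simp [Instr.IsDet]
    · intro x hx
      have h1 : x ≠ 26 := by omega
      have h2 : x ≠ 27 := by omega
      have h3 : x ≠ 28 := by omega
      have h4 : x ≠ 30 := by omega
      have h5 : x ≠ 31 := by omega
      have h6 : x ≠ 32 := by omega
      simp [Instr.after, Store.set, h1, h2, h3, h4, h5, h6]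
    · simp [Instr.after, Store.set, h25, hs.h10, hs.h0, hs.h15, floor_address']
      rw [Function.update_of_ne (by omega), key]
    · simp [Instr.after, Store.set, h25, hs.h10, hs.h0, hs.h15, hs.h13, floor_address']
      rw [Function.update_of_ne (by omega), key]
    all_goals simp [Instr.after, Store.set, h25]
  obtain ⟨s₂, d₂, f₂, w30, w31⟩ := countLoop_spec (hs.of_eq fun x hx => f₁ x (by omega))
    (hst.of_eq fun x hx => f₁ x (by omega)) hπ ((f₁ 19 (by norm_num)).trans h19) v27 v28 v30 v31 v32
  have g₂ : ∀ x, x < 25 ∨ 40 ≤ x → s₂.mem x = s.mem x := fun x hx =>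
    (f₂ x (by omega)).trans (f₁ x hx)
  set cm : ℝ := ((cnt N (fun j => column orc κ κ (ω j)) (column orc κ κ (ω j)) : ℕ) : ℝ) with hcm
  set cp : ℝ := ((cnt N (fun j => column orc κ π (ω j)) (column orc κ κ (ω j) + h) : ℕ) : ℝ) with hcp
  obtain ⟨s₃, d₃, -, f₃⟩ := iteL_spec (orc := orc) (.add 30 11 9) trivial 30 11 s₂
  have g₃ : ∀ x, x < 25 ∨ 40 ≤ x → s₃.mem x = s.mem x := fun x hx => by
    have h1 : x ≠ 30 := by omega
    rw [f₃ x (by omega)]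
    simp [Instr.after, Store.set, h1, g₂ x hx]
  have w₃ : s₃.mem 30 = max cm r := by
    rw [f₃ 30 (by simp)]
    simp [Instr.after, Store.set, w30, g₂ 11, g₂ 9, hs.h11, hs.h9]
    split_ifs with hlt
    · exact (max_eq_right hlt.le).symm
    · exact (max_eq_left (not_lt.1 hlt)).symm
  have w₃' : s₃.mem 31 = cp := by
    rw [f₃ 31 (by simp)]
    simp [Instr.after, Store.set, w31]
  have w₃'' : s₃.mem 25 = j := by
    rw [f₃ 25 (by simp)]
    simp [Instr.after, Store.set, f₂ 25, v25]
  obtain ⟨s₄, d₄, -, f₄⟩ := iteL_spec (orc := orc) (.add 31 11 9) trivial 31 11 s₃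
  have g₄ : ∀ x, x < 25 ∨ 40 ≤ x → s₄.mem x = s.mem x := fun x hx => by
    have h1 : x ≠ 31 := by omega
    rw [f₄ x (by omega)]
    simp [Instr.after, Store.set, h1, g₃ x hx]
  have w₄ : s₄.mem 31 = max cp r := by
    rw [f₄ 31 (by simp)]
    simp [Instr.after, Store.set, w₃', g₃ 11, g₃ 9, hs.h11, hs.h9]
    split_ifs with hlt
    · exact (max_eq_right hlt.le).symm
    · exact (max_eq_left (not_lt.1 hlt)).symm
  have w₄' : s₄.mem 30 = max cm r := by
    rw [f₄ 30 (by simp)]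
    simp [Instr.after, Store.set, w₃]
  have w₄'' : s₄.mem 25 = j := by
    rw [f₄ 25 (by simp)]
    simp [Instr.after, Store.set, w₃'']
  obtain ⟨s₅, d₅, g₅, w₅, w₅', w₅''⟩ : ∃ s', Det orc
      (Prog.line (.div 31 31 11) [.div 30 12 30]) s₄ s' 3 ∧
      (∀ x, x < 25 ∨ 40 ≤ x → s'.mem x = s.mem x) ∧ s'.mem 31 = max cp r / r ∧
      s'.mem 30 = N / max cm r ∧ s'.mem 25 = j := by
    refine exists_det_line (c := .div 31 31 11) trivial ?_ (by simp) ⟨?_, ?_, ?_, ?_⟩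
    · simp [Instr.IsDet]
    · intro x hx
      have h1 : x ≠ 31 := by omega
      have h2 : x ≠ 30 := by omega
      simp [Instr.after, Store.set, h1, h2, g₄ x hx]
    · simp [Instr.after, Store.set, w₄, g₄ 11, hs.h11]
    · simp [Instr.after, Store.set, w₄', g₄ 12, hs.h12]
    · simp [Instr.after, Store.set, w₄'']
  obtain ⟨s₆, d₆, -, f₆⟩ := iteL_spec (orc := orc) (.add 31 30 9) trivial 31 30 s₅
  have g₆ : ∀ x, x < 25 ∨ 40 ≤ x → s₆.mem x = s.mem x := fun x hx => by
    have h1 : x ≠ 31 := by omega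
    rw [f₆ x (by omega)]
    simp [Instr.after, Store.set, h1, g₅ x hx]
  have w₆ : s₆.mem 31 = max (max cp r / r) (N / max cm r) := by
    rw [f₆ 31 (by simp)]
    simp [Instr.after, Store.set, w₅, w₅', g₅ 9, hs.h9]
    split_ifs with hlt
    · exact (max_eq_right hlt.le).symm
    · exact (max_eq_left (not_lt.1 hlt)).symm
  have w₆' : s₆.mem 25 = j := by
    rw [f₆ 25 (by simp)]
    simp [Instr.after, Store.set, w₅'']
  obtain ⟨s₇, d₇, -, f₇⟩ := iteL_spec (orc := orc) (.add 24 31 9) trivial 31 24 s₆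
  refine ⟨_, (d₁.seq (d₂.seq (d₃.seq (d₄.seq (d₅.seq (d₆.seq (d₇.seq
    (Det.instr (c := .add 25 25 8) trivial s₇)))))))).mono (by omega), ?_, ?_, ?_⟩
  · intro x hx
    have h1 : x ≠ 25 := by omega
    have h2 : x ≠ 24 := by omega
    simp [Instr.after, Store.set, h1, h2, f₇ x (by omega), g₆ x (by omega)]
  · simp [Instr.after, Store.set, f₇ 24, w₆, g₆ 24, h24, g₆ 9, hs.h9, level]
    simp only [← max_lt_iff]
    split_ifs with hlt
    · exact (min_eq_right hlt.le).symm
    · exact (min_eq_left (not_lt.1 hlt)).symm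
  · simp [Instr.after, Store.set, f₇ 25, w₆', f₇ 8, g₆ 8, hs.h8]

/-- The final content of cell 24 is the probability with which reservoir sampling replaces its
current choice. -/
theorem weightProg_spec {κ N π : ℕ} {p r h c W : ℝ} {ω : ℕ → Finset (Fin n)} {s : Store n}
    (hs : Constants s κ N p r h c) (hst : Stored s orc κ N ω) (hπ : π < κ)
    (h19 : s.mem 19 = π) (h20 : s.mem 20 = W) :
    ∃ s', Det orc weightProg s s' (N * (N * 26 + 41) + 20) ∧
      (∀ x, x < 20 ∨ x = 21 ∨ 40 ≤ x → s'.mem x = s.mem x) ∧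
      s'.mem 20 = W + weight orc κ N r h c ω π ∧
      s'.mem 24 = weight orc κ N r h c ω π / (W + weight orc κ N r h c ω π) := by
  obtain ⟨s₁, d₁, f₁, v24, v25⟩ : ∃ s', Det orc
      (Prog.line (.add 24 17 9) [.const 25 0]) s s' 3 ∧
      (∀ x, x < 24 ∨ 40 ≤ x → s'.mem x = s.mem x) ∧ s'.mem 24 = N / r ∧ s'.mem 25 = 0 := by
    refine exists_det_line (c := .add 24 17 9) trivial ?_ (by simp) ⟨?_, ?_, ?_⟩
    · simp [Instr.IsDet]
    · intro x hx
      have h1 : x ≠ 24 := by omega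
      have h2 : x ≠ 25 := by omega
      simp [Instr.after, Store.set, h1, h2]
    · simp [Instr.after, Store.set, hs.h17, hs.h9]
    · simp [Instr.after, Store.set]
  obtain ⟨s₂, d₂, f₂, w24, -⟩ := Det.loop (orc := orc) (x := 25) (y := 12) (P := scoreBody)
    (N := N) (a := N * 26 + 40)
    (fun j s' => (∀ x, x < 24 ∨ 40 ≤ x → s'.mem x = s.mem x) ∧
      s'.mem 24 = scoreTo N r h (fun j => column orc κ κ (ω j)) (fun j => column orc κ π (ω j)) j ∧
      s'.mem 25 = j)
    (fun i s' _ ⟨h1, _, h2⟩ => by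
      rw [h2, h1 12 (by norm_num), hs.h12]
      exact Nat.cast_lt)
    (fun i s₁ hi ⟨e1, e2, e3⟩ => by
      obtain ⟨s₂, d, f, g1, g2⟩ := scoreBody_spec (hs.of_eq fun x hx => e1 x (by omega))
        (hst.of_eq fun x hx => e1 x (by omega)) hi hπ ((e1 19 (by norm_num)).trans h19) e2 e3
      refine ⟨s₂, d, fun x hx => (f x hx).trans (e1 x hx), g1, ?_⟩
      · rw [g2]; push_cast; rfl)
    s₁ ⟨f₁, by simp [scoreTo, v24], by simp [v25]⟩
  obtain ⟨s₃, d₃, h₃⟩ : ∃ s', Det orc (Prog.line (.log 24 24) [.mul 24 14 24, .exp 24 24,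
      .add 20 20 24, .div 24 24 20]) s₂ s' 9 ∧
      (∀ x, x < 20 ∨ x = 21 ∨ 40 ≤ x → s'.mem x = s.mem x) ∧
      s'.mem 20 = W + weight orc κ N r h c ω π ∧
      s'.mem 24 = weight orc κ N r h c ω π / (W + weight orc κ N r h c ω π) := by
    refine exists_det_line (c := .log 24 24) trivial ?_ (by simp) ⟨?_, ?_, ?_⟩
    · simp [Instr.IsDet]
    · intro x hx
      have h1 : x ≠ 24 := by omega
      have h2 : x ≠ 20 := by omega
      simp [Instr.after, Store.set, h1, h2, f₂ x (by omega)]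
    · simp [Instr.after, Store.set, w24, f₂ 14, f₂ 20, hs.h14, h20, weight, score]
    · simp [Instr.after, Store.set, w24, f₂ 14, f₂ 20, hs.h14, h20, weight, score]
  exact ⟨s₃, (d₁.seq (d₂.seq d₃)).mono (by rw [Nat.add_assoc (N * 26)]; omega), h₃⟩

theorem queryBody_spec {κ N i j : ℕ} {p r h c m : ℝ} {s : Store n}
    (hs : Constants s κ N p r h c)
    (h18 : s.mem 18 = j) (h30 : s.mem 30 = m) (h31 : s.mem 31 = i) :
    ∃ s', Det orc queryBody s s' 15 ∧ s'.sel = s.sel ∧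
      (∀ x, x < 30 ∨ 40 ≤ x → x ≠ 64 + (j * (κ + 1) + i) → s'.mem x = s.mem x) ∧
      s'.mem (64 + (j * (κ + 1) + i)) = orc i s.sel ∧ s'.mem 30 = min (orc i s.sel) m ∧
      s'.mem 31 = i + 1 := by
  obtain ⟨s₁, d₁, e₁⟩ : ∃ s₁, Det orc (.instr (.query 32 31)) s s₁ 1 ∧
      s₁ = s.set 32 (orc i s.sel) :=
    ⟨_, Det.instr (c := .query 32 31) trivial s, by simp [Instr.after, h31]⟩
  obtain ⟨s₂, d₂, hsel₂, f₂⟩ := iteL_spec (orc := orc) (.add 30 32 9) trivial 32 30 s₁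
  have g₂ : ∀ x, x ≠ 36 → x ≠ 30 → x ≠ 32 → s₂.mem x = s.mem x := fun x h1 h2 h3 => by
    rw [f₂ x h1]
    simp [Instr.after, Store.set, h2, h3, e₁]
  have w30 : s₂.mem 30 = min (orc i s.sel) m := by
    rw [f₂ 30 (by simp)]
    simp [Instr.after, Store.set, e₁, hs.h9, h30]
    split_ifs with hlt
    · exact (min_eq_left hlt.le).symm
    · exact (min_eq_right (not_lt.1 hlt)).symm
  have w32 : s₂.mem 32 = orc i s.sel := by
    rw [f₂ 32 (by simp)]
    simp [Instr.after, Store.set, e₁]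
  obtain ⟨s₃, d₃, h₃⟩ : ∃ s', Det orc (Prog.line (.mul 33 18 10)
      [.add 33 33 31, .add 33 33 15, .store 33 32, .add 31 31 8]) s₂ s' 9 ∧ s'.sel = s.sel ∧
      (∀ x, x < 30 ∨ 40 ≤ x → x ≠ 64 + (j * (κ + 1) + i) → s'.mem x = s.mem x) ∧
      s'.mem (64 + (j * (κ + 1) + i)) = orc i s.sel ∧ s'.mem 30 = min (orc i s.sel) m ∧
      s'.mem 31 = i + 1 := by
    refine exists_det_line (c := .mul 33 18 10) trivial ?_ (by simp) ⟨?_, ?_, ?_, ?_, ?_⟩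
    · simp [Instr.IsDet]
    · simp [Instr.after, Store.set, hsel₂, e₁]
    · intro x hx hxne
      have h1 : x ≠ 33 := by omega
      have h2 : x ≠ 31 := by omega
      simp [Instr.after, Store.set, h1, h2, g₂, h18, hs.h10, hs.h15, h31, floor_address', hxne]
      exact g₂ x (by omega) (by omega) (by omega)
    · have h1 : 64 + (j * (κ + 1) + i) ≠ 31 := by omega
      simp [Instr.after, Store.set, g₂, h18, hs.h10, hs.h15, h31, floor_address', h1, w32]
    · have h1 : 64 + (j * (κ + 1) + i) ≠ 30 := by omega
      simp [Instr.after, Store.set, g₂, h18, hs.h10, hs.h15, h31, floor_address', h1.symm, w30]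
    · have h1 : 64 + (j * (κ + 1) + i) ≠ 31 := by omega
      have h2 : 64 + (j * (κ + 1) + i) ≠ 8 := by omega
      simp [Instr.after, Store.set, g₂, h18, hs.h10, hs.h15, h31, floor_address', h1.symm, h2.symm,
        hs.h8]
  exact ⟨s₃, (d₁.seq (d₂.seq d₃)).mono (by omega), h₃⟩

/-- The draw is the only random instruction of the round. For each outcome `S` the remainder runs
deterministically and appends the row of `S` to the matrix, so the value is an average over `S`. -/
theorem drawBody_spec {κ N j : ℕ} {p r h c : ℝ} {ω : ℕ → Finset (Fin n)} {s : Store n}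
    (hs : Constants s κ N p r h c) (hst : Stored s orc κ j ω) (h18 : s.mem 18 = j)
    {k : List Prog} {τ : ℕ} {v : Finset (Fin n) → Set ℕ → ℝ≥0∞}
    (hk : ∀ (S : Finset (Fin n)) (s' : Store n), Constants s' κ N p r h c →
      Stored s' orc κ (j + 1) (Function.update ω j S) → s'.mem 18 = j + 1 →
      Ends orc (k, s') τ (v S)) :
    Ends orc (drawBody :: k, s) (τ + (κ * 16 + 20)) fun E => ∑' S, randomSubset n p S * v S E := by
  have hdraw : ∀ S : Finset (Fin n), ∃ s', Det orc (Prog.block (Prog.line (.query 30 9) [.const 31 0])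
      [.loop 31 0 queryBody,
      Prog.line (.mul 33 18 10) [.add 33 33 0, .add 33 33 15, .store 33 30, .add 18 18 8]])
      { s with sel := S } s' (κ * 16 + 15) ∧ Constants s' κ N p r h c ∧
      Stored s' orc κ (j + 1) (Function.update ω j S) ∧ s'.mem 18 = j + 1 := by
    intro S
    obtain ⟨s₁, d₁, hsel₁, f₁, v30, v31⟩ : ∃ s', Det orc (Prog.line (.query 30 9) [.const 31 0])
        { s with sel := S } s' 3 ∧ s'.sel = S ∧ (∀ x, x ≠ 30 → x ≠ 31 → s'.mem x = s.mem x) ∧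
        s'.mem 30 = orc 0 S ∧ s'.mem 31 = 0 := by
      refine exists_det_line (c := .query 30 9) trivial ?_ (by simp) ⟨?_, ?_, ?_, ?_⟩
      · simp [Instr.IsDet]
      · simp [Instr.after, Store.set]
      · intro x h1 h2
        simp [Instr.after, Store.set, h1, h2]
      · simp [Instr.after, Store.set, hs.h9]
      · simp [Instr.after, Store.set]
    obtain ⟨s₂, d₂, hsel₂, f₂, g₂, w30, -⟩ := Det.loop (orc := orc) (x := 31) (y := 0)
      (P := queryBody) (N := κ) (a := 15)
      (fun i s' => s'.sel = S ∧
        (∀ x, x < 30 ∨ 40 ≤ x → x < 64 + j * (κ + 1) → s'.mem x = s.mem x) ∧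
        (∀ i' < i, s'.mem (64 + (j * (κ + 1) + i')) = orc i' S) ∧ s'.mem 30 = rowMin orc S i ∧
        s'.mem 31 = i)
      (fun i s' _ ⟨_, h1, _, _, h2⟩ => by
        rw [h2, h1 0 (by norm_num) (by omega), hs.h0]
        exact Nat.cast_lt)
      (fun i s₁ _ ⟨e0, e1, e2, e3, e4⟩ => by
        obtain ⟨s₂, d, hsel, f, g1, g2, g3⟩ := queryBody_spec (orc := orc)
          (hs.of_eq fun x hx => e1 x (by omega) (by omega))
          ((e1 18 (by norm_num) (by omega)).trans h18) e3 e4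
        refine ⟨s₂, d, hsel.trans e0, fun x hx hx' => (f x hx (by omega)).trans (e1 x hx hx'), ?_,
          ?_, ?_⟩
        · intro i' hi'
          rcases Nat.lt_succ_iff_lt_or_eq.1 hi' with hlt | rfl
          · rw [f _ (by omega) (by omega), e2 i' hlt]
          · rw [g1, e0]
        · rw [g2, e0, rowMin]
        · rw [g3]; push_cast; rfl)
      -- The running minimum starts with the answer for index 0, as `rowMin` does; asking that index
      -- twice is harmless.
      s₁ ⟨hsel₁, fun x hx _ => f₁ x (by omega) (by omega), by simp, by simp [v30, rowMin],
        by simp [v31]⟩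
    have a18 : s₂.mem 18 = j := (f₂ 18 (by norm_num) (by omega)).trans h18
    have a10 : s₂.mem 10 = κ + 1 := (f₂ 10 (by norm_num) (by omega)).trans hs.h10
    have a15 : s₂.mem 15 = 64 := (f₂ 15 (by norm_num) (by omega)).trans hs.h15
    have a0 : s₂.mem 0 = κ := (f₂ 0 (by norm_num) (by omega)).trans hs.h0
    have a8 : s₂.mem 8 = 1 := (f₂ 8 (by norm_num) (by omega)).trans hs.h8
    obtain ⟨s₃, d₃, f₃, w, w18⟩ : ∃ s', Det orc (Prog.line (.mul 33 18 10)
        [.add 33 33 0, .add 33 33 15, .store 33 30, .add 18 18 8]) s₂ s' 9 ∧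
        (∀ x, x ≠ 33 → x ≠ 18 → x ≠ 64 + (j * (κ + 1) + κ) → s'.mem x = s₂.mem x) ∧
        s'.mem (64 + (j * (κ + 1) + κ)) = rowMin orc S κ ∧ s'.mem 18 = j + 1 := by
      refine exists_det_line (c := .mul 33 18 10) trivial ?_ (by simp) ⟨?_, ?_, ?_⟩
      · simp [Instr.IsDet]
      · intro x h1 h2 h3
        simp [Instr.after, Store.set, h1, h2, h3, a18, a10, a0, a15, floor_address']
      · have h1 : 64 + (j * (κ + 1) + κ) ≠ 18 := by omega
        simp [Instr.after, Store.set, a18, a10, a0, a15, floor_address', h1, w30]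
      · have h1 : 64 + (j * (κ + 1) + κ) ≠ 18 := by omega
        have h2 : 64 + (j * (κ + 1) + κ) ≠ 8 := by omega
        simp [Instr.after, Store.set, a18, a10, a0, a15, a8, floor_address', h1.symm, h2.symm]
    refine ⟨s₃, (d₁.seq (d₂.seq d₃)).mono (by omega), hs.of_eq fun x hx => ?_, ?_, w18⟩
    · rw [f₃ x (by omega) (by omega) (by omega), f₂ x (by omega) (by omega)]
    · intro j' hj' i hi
      rcases Nat.lt_succ_iff_lt_or_eq.1 hj' with hlt | rfl
      -- Row `j'` ends before row `j` starts, so earlier rows are not overwritten.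
      · have hb : j' * (κ + 1) + (κ + 1) ≤ j * (κ + 1) := by
          rw [← Nat.succ_mul]; exact Nat.mul_le_mul_right _ hlt
        rw [f₃ _ (by omega) (by omega) (by omega), f₂ _ (by omega) (by omega), hst j' hlt i hi,
          Function.update_of_ne hlt.ne]
      · rw [Function.update_self]
        rcases hi.lt_or_eq with hlt | rfl
        · rw [f₃ _ (by omega) (by omega) (by omega), g₂ i hlt, column, if_neg hlt.ne]
        · rw [w, column, if_pos rfl]
  set Q : Prog := Prog.block (Prog.line (.query 30 9) [.const 31 0]) [.loop 31 0 queryBody,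
      Prog.line (.mul 33 18 10) [.add 33 33 0, .add 33 33 15, .store 33 30, .add 18 18 8]] with hQ
  have key := Ends.bind (orc := orc) (c := (.instr (.draw 7) :: Q :: k, s))
    (q := randomSubset n p) (f := fun S => (Q :: k, { s with sel := S })) (τ := τ + (κ * 16 + 15))
    (v := v) (by simp only [step, Instr.exec, PMF.map_comp, hs.h7]; rfl) fun S => by
      obtain ⟨s', d, h1, h2, h3⟩ := hdraw S
      exact d _ _ _ (hk S s' h1 h2 h3)
  exact (Ends.pure (c := (drawBody :: k, s)) rfl key).mono (by omega)

end Spec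

/-! ### Reservoir sampling and the output distribution in closed form -/

section Selection

open Classical in
/-- The probability of the event `E` if `i < κ` is drawn with probability proportional to `w i`. -/
def selProb (w : ℕ → ℝ) (κ : ℕ) (E : Set ℕ) : ℝ :=
  (∑ i ∈ Finset.range κ, if i ∈ E then w i else 0) / ∑ i ∈ Finset.range κ, w i

/-- The probability that a random subset with inclusion probability `q` equals `S`. -/
def subsetProb {n : ℕ} (q : ℝ) (S : Finset (Fin n)) : ℝ := q ^ S.card * (1 - q) ^ (n - S.card)

/-- Extension of a finite list of subsets by the empty set. -/
def extendList {n N : ℕ} (η : Fin N → Finset (Fin n)) (j : ℕ) : Finset (Fin n) :=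
  if h : j < N then η ⟨j, h⟩ else ∅

variable {n : ℕ} {orc : ℕ → Finset (Fin n) → ℝ}

theorem subsetProb_nonneg {q : ℝ} (h0 : 0 ≤ q) (h1 : q ≤ 1) (S : Finset (Fin n)) :
    0 ≤ subsetProb q S :=
  mul_nonneg (pow_nonneg h0 _) (pow_nonneg (by linarith) _)

theorem clampProb_eq {q : ℝ} (h0 : 0 ≤ q) (h1 : q ≤ 1) : clampProb q = ENNReal.ofReal q := by
  rw [clampProb, min_eq_right h1, max_eq_right h0]

theorem randomSubset_apply {q : ℝ} (h0 : 0 ≤ q) (h1 : q ≤ 1) (S : Finset (Fin n)) :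
    randomSubset n q S = ENNReal.ofReal (subsetProb q S) := by
  have h : (1 : ℝ≥0∞) - ENNReal.ofReal q = ENNReal.ofReal (1 - q) := by
    rw [ENNReal.ofReal_sub _ h0, ENNReal.ofReal_one]
  rw [randomSubset, PMF.ofFintype_apply, clampProb_eq h0 h1, subsetProb, h,
    ENNReal.ofReal_mul (pow_nonneg h0 _), ENNReal.ofReal_pow h0, ENNReal.ofReal_pow (by linarith)]

theorem tsum_coin_mul {q : ℝ} (h0 : 0 ≤ q) (h1 : q ≤ 1) {a : Bool → ℝ} (ha : ∀ b, 0 ≤ a b) :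
    ∑' b, coin q b * ENNReal.ofReal (a b) =
      ENNReal.ofReal (q * a true + (1 - q) * a false) := by
  have h : (1 : ℝ≥0∞) - ENNReal.ofReal q = ENNReal.ofReal (1 - q) := by
    rw [ENNReal.ofReal_sub _ h0, ENNReal.ofReal_one]
  have h1' : 0 ≤ 1 - q := by linarith
  rw [tsum_fintype, Fintype.sum_bool, coin, PMF.ofFintype_apply, PMF.ofFintype_apply]
  simp only [if_true, Bool.false_eq_true, if_false]
  rw [clampProb_eq h0 h1, h, ENNReal.ofReal_add (mul_nonneg h0 (ha _)) (mul_nonneg h1' (ha _)),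
    ENNReal.ofReal_mul h0, ENNReal.ofReal_mul h1']

theorem sum_subsetProb (q : ℝ) : ∑ S : Finset (Fin n), subsetProb q S = 1 := by
  have h := Finset.sum_pow_mul_eq_add_pow q (1 - q) (Finset.univ : Finset (Fin n))
  simpa [subsetProb] using h

/-- Iterated average over the subsets `ω j, …, ω (j + m - 1)`. -/
def drawSum (q : ℝ) (Φ : (ℕ → Finset (Fin n)) → ℝ) : ℕ → ℕ → (ℕ → Finset (Fin n)) → ℝ
  | 0, _, ω => Φ ω
  | m + 1, j, ω => ∑ S, subsetProb q S * drawSum q Φ m (j + 1) (Function.update ω j S)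

theorem drawSum_nonneg {q : ℝ} (h0 : 0 ≤ q) (h1 : q ≤ 1) {Φ : (ℕ → Finset (Fin n)) → ℝ}
    (hΦ : ∀ ω, 0 ≤ Φ ω) (m j : ℕ) (ω : ℕ → Finset (Fin n)) : 0 ≤ drawSum q Φ m j ω := by
  induction m generalizing j ω with
  | zero => exact hΦ ω
  | succ m ih => exact Finset.sum_nonneg fun S _ => mul_nonneg (subsetProb_nonneg h0 h1 S) (ih _ _)

/-- The program averages over one subsample after the other; the analysis needs one sum over the
product distribution. Splitting off the first coordinate of `η` matches the two. -/
theorem drawSum_eq (q : ℝ) (Φ : (ℕ → Finset (Fin n)) → ℝ) (m j : ℕ) (ω : ℕ → Finset (Fin n)) :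
    drawSum q Φ m j ω = ∑ η : Fin m → Finset (Fin n), (∏ i, subsetProb q (η i)) *
      Φ fun a => if a < j then ω a else if h : a - j < m then η ⟨a - j, h⟩ else ω a := by
  induction m generalizing j ω with
  | zero => simp [drawSum]
  | succ m ih =>
    rw [drawSum, ← (Fin.consEquiv fun _ : Fin (m + 1) => Finset (Fin n)).sum_comp,
      Fintype.sum_prod_type]
    refine Finset.sum_congr rfl fun S _ => ?_
    rw [ih, Finset.mul_sum]
    refine Finset.sum_congr rfl fun η _ => ?_
    rw [Fin.prod_univ_succ, ← mul_assoc]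
    simp only [Fin.consEquiv_apply, Fin.cons_zero, Fin.cons_succ]
    congr 2
    funext a
    rcases lt_trichotomy a j with h | rfl | h
    · rw [if_pos (by omega), if_pos h, Function.update_of_ne h.ne]
    · simp
    · rw [if_neg (by omega), if_neg (by omega)]
      obtain ⟨b, rfl⟩ : ∃ b, a = j + 1 + b := ⟨a - (j + 1), by omega⟩
      by_cases hb : b < m
      · rw [dif_pos (by omega), dif_pos (by omega)]
        have : (⟨j + 1 + b - j, by omega⟩ : Fin (m + 1)) = Fin.succ ⟨j + 1 + b - (j + 1), by omega⟩ := by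
          ext; simp; omega
        rw [this, Fin.cons_succ]
      · rw [dif_neg (by omega), dif_neg (by omega), Function.update_of_ne h.ne']

theorem drawSum_empty (q : ℝ) (Φ : (ℕ → Finset (Fin n)) → ℝ) (N : ℕ) :
    drawSum q Φ N 0 (fun _ => ∅) = ∑ η : Fin N → Finset (Fin n), (∏ i, subsetProb q (η i)) *
      Φ (extendList η) := by
  rw [drawSum_eq]
  rfl

theorem weight_pos {σ : Type*} (orc : ℕ → σ → ℝ) (κ N : ℕ) (r h c : ℝ) (ω : ℕ → σ) (i : ℕ) :
    0 < weight orc κ N r h c ω i := Real.exp_pos _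

theorem selProb_nonneg {w : ℕ → ℝ} (hw : ∀ i, 0 < w i) (κ : ℕ) (E : Set ℕ) :
    0 ≤ selProb w κ E := by
  refine div_nonneg (Finset.sum_nonneg fun i _ => ?_) (Finset.sum_nonneg fun i _ => (hw i).le)
  split_ifs
  exacts [(hw i).le, le_rfl]

/-- One round of reservoir sampling. -/
theorem selectBody_spec {κ N i o : ℕ} {p r h c W : ℝ} {ω : ℕ → Finset (Fin n)} {s : Store n}
    (hs : Constants s κ N p r h c) (hst : Stored s orc κ N ω) (hi : i < κ) (hW : 0 ≤ W)
    (h19 : s.mem 19 = i) (h20 : s.mem 20 = W) (h21 : s.mem 21 = o)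
    {k : List Prog} {τ : ℕ} {v : ℕ → Set ℕ → ℝ} (hv : ∀ o E, 0 ≤ v o E)
    (hk : ∀ (o' : ℕ) (s' : Store n), Constants s' κ N p r h c →
      Stored s' orc κ N ω → s'.mem 19 = i + 1 → s'.mem 20 = W + weight orc κ N r h c ω i →
      s'.mem 21 = o' → Ends orc (k, s') τ fun E => ENNReal.ofReal (v o' E)) :
    Ends orc (selectBody :: k, s) (τ + (N * (N * 26 + 41) + 30)) fun E =>
      ENNReal.ofReal (weight orc κ N r h c ω i / (W + weight orc κ N r h c ω i) * v i E +
        (1 - weight orc κ N r h c ω i / (W + weight orc κ N r h c ω i)) * v o E) := by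
  have hw := weight_pos orc κ N r h c ω i
  obtain ⟨s₁, d₁, f₁, v20, v24⟩ := weightProg_spec hs hst hi h19 h20
  have hq0 : 0 ≤ weight orc κ N r h c ω i / (W + weight orc κ N r h c ω i) := by positivity
  have hq1 : weight orc κ N r h c ω i / (W + weight orc κ N r h c ω i) ≤ 1 := by
    rw [div_le_one (by positivity)]
    linarith
  have hflip : ∀ b : Bool, Ends orc (.seq (.ite 9 24 (.instr (.add 21 19 9)) nop)
      (.instr (.add 19 19 8)) :: k, s₁.set 24 (if b then 1 else 0)) (τ + 4)
      fun E => ENNReal.ofReal (v (if b then i else o) E) := by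
    intro b
    obtain ⟨s₂, d₂, -, f₂⟩ := iteL_spec (orc := orc) (.add 21 19 9) trivial 9 24
      (s₁.set 24 (if b then 1 else 0))
    refine (d₂.seq (Det.instr (c := .add 19 19 8) trivial s₂)) _ _ _ (hk _ _ ?_ ?_ ?_ ?_ ?_)
    · refine hs.of_eq fun x hx => ?_
      have h1 : x ≠ 19 := by omega
      have h2 : x ≠ 21 := by omega
      have h3 : x ≠ 24 := by omega
      simp [Instr.after, Store.set, h1, f₂ x (by omega), h2, h3, f₁ x (by omega)]
    · refine hst.of_eq fun x hx => ?_
      have h1 : x ≠ 19 := by omega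
      have h2 : x ≠ 21 := by omega
      have h3 : x ≠ 24 := by omega
      simp [Instr.after, Store.set, h1, f₂ x (by omega), h2, h3, f₁ x (by omega)]
    · simp [Instr.after, Store.set, f₂, f₁, h19, hs.h8]
    · simp [Instr.after, Store.set, f₂, v20]
    · cases b <;> simp [Instr.after, Store.set, f₂, f₁, h19, h21, hs.h9]
  have key := Ends.bind (orc := orc) (c := (.instr (.flip 24 24) :: .seq (.ite 9 24
    (.instr (.add 21 19 9)) nop) (.instr (.add 19 19 8)) :: k, s₁)) (q := coin (s₁.mem 24))
    (f := fun b => (.seq (.ite 9 24 (.instr (.add 21 19 9)) nop)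
      (.instr (.add 19 19 8)) :: k, s₁.set 24 (if b then 1 else 0)))
    (by simp only [step, Instr.exec, PMF.map_comp]; rfl) hflip
  have key' := Ends.pure (c := (.seq (.instr (.flip 24 24)) (.seq (.ite 9 24
    (.instr (.add 21 19 9)) nop) (.instr (.add 19 19 8))) :: k, s₁)) rfl key
  refine ((Ends.pure (c := (selectBody :: k, s)) rfl (d₁ _ _ _ key')).mono (by omega)).congr
    fun E => ?_
  rw [v24, tsum_coin_mul hq0 hq1 (fun b => hv _ E)]
  simp

open Classical in
-- Invariant of reservoir sampling: the present choice `o` carries the whole weight of the indices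
-- before `i`, and every later index still carries its own. Initially that weight is `0`, so the
-- choice made before the first round is irrelevant.
theorem selectLoop_spec {κ N : ℕ} {p r h c : ℝ} {ω : ℕ → Finset (Fin n)} (m : ℕ) :
    ∀ {i o : ℕ} {s : Store n}, i + m = κ → 0 < κ →
    Constants s κ N p r h c → Stored s orc κ N ω → s.mem 19 = i →
    s.mem 20 = ∑ i' ∈ Finset.range i, weight orc κ N r h c ω i' → s.mem 21 = o →
    Ends orc ([.loop 19 0 selectBody, .instr (.add 0 21 9)], s)
      (m * (N * (N * 26 + 41) + 31) + 2) fun E => ENNReal.ofReal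
      (((∑ i' ∈ Finset.range i, weight orc κ N r h c ω i') * (if o ∈ E then 1 else 0) +
        ∑ i' ∈ Finset.Ico i κ, if i' ∈ E then weight orc κ N r h c ω i' else 0) /
        ∑ i' ∈ Finset.range κ, weight orc κ N r h c ω i') := by
  have htot : ∀ {m}, 0 < m → 0 < ∑ i' ∈ Finset.range m, weight orc κ N r h c ω i' := fun hm =>
    Finset.sum_pos (fun i _ => weight_pos _ _ _ _ _ _ _ _) (by simp; omega)
  induction m with
  | zero =>
    intro i o s hi hκ hs hst h19 h20 h21
    obtain rfl : i = κ := by omega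
    have hg : ¬ s.mem 19 < s.mem 0 := by rw [h19, hs.h0]; simp
    refine ((Ends.pure (c' := ([.instr (.add 0 21 9)], s)) (by simp [step, hg])
      ((Det.instr (c := .add 0 21 9) trivial s) _ _ _ (ends_nil _))).mono (by omega)).congr
      fun E => ?_
    have hmem : ((Instr.add 0 21 9).after orc s).mem 0 = o := by
      simp [Instr.after, Store.set, h21, hs.h9]
    rw [hmem, Nat.floor_natCast]
    have := (htot hκ).ne'
    split_ifs <;> simp [this]
  | succ m ih =>
    intro i o s hi hκ hs hst h19 h20 h21
    have hg : s.mem 19 < s.mem 0 := by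
      rw [h19, hs.h0, Nat.cast_lt]; omega
    have hw := fun i => weight_pos orc κ N r h c ω i
    have hT : 0 ≤ ∑ i' ∈ Finset.range i, weight orc κ N r h c ω i' :=
      Finset.sum_nonneg fun i _ => (hw i).le
    have hbody := selectBody_spec (orc := orc) (k := [.loop 19 0 selectBody, .instr (.add 0 21 9)])
      (τ := m * (N * (N * 26 + 41) + 31) + 2) (v := fun o E =>
      (((∑ i' ∈ Finset.range (i + 1), weight orc κ N r h c ω i') * (if o ∈ E then 1 else 0) +
        ∑ i' ∈ Finset.Ico (i + 1) κ, if i' ∈ E then weight orc κ N r h c ω i' else 0) /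
        ∑ i' ∈ Finset.range κ, weight orc κ N r h c ω i')) hs hst (by omega) hT h19 h20 h21
      (fun o E => by
        refine div_nonneg (add_nonneg (mul_nonneg (Finset.sum_nonneg fun i _ => (hw i).le)
          (by split_ifs <;> simp)) (Finset.sum_nonneg fun i _ => ?_)) (htot hκ).le
        split_ifs
        exacts [(hw i).le, le_rfl])
      (fun o' s' h1 h2 h3 h4 h5 => ih (by omega) hκ h1 h2 (by rw [h3]; push_cast; rfl)
        (by rw [h4, Finset.sum_range_succ]) h5)
    refine ((Ends.pure (c' := (selectBody :: [.loop 19 0 selectBody, .instr (.add 0 21 9)], s))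
      (by simp [step, hg]) hbody).mono (by ring_nf; omega)).congr fun E => ?_
    -- With `W` the weight before `i`, the round preserves mass: `W + w i` times the new mixture of
    -- the indicators of `i` and `o` is `w i` times the first plus `W` times the second.
    congr 1
    rw [Finset.sum_range_succ, Finset.sum_eq_sum_Ico_succ_bot (show i < κ by omega)]
    have := htot hκ
    have := hw i
    have h3 : (∑ i' ∈ Finset.range i, weight orc κ N r h c ω i') + weight orc κ N r h c ω i ≠ 0 := by
      positivity
    field_simp
    by_cases h1 : i ∈ E <;> by_cases h2 : o ∈ E <;> simp [h1, h2] <;> ring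

theorem selProb_eq (w : ℕ → ℝ) (κ : ℕ) (E : Set ℕ) [DecidablePred (· ∈ E)] :
    selProb w κ E = (∑ i ∈ Finset.range κ, if i ∈ E then w i else 0) /
      ∑ i ∈ Finset.range κ, w i := by
  unfold selProb
  congr!

theorem drawLoop_spec {κ N : ℕ} {p r h c : ℝ} (hp0 : 0 ≤ p) (hp1 : p ≤ 1) (hκ : 0 < κ) (m : ℕ) :
    ∀ {j : ℕ} {ω : ℕ → Finset (Fin n)} {s : Store n}, j + m = N →
    Constants s κ N p r h c → Stored s orc κ j ω → s.mem 18 = j →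
    Ends orc ([.loop 18 12 drawBody, .seq (Prog.line (.const 19 0) [.const 20 0, .const 21 0])
        (.seq (.loop 19 0 selectBody) (.instr (.add 0 21 9)))], s)
      (m * (κ * 16 + 21) + (κ * (N * (N * 26 + 41) + 31) + 10)) fun E => ENNReal.ofReal
      (drawSum p (fun ω => selProb (weight orc κ N r h c ω) κ E) m j ω) := by
  have hnn : ∀ (E : Set ℕ) (ω : ℕ → Finset (Fin n)), 0 ≤ selProb (weight orc κ N r h c ω) κ E :=
    fun E ω => selProb_nonneg (weight_pos orc κ N r h c ω) κ E
  induction m with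
  | zero =>
    intro j ω s hj hs hst h18
    obtain rfl : j = N := by omega
    have hg : ¬ s.mem 18 < s.mem 12 := by rw [h18, hs.h12]; simp
    obtain ⟨s₁, d₁, f₁, v19, v20, v21⟩ : ∃ s', Det orc
        (Prog.line (.const 19 0) [.const 20 0, .const 21 0]) s s' 5 ∧
        (∀ x, x < 19 ∨ 21 < x → s'.mem x = s.mem x) ∧ s'.mem 19 = 0 ∧ s'.mem 20 = 0 ∧
        s'.mem 21 = 0 := by
      refine exists_det_line (c := .const 19 0) trivial ?_ (by simp) ⟨?_, ?_, ?_, ?_⟩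
      · simp [Instr.IsDet]
      · intro x hx
        have h1 : x ≠ 19 := by omega
        have h2 : x ≠ 20 := by omega
        have h3 : x ≠ 21 := by omega
        simp [Instr.after, Store.set, h1, h2, h3]
      all_goals simp [Instr.after, Store.set]
    have h1 := selectLoop_spec κ (i := 0) (o := 0) (s := s₁) (by omega) hκ
      (hs.of_eq fun x hx => f₁ x (by omega)) (hst.of_eq fun x hx => f₁ x (by omega))
      (by simpa using v19) (by simpa using v20) (by simpa using v21)
    have h2 := Ends.pure (c := ([.seq (.loop 19 0 selectBody) (.instr (.add 0 21 9))], s₁)) rfl h1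
    have h3 := Ends.pure (c := ([.seq (Prog.line (.const 19 0) [.const 20 0, .const 21 0])
        (.seq (.loop 19 0 selectBody) (.instr (.add 0 21 9)))], s)) rfl (d₁ _ _ _ h2)
    refine ((Ends.pure (c := (.loop 18 12 drawBody :: [.seq (Prog.line (.const 19 0)
      [.const 20 0, .const 21 0]) (.seq (.loop 19 0 selectBody) (.instr (.add 0 21 9)))], s))
      (by simp [step, hg]) h3).mono (by omega)).congr fun E => ?_
    classical
    simp only [drawSum]
    rw [selProb_eq]
    simp
  | succ m ih =>
    intro j ω s hj hs hst h18
    have hg : s.mem 18 < s.mem 12 := by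
      rw [h18, hs.h12, Nat.cast_lt]; omega
    have hb := drawBody_spec hs hst h18 (v := fun S E => ENNReal.ofReal
      (drawSum p (fun ω => selProb (weight orc κ N r h c ω) κ E) m (j + 1)
        (Function.update ω j S))) fun S s' h1 h2 h3 => ih (by omega) h1 h2
          (by rw [h3]; push_cast; rfl)
    refine ((Ends.pure (c := (.loop 18 12 drawBody :: _, s)) (by simp [step, hg]) hb).mono
      (by ring_nf; omega)).congr fun E => ?_
    rw [drawSum, tsum_fintype, ENNReal.ofReal_sum_of_nonneg]
    · refine Finset.sum_congr rfl fun S _ => ?_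
      rw [ENNReal.ofReal_mul (subsetProb_nonneg hp0 hp1 S), randomSubset_apply hp0 hp1]
    · exact fun S _ => mul_nonneg (subsetProb_nonneg hp0 hp1 S)
        (drawSum_nonneg hp0 hp1 (hnn E) _ _ _)

/-- The probability that the mechanism outputs an index in `E`. -/
def mechProb {n : ℕ} (orc : ℕ → Finset (Fin n) → ℝ) (κ : ℕ) (ε δ β α p : ℝ) (E : Set ℕ) : ℝ :=
  ∑ η : Fin (numSamples κ ε δ β p) → Finset (Fin n), (∏ i, subsetProb p (η i)) *
    selProb (weight orc κ (numSamples κ ε δ β p) (minCount κ δ p) (8 * p * α * α)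
      (ε / 2 / logGap p) (extendList η)) κ E

theorem mechanism_ends {κ : ℕ} {ε δ β α ρ p : ℝ} (hp0 : 0 ≤ p) (hp1 : p ≤ 1) (hκ : 0 < κ)
    (hr : 0 ≤ rawCount κ ε δ β p) :
    Ends orc (initConfig n mechanism (inputMem κ n ε δ β α ρ p))
      (numSamples κ ε δ β p * (κ * 16 + 21) +
        (κ * (numSamples κ ε δ β p * (numSamples κ ε δ β p * 26 + 41) + 31) + 90))
      fun E => ENNReal.ofReal (mechProb orc κ ε δ β α p E) := by
  obtain ⟨s, d, hs, h18⟩ := setup_spec (n := n) (orc := orc) (α := α) (ρ := ρ) hr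
  have h1 := drawLoop_spec (orc := orc) hp0 hp1 hκ _ (ω := fun _ => ∅) (Nat.zero_add _) hs
    (fun j hj => absurd hj (by simp)) (by simpa using h18)
  have h2 := Ends.pure (c := ([.seq (.loop 18 12 drawBody) (.seq (Prog.line (.const 19 0)
    [.const 20 0, .const 21 0]) (.seq (.loop 19 0 selectBody) (.instr (.add 0 21 9))))], s)) rfl h1
  refine ((Ends.pure (c := initConfig n mechanism (inputMem κ n ε δ β α ρ p)) rfl
    (d _ _ _ h2)).mono (by omega)).congr fun E => ?_
  rw [drawSum_empty]
  rfl

end Selection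

/-! ### Privacy -/

section Scores

theorem le_scoreTo_iff {N : ℕ} {r h : ℝ} {x y : ℕ → ℝ} {m : ℕ} {a : ℝ} :
    a ≤ scoreTo N r h x y m ↔ a ≤ N / r ∧ ∀ j < m, a ≤ level N r h x y (x j) := by
  induction m with
  | zero => simp [scoreTo]
  | succ m ih =>
    rw [scoreTo, le_min_iff, ih, and_assoc]
    refine and_congr_right fun _ => ⟨fun ⟨h1, h2⟩ j hj => ?_, fun h1 => ⟨fun j hj => h1 j (by omega),
      h1 m (by omega)⟩⟩
    rcases Nat.lt_succ_iff_lt_or_eq.1 hj with hlt | rfl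
    exacts [h1 j hlt, h2]

theorem score_le_div {N : ℕ} {r h : ℝ} {x y : ℕ → ℝ} : score N r h x y ≤ N / r :=
  (le_scoreTo_iff.1 le_rfl).1

theorem cnt_mono (N : ℕ) (x : ℕ → ℝ) {t u : ℝ} (htu : t ≤ u) : cnt N x t ≤ cnt N x u :=
  Finset.card_le_card fun j hj => by
    simp only [Finset.mem_filter] at hj ⊢
    exact ⟨hj.1, hj.2.trans htu⟩

theorem cnt_le (N : ℕ) (x : ℕ → ℝ) (t : ℝ) : cnt N x t ≤ N :=
  (Finset.card_filter_le _ _).trans (by simp)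

/-- Lowering `t` to the largest entry of `x` below it keeps the count of `x` and does not raise that
of `y`. If there is no such entry, the level is at least the cap `N / r`. Thus the score is a
minimum over all real thresholds, although the machine tests only `N` of them. -/
theorem score_le_level {N : ℕ} {r h : ℝ} (hr : 0 < r) {x y : ℕ → ℝ} (t : ℝ) :
    score N r h x y ≤ level N r h x y t := by
  rcases (Finset.filter (fun j => x j ≤ t) (Finset.range N)).eq_empty_or_nonempty with he | hne
  · refine score_le_div.trans ((le_of_eq ?_).trans (le_max_right _ _))
    rw [cnt, he]
    simp [hr.le]
  · obtain ⟨j, hj, hmax⟩ := Finset.exists_max_image _ x hne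
    simp only [Finset.mem_filter, Finset.mem_range] at hj hmax
    refine ((le_scoreTo_iff.1 le_rfl).2 j hj.1).trans ?_
    have hc : cnt N x (x j) = cnt N x t := by
      unfold cnt
      congr 1
      ext i
      simp only [Finset.mem_filter, Finset.mem_range]
      exact ⟨fun hi => ⟨hi.1, hi.2.trans hj.2⟩, fun hi => ⟨hi.1, hmax i hi⟩⟩
    have hc' : cnt N y (x j + h) ≤ cnt N y (t + h) := cnt_mono _ _ (by linarith [hj.2])
    unfold level
    rw [hc]
    have : (cnt N y (x j + h) : ℝ) ≤ cnt N y (t + h) := by exact_mod_cast hc'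
    gcongr

theorem one_le_level {N : ℕ} {r h : ℝ} (hr : 0 < r) {x y : ℕ → ℝ} (t : ℝ) :
    1 ≤ level N r h x y t :=
  le_trans (by rw [le_div_iff₀ hr, one_mul]; exact le_max_right _ _) (le_max_left _ _)

theorem one_le_score {N : ℕ} {r h : ℝ} (hr : 0 < r) (hN : r ≤ N) {x y : ℕ → ℝ} :
    1 ≤ score N r h x y :=
  le_scoreTo_iff.2 ⟨by rwa [le_div_iff₀ hr, one_mul], fun _ _ => one_le_level hr _⟩

/-- The two scores use different thresholds, but by `score_le_level` the left one may be tested at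
the thresholds of the right one. There both ratios change by at most the factor `g`. -/
theorem score_le_mul {N : ℕ} {r h g : ℝ} (hr : 0 < r) (hg : 1 ≤ g) {x y x' y' : ℕ → ℝ}
    (hx : ∀ t, max (cnt N x' t : ℝ) r ≤ g * max (cnt N x t : ℝ) r)
    (hy : ∀ t, max (cnt N y t : ℝ) r ≤ g * max (cnt N y' t : ℝ) r) :
    score N r h x y ≤ g * score N r h x' y' := by
  have hg0 : 0 < g := by linarith
  rw [← div_le_iff₀' hg0]
  refine le_scoreTo_iff.2 ⟨?_, fun j _ => ?_⟩
  · rw [div_le_iff₀ hg0]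
    refine score_le_div.trans (le_mul_of_one_le_right (by positivity) hg)
  · rw [div_le_iff₀' hg0]
    refine (score_le_level hr (x' j)).trans ?_
    unfold level
    rw [mul_max_of_nonneg _ _ hg0.le]
    refine max_le_max ?_ ?_
    · rw [← mul_div_assoc]
      gcongr
      exact hy _
    · have h1 : 0 < max (cnt N x' (x' j) : ℝ) r := lt_max_of_lt_right hr
      have h2 : 0 < max (cnt N x (x' j) : ℝ) r := lt_max_of_lt_right hr
      rw [← mul_div_assoc, div_le_div_iff₀ h2 h1]
      nlinarith [hx (x' j), (Nat.cast_nonneg N : (0 : ℝ) ≤ N)]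

/-- One factor `exp a` comes from the numerator, the other from the normalization. -/
theorem selProb_le_mul {w w' : ℕ → ℝ} {κ : ℕ} {a : ℝ} (hκ : 0 < κ) (hw : ∀ i, 0 < w i)
    (hw' : ∀ i, 0 < w' i) (h : ∀ i < κ, w i ≤ Real.exp a * w' i)
    (h' : ∀ i < κ, w' i ≤ Real.exp a * w i) (E : Set ℕ) :
    selProb w κ E ≤ Real.exp (2 * a) * selProb w' κ E := by
  have hpos : ∀ u : ℕ → ℝ, (∀ i, 0 < u i) → 0 < ∑ i ∈ Finset.range κ, u i := fun u hu =>
    Finset.sum_pos (fun i _ => hu i) (by simp; omega)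
  classical
  rw [selProb_eq, selProb_eq, ← mul_div_assoc, div_le_div_iff₀ (hpos w hw) (hpos w' hw')]
  have h1 : (∑ i ∈ Finset.range κ, if i ∈ E then w i else 0) ≤
      Real.exp a * ∑ i ∈ Finset.range κ, if i ∈ E then w' i else 0 := by
    rw [Finset.mul_sum]
    refine Finset.sum_le_sum fun i hi => ?_
    split_ifs
    · exact h i (Finset.mem_range.1 hi)
    · simp
  have h2 : (∑ i ∈ Finset.range κ, w' i) ≤ Real.exp a * ∑ i ∈ Finset.range κ, w i := by
    rw [Finset.mul_sum]
    exact Finset.sum_le_sum fun i hi => h' i (Finset.mem_range.1 hi)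
  have h3 : 0 ≤ ∑ i ∈ Finset.range κ, if i ∈ E then w' i else 0 := Finset.sum_nonneg fun i _ => by
    split_ifs
    exacts [(hw' i).le, le_rfl]
  calc _ ≤ (Real.exp a * ∑ i ∈ Finset.range κ, if i ∈ E then w' i else 0) *
        (Real.exp a * ∑ i ∈ Finset.range κ, w i) :=
        mul_le_mul h1 h2 (hpos w' hw').le (by positivity)
    _ = _ := by rw [two_mul, Real.exp_add]; ring

end Scores

section Column

variable {σ : Type*} {orc orc' : ℕ → σ → ℝ} {κ : ℕ} {S S' : σ}

theorem rowMin_mono (h : ∀ i, orc i S ≤ orc' i S') (m : ℕ) :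
    rowMin orc S m ≤ rowMin orc' S' m := by
  induction m with
  | zero => exact h 0
  | succ m ih => exact min_le_min (h m) ih

theorem column_mono (h : ∀ i, orc i S ≤ orc' i S') (i : ℕ) :
    column orc κ i S ≤ column orc' κ i S' := by
  unfold column
  split_ifs
  exacts [rowMin_mono h κ, h i]

end Column

/-! ### How many subsamples of a level set contain a given entry -/

section Chernoff

variable {n N : ℕ}

/-- The fiber over `T` is `{T, insert i₀ T}`, or empty if `i₀ ∈ T`. Given the other entries, `i₀` is
still kept with probability `p`, so the conditional moment generating function is that of a
Bernoulli variable. -/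
theorem sum_fiber_erase {p : ℝ} (i₀ : Fin n) (T : Finset (Fin n)) :
    ∑ S with S.erase i₀ = T, subsetProb p S * (if i₀ ∈ S then Real.exp 1 else 1) =
      (1 + p * (Real.exp 1 - 1)) * ∑ S with S.erase i₀ = T, subsetProb p S := by
  by_cases hT : i₀ ∈ T
  · have : (Finset.univ.filter fun S : Finset (Fin n) => S.erase i₀ = T) = ∅ := by
      refine Finset.filter_eq_empty_iff.2 fun S _ hS => ?_
      rw [← hS] at hT
      simp at hT
    simp [this]
  · have : (Finset.univ.filter fun S : Finset (Fin n) => S.erase i₀ = T) = {T, insert i₀ T} := by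
      ext S
      simp only [Finset.mem_filter, Finset.mem_univ, true_and, Finset.mem_insert,
        Finset.mem_singleton]
      constructor
      · rintro rfl
        by_cases hS : i₀ ∈ S
        · exact Or.inr (Finset.insert_erase hS).symm
        · exact Or.inl (Finset.erase_eq_of_notMem hS).symm
      · rintro (rfl | rfl)
        · exact Finset.erase_eq_of_notMem hT
        · exact Finset.erase_insert hT
    have hne : T ≠ insert i₀ T := fun h => hT (h ▸ Finset.mem_insert_self _ _)
    rw [this, Finset.sum_pair hne, Finset.sum_pair hne, if_neg hT, if_pos (Finset.mem_insert_self _ _)]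
    have hcard : T.card < n := by
      have := Finset.card_lt_univ_of_notMem hT
      simpa using this
    obtain ⟨m, hm⟩ : ∃ m, n = T.card + 1 + m := ⟨n - (T.card + 1), by omega⟩
    have h1 : subsetProb p T = p ^ T.card * (1 - p) ^ (m + 1) := by
      rw [subsetProb, show n - T.card = m + 1 by omega]
    have h2 : subsetProb p (insert i₀ T) = p ^ (T.card + 1) * (1 - p) ^ m := by
      rw [subsetProb, Finset.card_insert_of_notMem hT, show n - (T.card + 1) = m by omega]
    rw [h1, h2]
    ring

theorem sum_prod_subsetProb (p : ℝ) :
    ∑ η : Fin N → Finset (Fin n), ∏ i, subsetProb p (η i) = 1 := by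
  have := Finset.prod_univ_sum (fun _ : Fin N => (Finset.univ : Finset (Finset (Fin n))))
    (fun _ S => subsetProb p S)
  rw [Fintype.piFinset_univ] at this
  rw [← this]
  simp [sum_subsetProb]

/-- The entry `i₀` belongs to at most about the expected number of the subsamples in a set of `k`
subsamples that is chosen without regard to the entry `i₀`. -/
theorem chernoff_membership {p : ℝ} (hp0 : 0 ≤ p) (hp1 : p ≤ 1) (i₀ : Fin n)
    (A : (Fin N → Finset (Fin n)) → Finset (Fin N)) (k : ℕ)
    [DecidablePred fun η : Fin N → Finset (Fin n) => (A fun j => (η j).erase i₀).card = k ∧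
      2 * p * k < ((A fun j => (η j).erase i₀).filter fun j => i₀ ∈ η j).card] :
    ∑ η : Fin N → Finset (Fin n) with (A fun j => (η j).erase i₀).card = k ∧
      2 * p * k < ((A fun j => (η j).erase i₀).filter fun j => i₀ ∈ η j).card,
      ∏ i, subsetProb p (η i) ≤ Real.exp (-(p * k / 4)) := by
  classical
  set er : (Fin N → Finset (Fin n)) → (Fin N → Finset (Fin n)) := fun η j => (η j).erase i₀ with her
  have hP : ∀ η : Fin N → Finset (Fin n), 0 ≤ ∏ i, subsetProb p (η i) := fun η =>
    Finset.prod_nonneg fun i _ => subsetProb_nonneg hp0 hp1 _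
  set f : Finset (Fin N) → Fin N → Finset (Fin n) → ℝ := fun B j S =>
    if j ∈ B then (if i₀ ∈ S then Real.exp 1 else 1) else 1 with hf
  have hprod : ∀ (B : Finset (Fin N)) (η : Fin N → Finset (Fin n)),
      ∏ j, f B j (η j) = Real.exp (B.filter fun j => i₀ ∈ η j).card := by
    intro B η
    rw [hf]
    simp only
    rw [Finset.prod_ite_mem, Finset.univ_inter, Finset.prod_ite, Finset.prod_const,
      Finset.prod_const_one, mul_one, ← Real.exp_nat_mul, mul_one]
  have e1 : (0 : ℝ) ≤ Real.exp 1 - 1 := by linarith [Real.add_one_le_exp (1 : ℝ)]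
  have hc : 0 ≤ p * (Real.exp 1 - 1) := mul_nonneg hp0 e1
  have hfib : ∀ ζ : Fin N → Finset (Fin n), ∑ η with er η = ζ,
      ∏ j, (subsetProb p (η j) * f (A ζ) j (η j)) =
      (1 + p * (Real.exp 1 - 1)) ^ (A ζ).card * ∑ η with er η = ζ, ∏ j, subsetProb p (η j) := by
    intro ζ
    have hset : (Finset.univ.filter fun η => er η = ζ) =
        Fintype.piFinset fun j => Finset.univ.filter fun S : Finset (Fin n) => S.erase i₀ = ζ j := by
      ext η
      simp [her, funext_iff, Fintype.mem_piFinset]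
    rw [hset, ← Finset.prod_univ_sum (fun j => Finset.univ.filter fun S : Finset (Fin n) =>
      S.erase i₀ = ζ j) fun j S => subsetProb p S * f (A ζ) j S,
      ← Finset.prod_univ_sum (fun j => Finset.univ.filter fun S : Finset (Fin n) =>
      S.erase i₀ = ζ j) fun j S => subsetProb p S, ← Finset.prod_const,
      ← Finset.univ_inter (A ζ), ← Finset.prod_ite_mem, ← Finset.prod_mul_distrib]
    refine Finset.prod_congr rfl fun j _ => ?_
    rw [Finset.univ_inter]
    by_cases hj : j ∈ A ζ
    · simp only [hf, if_pos hj]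
      exact sum_fiber_erase i₀ (ζ j)
    · simp only [hf, if_neg hj, mul_one, one_mul]
  -- Markov's inequality for the exponential moment. Grouping by the erased list fixes the chosen
  -- set, and the sum over each fiber factors over the subsamples.
  calc _ ≤ ∑ η : Fin N → Finset (Fin n) with (A (er η)).card = k,
        Real.exp (-(2 * p * k)) * ∏ j, (subsetProb p (η j) * f (A (er η)) j (η j)) := by
        refine (Finset.sum_le_sum fun η hη => ?_).trans (Finset.sum_le_sum_of_subset_of_nonneg
          (fun η hη => ?_) fun η _ _ => ?_)
        · simp only [Finset.mem_filter, Finset.mem_univ, true_and] at hη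
          rw [Finset.prod_mul_distrib, hprod, mul_left_comm, ← Real.exp_add]
          refine le_mul_of_one_le_right (hP η) (Real.one_le_exp ?_)
          have := hη.2
          simp only [her] at this ⊢
          linarith
        · simp only [Finset.mem_filter, Finset.mem_univ, true_and] at hη ⊢
          exact hη.1
        · rw [Finset.prod_mul_distrib, hprod]
          exact mul_nonneg (Real.exp_pos _).le (mul_nonneg (hP η) (Real.exp_pos _).le)
    _ = ∑ ζ : Fin N → Finset (Fin n), ∑ η with er η = ζ, (if (A ζ).card = k then
        Real.exp (-(2 * p * k)) * ∏ j, (subsetProb p (η j) * f (A ζ) j (η j)) else 0) := by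
        rw [Finset.sum_filter, ← Finset.sum_fiberwise _ er]
        refine Finset.sum_congr rfl fun ζ _ => Finset.sum_congr rfl fun η hη => ?_
        rw [(Finset.mem_filter.1 hη).2]
    _ ≤ ∑ ζ : Fin N → Finset (Fin n), ∑ η with er η = ζ,
        Real.exp (-(p * k / 4)) * ∏ j, subsetProb p (η j) := by
        refine Finset.sum_le_sum fun ζ _ => ?_
        by_cases hk : (A ζ).card = k
        · simp only [if_pos hk]
          rw [← Finset.mul_sum, ← Finset.mul_sum, hfib, hk, ← mul_assoc]
          refine mul_le_mul_of_nonneg_right ?_ (Finset.sum_nonneg fun η _ => hP η)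
          have h1 : (1 + p * (Real.exp 1 - 1)) ^ k ≤ Real.exp (p * (Real.exp 1 - 1) * k) := by
            rw [mul_comm _ (k : ℝ), Real.exp_nat_mul]
            refine pow_le_pow_left₀ (by linarith) ?_ k
            linarith [Real.add_one_le_exp (p * (Real.exp 1 - 1))]
          refine (mul_le_mul_of_nonneg_left h1 (Real.exp_pos _).le).trans ?_
          rw [← Real.exp_add, Real.exp_le_exp]
          -- The exponent is `-(3 - e) p k`, and `3 - e > 1/4`.
          have h2 := Real.exp_one_lt_d9
          have h3 : 0 ≤ p * k := by positivity
          nlinarith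
        · simp only [if_neg hk, Finset.sum_const_zero]
          exact Finset.sum_nonneg fun η _ => mul_nonneg (Real.exp_pos _).le (hP η)
    _ = Real.exp (-(p * k / 4)) := by
        rw [Finset.sum_fiberwise, ← Finset.mul_sum, sum_prod_subsetProb, mul_one]

end Chernoff

/-! ### Elementary bounds for the parameters of the mechanism -/

section Parameters

variable {κ : ℕ} {ε δ β p : ℝ}

theorem logGap_pos (hp0 : 0 < p) (hp1 : p < 1 / 4) : 0 < logGap p := by
  have := Real.log_neg (x := 1 - 2 * p) (by linarith) (by linarith)
  unfold logGap
  linarith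

theorem exp_logGap (hp1 : p < 1 / 4) : Real.exp (logGap p) = 1 / (1 - 2 * p) := by
  rw [logGap, zero_sub, Real.exp_neg, Real.exp_log (by linarith), one_div]

/-- Because `(1 + 4p)(1 - 2p) ≥ 1` for `p ≤ 1/4`. This bound produces the ratio `p / ε` in the
exponent of the running time. -/
theorem logGap_le (hp0 : 0 < p) (hp1 : p < 1 / 4) : logGap p ≤ 4 * p := by
  have h1 : (0 : ℝ) < 1 - 2 * p := by linarith
  have h := Real.add_one_le_exp (4 * p)
  rw [logGap, zero_sub, ← Real.log_inv, Real.log_le_iff_le_exp (by positivity)]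
  refine le_trans ?_ h
  rw [inv_le_iff_one_le_mul₀ h1]
  nlinarith

theorem minCount_arg_gt (hδ : 0 < δ) (hp0 : 0 < p) (hp1 : p < 1 / 4) :
    64 ≤ 16 * ((κ : ℝ) + 1) * (1 + 1 / δ) / p := by
  have hκ : (0 : ℝ) ≤ κ := Nat.cast_nonneg κ
  have h1 : 0 < 1 / δ := by positivity
  rw [le_div_iff₀ hp0]
  nlinarith [mul_nonneg hκ h1.le]

theorem minCount_pos (hδ : 0 < δ) (hp0 : 0 < p) (hp1 : p < 1 / 4) : 0 < minCount κ δ p := by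
  have h := minCount_arg_gt (κ := κ) hδ hp0 hp1
  exact mul_pos (by positivity) (Real.log_pos (by linarith))

theorem exponent_nonneg (hε : 0 < ε) (hβ0 : 0 < β) (hβ1 : β < 1) (hp0 : 0 < p) (hp1 : p < 1 / 4) :
    0 ≤ 8 / ε * logGap p * Real.log κ * Real.log (2 / β) := by
  have h1 := logGap_pos hp0 hp1
  have h2 : 0 ≤ Real.log κ := Real.log_natCast_nonneg κ
  have h3 : 0 ≤ Real.log (2 / β) := Real.log_nonneg (by rw [le_div_iff₀ hβ0]; linarith)
  positivity

theorem minCount_le_rawCount (hε : 0 < ε) (hδ : 0 < δ) (hβ0 : 0 < β) (hβ1 : β < 1) (hp0 : 0 < p)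
    (hp1 : p < 1 / 4) : minCount κ δ p ≤ rawCount κ ε δ β p :=
  le_mul_of_one_le_right (minCount_pos hδ hp0 hp1).le
    (Real.one_le_exp (exponent_nonneg hε hβ0 hβ1 hp0 hp1))

theorem rawCount_le_numSamples : rawCount κ ε δ β p ≤ numSamples κ ε δ β p := by
  unfold numSamples
  push_cast
  exact (Nat.lt_floor_add_one _).le

end Parameters

theorem sum_biUnion_le {ι γ : Type*} [DecidableEq γ] (s : Finset ι) (t : ι → Finset γ) {f : γ → ℝ}
    (hf : ∀ a, 0 ≤ f a) : ∑ a ∈ s.biUnion t, f a ≤ ∑ i ∈ s, ∑ a ∈ t i, f a := by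
  classical
  induction s using Finset.induction_on with
  | empty => simp
  | insert i s hi ih =>
    rw [Finset.biUnion_insert, Finset.sum_insert hi]
    have h1 := Finset.sum_union_inter (s₁ := t i) (s₂ := s.biUnion t) (f := f)
    have h2 := Finset.sum_nonneg (s := t i ∩ s.biUnion t) fun a _ => hf a
    linarith

section Privacy

variable {n N : ℕ}

theorem cnt_eq_card (x : ℕ → ℝ) (t : ℝ) :
    cnt N x t = (Finset.univ.filter fun j : Fin N => x j ≤ t).card := by
  rw [cnt, Finset.card_filter, Finset.card_filter, Finset.sum_range]

theorem extendList_erase (η : Fin N → Finset (Fin n)) (i₀ : Fin n) (j : ℕ) :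
    extendList (fun j => (η j).erase i₀) j = (extendList η j).erase i₀ := by
  unfold extendList
  split_ifs <;> simp

theorem extendList_fin (η : Fin N → Finset (Fin n)) (j : Fin N) : extendList η j = η j := by
  simp [extendList]

/-- In all lower level sets of at least `r` subsamples, the entry `i₀` is missing from most of the
subsamples. -/
def MostlyMissing (orc : ℕ → Finset (Fin n) → ℝ) (κ : ℕ) (r p : ℝ) (i₀ : Fin n)
    (η : Fin N → Finset (Fin n)) : Prop :=
  ∀ i ≤ κ, ∀ t : ℝ, r ≤ cnt N (fun j => column orc κ i ((extendList η j).erase i₀)) t →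
    (1 - 2 * p) * cnt N (fun j => column orc κ i ((extendList η j).erase i₀)) t ≤
      (Finset.univ.filter fun j : Fin N =>
        column orc κ i ((extendList η j).erase i₀) ≤ t ∧ i₀ ∉ η j).card

/-- Both counts are compared with the count for the erased list. It is an upper bound for the count
of `orc'`, since erasing lowers the answers. The count of `orc` includes every member of the erased
level set that lacks `i₀`, which is a fraction of at least `1 - 2p` once that set has size `r`. For
smaller sets the rounding up to `r` makes the claim trivial. -/
theorem cnt_comparison {orc orc' : ℕ → Finset (Fin n) → ℝ} {κ : ℕ} {r p : ℝ} (hr : 0 < r)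
    (hp0 : 0 ≤ p) (hp1 : p < 1 / 4) {i₀ : Fin n} {η : Fin N → Finset (Fin n)}
    (hmono' : ∀ i S, orc' i (S.erase i₀) ≤ orc' i S)
    (heq : ∀ i S, i₀ ∉ S → orc i S = orc' i S) (hη : MostlyMissing orc κ r p i₀ η)
    {i : ℕ} (hi : i ≤ κ) (t : ℝ) :
    max (cnt N (fun j => column orc' κ i (extendList η j)) t : ℝ) r ≤
      1 / (1 - 2 * p) * max (cnt N (fun j => column orc κ i (extendList η j)) t : ℝ) r := by
  have hpp : 0 < 1 - 2 * p := by linarith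
  set y : ℕ → ℝ := fun j => column orc κ i ((extendList η j).erase i₀) with hy
  have h1 : cnt N (fun j => column orc' κ i (extendList η j)) t ≤ cnt N y t := by
    refine Finset.card_le_card fun j hj => ?_
    simp only [Finset.mem_filter] at hj ⊢
    refine ⟨hj.1, le_trans (column_mono (fun i => ?_) i) hj.2⟩
    rw [heq i _ (Finset.notMem_erase _ _)]
    exact hmono' i _
  have h2 : (Finset.univ.filter fun j : Fin N => y j ≤ t ∧ i₀ ∉ η j).card ≤
      cnt N (fun j => column orc κ i (extendList η j)) t := by
    rw [cnt_eq_card]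
    refine Finset.card_le_card fun j hj => ?_
    simp only [Finset.mem_filter, Finset.mem_univ, true_and] at hj ⊢
    have : (extendList η j).erase i₀ = extendList η j :=
      Finset.erase_eq_of_notMem (by rw [extendList_fin]; exact hj.2)
    rw [← this]
    exact hj.1
  have h1' : (cnt N (fun j => column orc' κ i (extendList η j)) t : ℝ) ≤ cnt N y t := by
    exact_mod_cast h1
  have h2' : ((Finset.univ.filter fun j : Fin N => y j ≤ t ∧ i₀ ∉ η j).card : ℝ) ≤
      cnt N (fun j => column orc κ i (extendList η j)) t := by exact_mod_cast h2
  rw [one_div, le_inv_mul_iff₀ hpp]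
  rcases lt_or_ge (cnt N y t : ℝ) r with hlt | hge
  · rw [max_eq_right (h1'.trans hlt.le)]
    refine le_trans ?_ (le_max_right _ _)
    nlinarith
  · refine le_trans (mul_le_mul_of_nonneg_left (max_le h1' hge) hpp.le) ?_
    exact ((hη i hi t hge).trans h2').trans (le_max_left _ _)

/-- The event involves only erased subsamples, on which neighboring datasets agree. Hence a single
exceptional event serves for both directions of the comparison. -/
theorem mostlyMissing_congr {orc orc' : ℕ → Finset (Fin n) → ℝ} {κ : ℕ} {r p : ℝ} {i₀ : Fin n}
    {η : Fin N → Finset (Fin n)} (heq : ∀ i S, i₀ ∉ S → orc i S = orc' i S)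
    (hη : MostlyMissing orc κ r p i₀ η) : MostlyMissing orc' κ r p i₀ η := by
  have hcol : ∀ i S, column orc κ i (Finset.erase S i₀) = column orc' κ i (S.erase i₀) := fun i S =>
    le_antisymm (column_mono (fun i => (heq i _ (Finset.notMem_erase _ _)).le) i)
      (column_mono (fun i => (heq i _ (Finset.notMem_erase _ _)).ge) i)
  unfold MostlyMissing at hη ⊢
  simpa only [hcol] using hη

theorem weight_le_mul {orc orc' : ℕ → Finset (Fin n) → ℝ} {κ : ℕ} {r p h c : ℝ} (hr : 0 < r)
    (hN : r ≤ N) (hc : 0 ≤ c)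
    (hp0 : 0 ≤ p) (hp1 : p < 1 / 4) {i₀ : Fin n} {η : Fin N → Finset (Fin n)}
    (hmono : ∀ i S, orc i (S.erase i₀) ≤ orc i S) (hmono' : ∀ i S, orc' i (S.erase i₀) ≤ orc' i S)
    (heq : ∀ i S, i₀ ∉ S → orc i S = orc' i S) (hη : MostlyMissing orc κ r p i₀ η)
    {i : ℕ} (hi : i ≤ κ) :
    weight orc κ N r h c (extendList η) i ≤
      Real.exp (c * logGap p) * weight orc' κ N r h c (extendList η) i := by
  have hpp : 0 < 1 - 2 * p := by linarith
  have hg : 1 ≤ 1 / (1 - 2 * p) := by rw [le_div_iff₀ hpp]; linarith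
  have hs := score_le_mul (h := h) (N := N) hr hg
    (fun t => cnt_comparison hr hp0 hp1 hmono' heq hη le_rfl t)
    (fun t => cnt_comparison hr hp0 hp1 hmono (fun i S hS => (heq i S hS).symm)
      (mostlyMissing_congr heq hη) hi t)
  unfold weight
  rw [← Real.exp_add, Real.exp_le_exp, ← mul_add]
  refine mul_le_mul_of_nonneg_left ?_ hc
  refine (Real.log_le_log (lt_of_lt_of_le one_pos (one_le_score hr hN)) hs).trans (le_of_eq ?_)
  rw [Real.log_mul (by positivity) (lt_of_lt_of_le one_pos (one_le_score hr hN)).ne',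
    ← exp_logGap hp1, Real.log_exp]

open Classical in
-- A union bound over the columns and over the level sets of each column. Though there are
-- infinitely many thresholds, a lower level set is determined by its size `k`, so a sum over `k ≥
-- r` suffices.
theorem sum_not_mostlyMissing (orc : ℕ → Finset (Fin n) → ℝ) (κ : ℕ) {r p : ℝ} (hp0 : 0 < p)
    (hp1 : p < 1 / 4) (i₀ : Fin n) :
    ∑ η : Fin N → Finset (Fin n) with ¬ MostlyMissing orc κ r p i₀ η, ∏ i, subsetProb p (η i) ≤
      (κ + 1) * (16 / p * Real.exp (-(p * r / 8))) := by
  have hP : ∀ η : Fin N → Finset (Fin n), 0 ≤ ∏ i, subsetProb p (η i) := fun η =>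
    Finset.prod_nonneg fun i _ => subsetProb_nonneg hp0.le (by linarith) _
  -- The candidate for the level set of size `k`: all positions whose own level set has at most `k`
  -- members. It equals the level set at `t` when `k` is the count at `t`.
  set A : ℕ → ℕ → (Fin N → Finset (Fin n)) → Finset (Fin N) := fun i k ζ =>
    Finset.univ.filter fun j => cnt N (fun a => column orc κ i (extendList ζ a))
      (column orc κ i (extendList ζ j)) ≤ k with hA
  set B : ℕ → ℕ → Finset (Fin N → Finset (Fin n)) := fun i k =>
    Finset.univ.filter fun η => (A i k fun j => (η j).erase i₀).card = k ∧
      2 * p * k < ((A i k fun j => (η j).erase i₀).filter fun j => i₀ ∈ η j).card with hB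
  have hsub : (Finset.univ.filter fun η : Fin N → Finset (Fin n) =>
      ¬ MostlyMissing orc κ r p i₀ η) ⊆ (Finset.range (κ + 1)).biUnion fun i =>
      ((Finset.range (N + 1)).filter fun k => r ≤ (k : ℕ)).biUnion fun k => B i k := by
    intro η hη
    replace hη := (Finset.mem_filter.1 hη).2
    unfold MostlyMissing at hη
    push Not at hη
    obtain ⟨i, hi, t, hrt, hlt⟩ := hη
    set y : ℕ → ℝ := fun j => column orc κ i ((extendList η j).erase i₀) with hy
    simp only [Finset.mem_biUnion, Finset.mem_range, Finset.mem_filter]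
    refine ⟨i, by omega, cnt N y t, ⟨by have := cnt_le N y t; omega, hrt⟩, ?_⟩
    have hAy : (A i (cnt N y t) fun j => (η j).erase i₀) =
        Finset.univ.filter fun j : Fin N => y j ≤ t := by
      ext j
      simp only [hA, Finset.mem_filter, Finset.mem_univ, true_and, extendList_erase]
      change cnt N y (y j) ≤ cnt N y t ↔ y j ≤ t
      refine ⟨fun h => ?_, fun h => cnt_mono _ _ h⟩
      by_contra hcon
      rw [not_le] at hcon
      refine absurd h (not_le.2 (Finset.card_lt_card ?_))
      refine Finset.ssubset_iff_subset_ne.2 ⟨fun a ha => ?_, fun he => ?_⟩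
      · simp only [Finset.mem_filter] at ha ⊢
        exact ⟨ha.1, ha.2.trans hcon.le⟩
      · have : (j : ℕ) ∈ (Finset.range N).filter fun a => y a ≤ y j := by simp
        rw [← he] at this
        exact absurd (Finset.mem_filter.1 this).2 (not_le.2 hcon)
    simp only [hB, Finset.mem_filter, Finset.mem_univ, true_and, hAy]
    refine ⟨(cnt_eq_card y t).symm, ?_⟩
    have hsplit := Finset.card_filter_add_card_filter_not (s := Finset.univ.filter fun j : Fin N => y j ≤ t)
      (fun j => i₀ ∈ η j)
    rw [← cnt_eq_card] at hsplit
    rw [← Finset.filter_filter] at hlt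
    have hsplit' : (((Finset.univ.filter fun j : Fin N => y j ≤ t).filter fun j => i₀ ∈ η j).card : ℝ) +
      ((Finset.univ.filter fun j : Fin N => y j ≤ t).filter fun j => i₀ ∉ η j).card = cnt N y t := by
      exact_mod_cast hsplit
    linarith
  have hgeom : ∑ k ∈ Finset.range (N + 1), Real.exp (-(p / 8)) ^ k ≤ 16 / p := by
    have hx0 := Real.exp_pos (-(p / 8))
    have hx1 : Real.exp (-(p / 8)) ≤ 1 - p / 16 := by
      rw [Real.exp_neg, inv_le_iff_one_le_mul₀ (Real.exp_pos _)]
      nlinarith [Real.add_one_le_exp (p / 8)]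
    have := geom_sum_mul_neg (Real.exp (-(p / 8))) (N + 1)
    have h2 : 0 ≤ ∑ k ∈ Finset.range (N + 1), Real.exp (-(p / 8)) ^ k :=
      Finset.sum_nonneg fun k _ => pow_nonneg hx0.le k
    rw [le_div_iff₀ hp0]
    nlinarith [pow_nonneg hx0.le (N + 1)]
  calc _ ≤ ∑ i ∈ Finset.range (κ + 1), ∑ k ∈ (Finset.range (N + 1)).filter fun k => r ≤ (k : ℕ),
        ∑ η ∈ B i k, ∏ i, subsetProb p (η i) := by
        refine (Finset.sum_le_sum_of_subset_of_nonneg hsub fun η _ _ => hP η).trans ?_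
        refine (sum_biUnion_le _ _ hP).trans (Finset.sum_le_sum fun i _ => ?_)
        exact sum_biUnion_le _ _ hP
    _ ≤ ∑ i ∈ Finset.range (κ + 1), ∑ k ∈ (Finset.range (N + 1)).filter fun k => r ≤ (k : ℕ),
        Real.exp (-(p * k / 4)) :=
        Finset.sum_le_sum fun i _ => Finset.sum_le_sum fun k _ =>
          chernoff_membership hp0.le (by linarith) i₀ (A i k) k
    -- Half of the exponent is spent on `k ≥ r`, the other half is left for a geometric series.
    _ ≤ ∑ i ∈ Finset.range (κ + 1), ∑ k ∈ (Finset.range (N + 1)).filter fun k => r ≤ (k : ℕ),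
        Real.exp (-(p * r / 8)) * Real.exp (-(p / 8)) ^ k := by
        refine Finset.sum_le_sum fun i _ => Finset.sum_le_sum fun k hk => ?_
        have := (Finset.mem_filter.1 hk).2
        rw [← Real.exp_nat_mul, ← Real.exp_add, Real.exp_le_exp]
        nlinarith
    _ ≤ ∑ i ∈ Finset.range (κ + 1), Real.exp (-(p * r / 8)) * (16 / p) := by
        refine Finset.sum_le_sum fun i _ => ?_
        rw [← Finset.mul_sum]
        refine mul_le_mul_of_nonneg_left (le_trans ?_ hgeom) (Real.exp_pos _).le
        exact Finset.sum_le_sum_of_subset_of_nonneg (Finset.filter_subset _ _)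
          fun k _ _ => pow_nonneg (Real.exp_pos _).le k
    _ = _ := by
        rw [Finset.sum_const, Finset.card_range, nsmul_eq_mul]
        push_cast
        ring

theorem mechProb_le {orc orc' : ℕ → Finset (Fin n) → ℝ} {κ : ℕ} {ε δ β α p : ℝ} (hε : 0 < ε)
    (hδ : 0 < δ) (hβ0 : 0 < β) (hβ1 : β < 1) (hp0 : 0 < p) (hp1 : p < 1 / 4) (hκ : 0 < κ)
    {i₀ : Fin n}
    (hmono : ∀ i S, orc i (S.erase i₀) ≤ orc i S) (hmono' : ∀ i S, orc' i (S.erase i₀) ≤ orc' i S)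
    (heq : ∀ i S, i₀ ∉ S → orc i S = orc' i S) (E : Set ℕ) :
    mechProb orc κ ε δ β α p E ≤ Real.exp ε * mechProb orc' κ ε δ β α p E + δ := by
  classical
  have hP : ∀ η : Fin (numSamples κ ε δ β p) → Finset (Fin n), 0 ≤ ∏ i, subsetProb p (η i) :=
    fun η => Finset.prod_nonneg fun i _ => subsetProb_nonneg hp0.le (by linarith) _
  have hr := minCount_pos (κ := κ) hδ hp0 hp1
  have hN : minCount κ δ p ≤ numSamples κ ε δ β p :=
    (minCount_le_rawCount hε hδ hβ0 hβ1 hp0 hp1).trans rawCount_le_numSamples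
  have hlg := logGap_pos hp0 hp1
  have hc : 0 ≤ ε / 2 / logGap p := by positivity
  have hcl : ε / 2 / logGap p * logGap p = ε / 2 := by field_simp
  have hsel1 : ∀ (w : ℕ → ℝ), (∀ i, 0 < w i) → selProb w κ E ≤ 1 := by
    intro w hw
    rw [selProb_eq]
    refine div_le_one_of_le₀ (Finset.sum_le_sum fun i _ => ?_)
      (Finset.sum_nonneg fun i _ => (hw i).le)
    split_ifs
    exacts [le_rfl, (hw i).le]
  have hbad : ∑ η : Fin (numSamples κ ε δ β p) → Finset (Fin n)
      with ¬ MostlyMissing orc κ (minCount κ δ p) p i₀ η, ∏ i, subsetProb p (η i) ≤ δ := by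
    refine (sum_not_mostlyMissing orc κ hp0 hp1 i₀).trans ?_
    have harg := minCount_arg_gt (κ := κ) hδ hp0 hp1
    have : -(p * minCount κ δ p / 8) = -Real.log (16 * (κ + 1) * (1 + 1 / δ) / p) := by
      unfold minCount
      field_simp
    rw [this, Real.exp_neg, Real.exp_log (by linarith)]
    have hκ' : (0 : ℝ) < κ + 1 := by positivity
    -- The argument of the logarithm in `minCount` is chosen to cancel the union bound and leave `1
    -- / (1 + 1/δ)`.
    rw [show ((κ : ℝ) + 1) * (16 / p * (16 * ((κ : ℝ) + 1) * (1 + 1 / δ) / p)⁻¹) = δ / (δ + 1) by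
      field_simp]
    exact div_le_self hδ.le (by linarith)
  unfold mechProb
  rw [Finset.mul_sum]
  refine le_trans ?_ (add_le_add_right hbad _)
  rw [Finset.sum_filter, ← Finset.sum_add_distrib]
  refine Finset.sum_le_sum fun η _ => ?_
  by_cases hη : MostlyMissing orc κ (minCount κ δ p) p i₀ η
  · have key := selProb_le_mul (a := ε / 2) hκ
      (weight_pos orc κ (numSamples κ ε δ β p) (minCount κ δ p) (8 * p * α * α)
        (ε / 2 / logGap p) (extendList η))
      (weight_pos orc' κ (numSamples κ ε δ β p) (minCount κ δ p) (8 * p * α * α)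
        (ε / 2 / logGap p) (extendList η))
      (fun i hi => by
        have := weight_le_mul (h := 8 * p * α * α) hr hN hc hp0.le hp1 hmono hmono' heq hη hi.le
        rwa [hcl] at this)
      (fun i hi => by
        have := weight_le_mul (h := 8 * p * α * α) hr hN hc hp0.le hp1 hmono' hmono
          (fun i S hS => (heq i S hS).symm) (mostlyMissing_congr heq hη) hi.le
        rwa [hcl] at this) E
    rw [mul_div_cancel₀ _ two_ne_zero] at key
    simp only [hη, not_true_eq_false, if_false, add_zero]
    rw [mul_left_comm]
    exact mul_le_mul_of_nonneg_left key (hP η)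
  · simp only [hη, not_false_eq_true, if_true]
    refine le_trans (mul_le_of_le_one_right (hP η) (hsel1 _ (weight_pos _ _ _ _ _ _ _))) ?_
    refine le_add_of_nonneg_left (mul_nonneg (Real.exp_pos _).le (mul_nonneg (hP η) ?_))
    exact selProb_nonneg (weight_pos _ _ _ _ _ _ _) _ _

theorem mechProb_range {orc : ℕ → Finset (Fin n) → ℝ} {κ : ℕ} {ε δ β α p : ℝ} (hκ : 0 < κ)
    {E : Set ℕ} (hE : ∀ i < κ, i ∈ E) : mechProb orc κ ε δ β α p E = 1 := by
  classical
  have hsel : ∀ w : ℕ → ℝ, (∀ i, 0 < w i) → selProb w κ E = 1 := by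
    intro w hw
    rw [selProb_eq, Finset.sum_congr rfl fun i hi => if_pos (hE i (Finset.mem_range.1 hi))]
    exact div_self (Finset.sum_pos (fun i _ => hw i) (by simp; omega)).ne'
  unfold mechProb
  simp only [hsel _ (weight_pos _ _ _ _ _ _ _), mul_one]
  exact sum_prod_subsetProb p

end Privacy

/-! ### Concentration for random subsets with an exceptional set -/

section Concentration

variable {ι : Type*} {p : ℝ}

/-- The average of `F` over the random subset of `s` with inclusion probability `p`. -/
def subsetAvg (p : ℝ) (s : Finset ι) (F : Finset ι → ℝ) : ℝ :=
  ∑ S ∈ s.powerset, p ^ S.card * (1 - p) ^ (s.card - S.card) * F S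

theorem subsetAvg_empty (F : Finset ι → ℝ) : subsetAvg p ∅ F = F ∅ := by
  simp [subsetAvg]

theorem subsetAvg_congr {s : Finset ι} {F G : Finset ι → ℝ} (h : ∀ S ⊆ s, F S = G S) :
    subsetAvg p s F = subsetAvg p s G :=
  Finset.sum_congr rfl fun S hS => by rw [h S (Finset.mem_powerset.1 hS)]

theorem subsetAvg_mono (h0 : 0 ≤ p) (h1 : p ≤ 1) {s : Finset ι} {F G : Finset ι → ℝ}
    (h : ∀ S ⊆ s, F S ≤ G S) : subsetAvg p s F ≤ subsetAvg p s G :=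
  Finset.sum_le_sum fun S hS => mul_le_mul_of_nonneg_left (h S (Finset.mem_powerset.1 hS))
    (mul_nonneg (pow_nonneg h0 _) (pow_nonneg (by linarith) _))

theorem subsetAvg_add (s : Finset ι) (F G : Finset ι → ℝ) :
    subsetAvg p s (fun S => F S + G S) = subsetAvg p s F + subsetAvg p s G := by
  simp [subsetAvg, mul_add, Finset.sum_add_distrib]

theorem subsetAvg_mul (s : Finset ι) (F : Finset ι → ℝ) (c : ℝ) :
    subsetAvg p s (fun S => c * F S) = c * subsetAvg p s F := by
  simp only [subsetAvg, Finset.mul_sum]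
  exact Finset.sum_congr rfl fun S _ => by ring

variable [DecidableEq ι]

theorem subsetAvg_insert {a : ι} {s : Finset ι} (ha : a ∉ s) (F : Finset ι → ℝ) :
    subsetAvg p (insert a s) F =
      p * subsetAvg p s (fun S => F (insert a S)) + (1 - p) * subsetAvg p s F := by
  unfold subsetAvg
  rw [Finset.sum_powerset_insert ha, Finset.card_insert_of_notMem ha, add_comm, Finset.mul_sum,
    Finset.mul_sum]
  congr 1
  · refine Finset.sum_congr rfl fun S hS => ?_
    have hS' := Finset.mem_powerset.1 hS
    rw [Finset.card_insert_of_notMem fun h => ha (hS' h),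
      show s.card + 1 - (S.card + 1) = s.card - S.card by omega]
    ring
  · refine Finset.sum_congr rfl fun S hS => ?_
    have := Finset.card_le_card (Finset.mem_powerset.1 hS)
    rw [show s.card + 1 - S.card = s.card - S.card + 1 by omega]
    ring

theorem subsetAvg_const (s : Finset ι) (c : ℝ) : subsetAvg p s (fun _ => c) = c := by
  induction s using Finset.induction_on with
  | empty => simp [subsetAvg_empty]
  | insert a s ha ih => rw [subsetAvg_insert ha, ih]; ring

theorem subsetAvg_nonneg (h0 : 0 ≤ p) (h1 : p ≤ 1) {s : Finset ι} {F : Finset ι → ℝ}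
    (h : ∀ S, 0 ≤ F S) : 0 ≤ subsetAvg p s F := by
  rw [← subsetAvg_const (p := p) s 0]
  exact subsetAvg_mono h0 h1 fun S _ => h S

open Classical in
/-- The indicator of the event that the inclusion of `a` matters by more than `c`. -/
def influential (h : Finset ι → ℝ) (c : ℝ) (a : ι) (S : Finset ι) : ℝ :=
  if c < |h (insert a S) - h (S.erase a)| then 1 else 0

theorem influential_nonneg (h : Finset ι → ℝ) (c : ℝ) (a : ι) (S : Finset ι) :
    0 ≤ influential h c a S := by
  unfold influential
  split_ifs <;> simp

/-- By `exp x ≤ 1 + x + x²` for `|x| ≤ 1`: the linear terms cancel, and the quadratic ones sum to `p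
(1 - p) D²`. The variance factor `p` is essential, since it makes deviations scale with `p n` rather
than `n`. -/
theorem two_point_exp {D : ℝ} (h0 : 0 ≤ p) (h1 : p ≤ 1) (hD : |D| ≤ 1) :
    p * Real.exp ((1 - p) * D) + (1 - p) * Real.exp (-p * D) ≤ Real.exp (p * D ^ 2) := by
  have hp' : 0 ≤ 1 - p := by linarith
  have a1 : |(1 - p) * D| ≤ 1 := by
    rw [abs_mul, abs_of_nonneg hp']; nlinarith [abs_nonneg D]
  have a2 : |-p * D| ≤ 1 := by
    rw [abs_mul, abs_neg, abs_of_nonneg h0]; nlinarith [abs_nonneg D]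
  have b1 := (abs_le.1 (Real.abs_exp_sub_one_sub_id_le a1)).2
  have b2 := (abs_le.1 (Real.abs_exp_sub_one_sub_id_le a2)).2
  have b3 := Real.add_one_le_exp (p * D ^ 2)
  have c1 := mul_le_mul_of_nonneg_left b1 h0
  have c2 := mul_le_mul_of_nonneg_left b2 hp'
  nlinarith [mul_nonneg (mul_nonneg h0 h0) (sq_nonneg D)]

open Classical in
/-- A function that rarely depends strongly on single elements agrees on most subsets with a
function that is sub-Gaussian around the average. -/
theorem exists_subgaussian_modification (h0 : 0 ≤ p) (h1 : p ≤ 1) {R c : ℝ} (hR : 0 < R)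
    (hc : 0 < c) (s : Finset ι) (h : Finset ι → ℝ) (hh0 : ∀ S, 0 ≤ h S) (hhR : ∀ S, h S ≤ R) :
    ∃ h' : Finset ι → ℝ, (∀ θ : ℝ, |θ| * (2 * c) ≤ 1 →
      subsetAvg p s (fun S => Real.exp (θ * (h' S - subsetAvg p s h))) ≤
        Real.exp (s.card * (p * (θ * (2 * c)) ^ 2))) ∧
      subsetAvg p s (fun S => if h' S = h S then 0 else 1) ≤
        R / c * ∑ a ∈ s, subsetAvg p s (influential h c a) := by
  induction s using Finset.induction_on generalizing h with
  | empty => exact ⟨h, fun θ _ => by simp [subsetAvg_empty], by simp [subsetAvg_empty]⟩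
  | insert a s ha ih =>
    have hinf : subsetAvg p (insert a s) (influential h c a) =
        subsetAvg p s (influential h c a) := by
      rw [subsetAvg_insert ha]
      have : subsetAvg p s (fun S => influential h c a (insert a S)) =
          subsetAvg p s (influential h c a) := by
        refine subsetAvg_congr fun S hS => ?_
        have hS' : a ∉ S := fun h => ha (hS h)
        simp only [influential, Finset.insert_idem, Finset.erase_insert hS',
          Finset.erase_eq_of_notMem hS']
      rw [this]
      ring
    have hnn : ∀ b (t : Finset ι), 0 ≤ subsetAvg p t (influential h c b) := fun b t =>
      subsetAvg_nonneg h0 h1 fun S => influential_nonneg _ _ _ _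
    have hRc : 0 < R / c := by positivity
    -- If `a` is influential too often, the allowed exceptional probability exceeds `1` and the
    -- constant average will do.
    by_cases hbig : c < R * subsetAvg p s (influential h c a)
    · refine ⟨fun _ => subsetAvg p (insert a s) h, fun θ _ => ?_, ?_⟩
      · simp only [sub_self, mul_zero, Real.exp_zero, subsetAvg_const]
        exact Real.one_le_exp (by positivity)
      · calc _ ≤ subsetAvg p (insert a s) (fun _ => (1 : ℝ)) :=
              subsetAvg_mono h0 h1 fun S _ => by split_ifs <;> simp
          _ = 1 := subsetAvg_const _ _
          _ ≤ R / c * subsetAvg p (insert a s) (influential h c a) := by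
              rw [hinf, div_mul_eq_mul_div, le_div_iff₀ hc]
              linarith
          _ ≤ _ := by
              refine mul_le_mul_of_nonneg_left ?_ hRc.le
              exact Finset.single_le_sum (f := fun b => subsetAvg p (insert a s) (influential h c b))
                (fun b _ => hnn b _) (Finset.mem_insert_self a s)
    · obtain ⟨h₁, e₁, b₁⟩ := ih (fun S => h (insert a S)) (fun S => hh0 _) (fun S => hhR _)
      obtain ⟨h₀, e₀, b₀⟩ := ih h hh0 hhR
      set m₁ := subsetAvg p s (fun S => h (insert a S)) with hm₁
      set m₀ := subsetAvg p s h with hm₀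
      have hm : subsetAvg p (insert a s) h = p * m₁ + (1 - p) * m₀ := subsetAvg_insert ha h
      -- The conditional averages with and without `a` differ by at most `c` from the typical
      -- subsets, plus `R` times the probability of being influential, which is at most `c` in this
      -- case.
      have hdiff : |m₁ - m₀| ≤ 2 * c := by
        have hpt : ∀ S ⊆ s, |h (insert a S) - h S| ≤ c + R * influential h c a S := by
          intro S hS
          have hS' : a ∉ S := fun h => ha (hS h)
          unfold influential
          rw [Finset.erase_eq_of_notMem hS']
          split_ifs with hlt
          · have := abs_le.2 (⟨by linarith [hh0 (insert a S), hhR S],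
              by linarith [hh0 S, hhR (insert a S)]⟩ : -R ≤ h (insert a S) - h S ∧ _ ≤ R)
            linarith
          · linarith
        have hup : m₁ ≤ m₀ + (c + R * subsetAvg p s (influential h c a)) := by
          rw [hm₁, hm₀, ← subsetAvg_mul, ← subsetAvg_const (p := p) s c, ← subsetAvg_add,
            ← subsetAvg_add, subsetAvg_const]
          exact subsetAvg_mono h0 h1 fun S hS => by linarith [(abs_le.1 (hpt S hS)).2]
        have hlo : m₀ ≤ m₁ + (c + R * subsetAvg p s (influential h c a)) := by
          rw [hm₁, hm₀, ← subsetAvg_mul, ← subsetAvg_const (p := p) s c, ← subsetAvg_add,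
            ← subsetAvg_add, subsetAvg_const]
          exact subsetAvg_mono h0 h1 fun S hS => by linarith [(abs_le.1 (hpt S hS)).1]
        exact abs_le.2 ⟨by linarith, by linarith⟩
      -- The modifications of the two halves are glued. Each is sub-Gaussian about its own average,
      -- and the two averages form a two-point variable to which `two_point_exp` applies.
      refine ⟨fun S => if a ∈ S then h₁ (S.erase a) else h₀ S, fun θ hθ => ?_, ?_⟩
      · rw [subsetAvg_insert ha, hm]
        have g₁ : subsetAvg p s (fun S => Real.exp (θ * ((if a ∈ insert a S then
            h₁ ((insert a S).erase a) else h₀ (insert a S)) - (p * m₁ + (1 - p) * m₀)))) =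
            Real.exp ((1 - p) * (θ * (m₁ - m₀))) *
              subsetAvg p s (fun S => Real.exp (θ * (h₁ S - m₁))) := by
          rw [← subsetAvg_mul s (fun S => Real.exp (θ * (h₁ S - m₁)))]
          refine subsetAvg_congr fun S hS => ?_
          rw [if_pos (Finset.mem_insert_self a S), Finset.erase_insert fun h => ha (hS h),
            ← Real.exp_add]
          ring_nf
        have g₀ : subsetAvg p s (fun S => Real.exp (θ * ((if a ∈ S then
            h₁ (S.erase a) else h₀ S) - (p * m₁ + (1 - p) * m₀)))) =
            Real.exp (-p * (θ * (m₁ - m₀))) *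
              subsetAvg p s (fun S => Real.exp (θ * (h₀ S - m₀))) := by
          rw [← subsetAvg_mul s (fun S => Real.exp (θ * (h₀ S - m₀)))]
          refine subsetAvg_congr fun S hS => ?_
          rw [if_neg fun h => ha (hS h), ← Real.exp_add]
          ring_nf
        rw [g₁, g₀]
        have hθD : |θ * (m₁ - m₀)| ≤ |θ| * (2 * c) := by
          rw [abs_mul]; exact mul_le_mul_of_nonneg_left hdiff (abs_nonneg θ)
        have hp' : 0 ≤ 1 - p := by linarith
        calc _ ≤ p * (Real.exp ((1 - p) * (θ * (m₁ - m₀))) *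
                Real.exp (s.card * (p * (θ * (2 * c)) ^ 2))) +
              (1 - p) * (Real.exp (-p * (θ * (m₁ - m₀))) *
                Real.exp (s.card * (p * (θ * (2 * c)) ^ 2))) := by
              gcongr
              · exact e₁ θ hθ
              · exact e₀ θ hθ
          _ = Real.exp (s.card * (p * (θ * (2 * c)) ^ 2)) *
              (p * Real.exp ((1 - p) * (θ * (m₁ - m₀))) +
                (1 - p) * Real.exp (-p * (θ * (m₁ - m₀)))) := by ring
          _ ≤ Real.exp (s.card * (p * (θ * (2 * c)) ^ 2)) * Real.exp (p * (θ * (2 * c)) ^ 2) := by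
              refine mul_le_mul_of_nonneg_left ?_ (Real.exp_pos _).le
              refine (two_point_exp h0 h1 (hθD.trans hθ)).trans (Real.exp_le_exp.2 ?_)
              refine mul_le_mul_of_nonneg_left ?_ h0
              rw [sq_le_sq, abs_mul θ (2 * c), abs_of_pos (show 0 < 2 * c by positivity)]
              exact hθD
          _ = _ := by
              rw [← Real.exp_add, Finset.card_insert_of_notMem ha]
              push_cast
              ring_nf
      · rw [subsetAvg_insert ha, Finset.sum_insert ha, mul_add]
        have hp' : 0 ≤ 1 - p := by linarith
        have g₁ : subsetAvg p s (fun S => if (if a ∈ insert a S then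
            h₁ ((insert a S).erase a) else h₀ (insert a S)) = h (insert a S) then (0 : ℝ) else 1) =
            subsetAvg p s (fun S => if h₁ S = h (insert a S) then 0 else 1) := by
          refine subsetAvg_congr fun S hS => ?_
          rw [if_pos (Finset.mem_insert_self a S), Finset.erase_insert fun h => ha (hS h)]
        have g₀ : subsetAvg p s (fun S => if (if a ∈ S then
            h₁ (S.erase a) else h₀ S) = h S then (0 : ℝ) else 1) =
            subsetAvg p s (fun S => if h₀ S = h S then 0 else 1) := by
          refine subsetAvg_congr fun S hS => ?_
          rw [if_neg fun h => ha (hS h)]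
        have hsum : ∑ b ∈ s, subsetAvg p (insert a s) (influential h c b) =
            p * ∑ b ∈ s, subsetAvg p s (influential (fun S => h (insert a S)) c b) +
            (1 - p) * ∑ b ∈ s, subsetAvg p s (influential h c b) := by
          rw [Finset.mul_sum, Finset.mul_sum, ← Finset.sum_add_distrib]
          refine Finset.sum_congr rfl fun b hb => ?_
          rw [subsetAvg_insert ha]
          congr 2
          refine subsetAvg_congr fun S _ => ?_
          have hab : a ≠ b := fun h => ha (h ▸ hb)
          unfold influential
          rw [Finset.insert_comm b a, Finset.erase_insert_of_ne hab]
        rw [g₁, g₀, hsum]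
        have k1 := mul_le_mul_of_nonneg_left b₁ h0
        have k0 := mul_le_mul_of_nonneg_left b₀ hp'
        have k2 := mul_nonneg hRc.le (hnn a (insert a s))
        linarith

open Classical in
theorem subsetAvg_deviation (h0 : 0 < p) (h1 : p ≤ 1) {R c u : ℝ} (hR : 0 < R)
    (hc : 0 < c) {s : Finset ι} (hs : 0 < s.card) {h : Finset ι → ℝ} (hh0 : ∀ S, 0 ≤ h S)
    (hhR : ∀ S, h S ≤ R) (hu0 : 0 ≤ u) (hu : u ≤ 4 * c * (p * s.card)) :
    subsetAvg p s (fun S => if u ≤ |h S - subsetAvg p s h| then 1 else 0) ≤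
      2 * Real.exp (-(u ^ 2 / (16 * c ^ 2 * (p * s.card)))) +
        R / c * ∑ a ∈ s, subsetAvg p s (influential h c a) := by
  obtain ⟨h', he, hb⟩ := exists_subgaussian_modification h0.le h1 hR hc s h hh0 hhR
  set m := subsetAvg p s h
  have hscard : (0 : ℝ) < s.card := by exact_mod_cast hs
  -- The minimizer of `4c²p|s|θ² - θu`; the hypothesis `hu` is exactly what puts it into the
  -- admissible range.
  set θ := u / (8 * c ^ 2 * (p * s.card)) with hθ
  have hθ0 : 0 ≤ θ := by positivity
  have hθ1 : θ * (2 * c) ≤ 1 := by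
    rw [hθ, div_mul_eq_mul_div, div_le_one (by positivity)]
    nlinarith
  have hexp : s.card * (p * (θ * (2 * c)) ^ 2) - θ * u = -(u ^ 2 / (16 * c ^ 2 * (p * s.card))) := by
    rw [hθ]
    field_simp
    ring
  have e1 := he θ (by rwa [abs_of_nonneg hθ0])
  have e2 := he (-θ) (by rwa [abs_neg, abs_of_nonneg hθ0])
  rw [show (-θ * (2 * c)) ^ 2 = (θ * (2 * c)) ^ 2 by ring] at e2
  have hpt : ∀ S ⊆ s, (if u ≤ |h S - m| then (1 : ℝ) else 0) ≤
      Real.exp (-(θ * u)) * Real.exp (θ * (h' S - m)) +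
      Real.exp (-(θ * u)) * Real.exp (-θ * (h' S - m)) + (if h' S = h S then 0 else 1) := by
    intro S _
    have p1 : 0 < Real.exp (-(θ * u)) * Real.exp (θ * (h' S - m)) := by positivity
    have p2 : 0 < Real.exp (-(θ * u)) * Real.exp (-θ * (h' S - m)) := by positivity
    split_ifs with hS heq heq
    · rw [heq] at p1 p2 ⊢
      rcases le_abs.1 hS with hle | hle
      · have : 1 ≤ Real.exp (-(θ * u)) * Real.exp (θ * (h S - m)) := by
          rw [← Real.exp_add]; exact Real.one_le_exp (by nlinarith)
        linarith
      · have : 1 ≤ Real.exp (-(θ * u)) * Real.exp (-θ * (h S - m)) := by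
          rw [← Real.exp_add]; exact Real.one_le_exp (by nlinarith)
        linarith
    all_goals linarith
  refine (subsetAvg_mono h0.le h1 hpt).trans ?_
  rw [subsetAvg_add, subsetAvg_add, subsetAvg_mul, subsetAvg_mul]
  refine add_le_add ?_ hb
  rw [← hexp, two_mul]
  refine add_le_add ?_ ?_
  · refine (mul_le_mul_of_nonneg_left e1 (Real.exp_pos _).le).trans (le_of_eq ?_)
    rw [← Real.exp_add]
    ring_nf
  · refine (mul_le_mul_of_nonneg_left e2 (Real.exp_pos _).le).trans (le_of_eq ?_)
    rw [← Real.exp_add]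
    ring_nf

end Concentration

/-! ### The size of a random subset -/

section Size

variable {n : ℕ} {p : ℝ}

theorem sum_subsetProb_mul (p : ℝ) (F : Finset (Fin n) → ℝ) :
    ∑ S, subsetProb p S * F S = subsetAvg p Finset.univ F := by
  simp [subsetAvg, subsetProb]

theorem subsetAvg_exp_card (s : Finset (Fin n)) (θ : ℝ) :
    subsetAvg p s (fun S => Real.exp (θ * S.card)) = (1 + p * (Real.exp θ - 1)) ^ s.card := by
  induction s using Finset.induction_on with
  | empty => simp [subsetAvg_empty]
  | insert a s ha ih =>
    have : subsetAvg p s (fun S => Real.exp (θ * (insert a S).card)) =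
        Real.exp θ * subsetAvg p s (fun S => Real.exp (θ * S.card)) := by
      rw [← subsetAvg_mul]
      refine subsetAvg_congr fun S hS => ?_
      rw [Finset.card_insert_of_notMem fun h => ha (hS h), ← Real.exp_add]
      push_cast
      ring_nf
    rw [subsetAvg_insert ha, this, ih, Finset.card_insert_of_notMem ha]
    ring

open Classical in
theorem subsetAvg_card_large (h0 : 0 ≤ p) (h1 : p ≤ 1) :
    subsetAvg p (Finset.univ : Finset (Fin n))
      (fun S => if 2 * (p * n) < S.card then 1 else 0) ≤ Real.exp (-(p * n / 8)) := by
  have hle : ∀ S : Finset (Fin n), (if 2 * (p * n) < S.card then (1 : ℝ) else 0) ≤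
      Real.exp (-(2 * (p * n))) * Real.exp (1 * S.card) := by
    intro S
    rw [← Real.exp_add]
    split_ifs with h
    · exact Real.one_le_exp (by linarith)
    · exact (Real.exp_pos _).le
  refine (subsetAvg_mono h0 h1 fun S _ => hle S).trans ?_
  have hpn : 0 ≤ p * n := by positivity
  have e2 := Real.exp_one_lt_d9
  have e3 : (1 + p * (Real.exp 1 - 1)) ^ n ≤ Real.exp (n * (p * (Real.exp 1 - 1))) := by
    rw [Real.exp_nat_mul]
    refine pow_le_pow_left₀ ?_ (by linarith [Real.add_one_le_exp (p * (Real.exp 1 - 1))]) n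
    nlinarith [Real.add_one_le_exp (1 : ℝ)]
  rw [subsetAvg_mul, subsetAvg_exp_card, Finset.card_univ, Fintype.card_fin]
  refine (mul_le_mul_of_nonneg_left e3 (Real.exp_pos _).le).trans ?_
  rw [← Real.exp_add, Real.exp_le_exp]
  nlinarith

open Classical in
theorem subsetAvg_card_small (h0 : 0 ≤ p) (h1 : p ≤ 1) :
    subsetAvg p (Finset.univ : Finset (Fin n))
      (fun S => if (S.card : ℝ) < p * n / 2 then 1 else 0) ≤ Real.exp (-(p * n / 8)) := by
  have hle : ∀ S : Finset (Fin n), (if (S.card : ℝ) < p * n / 2 then (1 : ℝ) else 0) ≤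
      Real.exp (p * n / 2) * Real.exp (-1 * S.card) := by
    intro S
    rw [← Real.exp_add]
    split_ifs with h
    · exact Real.one_le_exp (by linarith)
    · exact (Real.exp_pos _).le
  refine (subsetAvg_mono h0 h1 fun S _ => hle S).trans ?_
  have hpn : 0 ≤ p * n := by positivity
  -- The exponent is `(exp (-1) - 1/2) p n`, and `0.375 - 1/2 = -1/8`.
  have e2 : Real.exp (-1) < 0.375 := by
    have := Real.exp_one_gt_d9
    rw [Real.exp_neg, inv_lt_comm₀ (Real.exp_pos _) (by norm_num)]
    norm_num
    linarith
  have e3 : (1 + p * (Real.exp (-1) - 1)) ^ n ≤ Real.exp (n * (p * (Real.exp (-1) - 1))) := by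
    rw [Real.exp_nat_mul]
    refine pow_le_pow_left₀ ?_ (by linarith [Real.add_one_le_exp (p * (Real.exp (-1) - 1))]) n
    nlinarith [Real.exp_pos (-1)]
  rw [subsetAvg_mul, subsetAvg_exp_card, Finset.card_univ, Fintype.card_fin]
  refine (mul_le_mul_of_nonneg_left e3 (Real.exp_pos _).le).trans ?_
  rw [← Real.exp_add, Real.exp_le_exp]
  nlinarith

end Size

/-! ### Losses of subsamples -/

section Losses

variable {d : ℕ} {𝒵 : Type*} [MeasurableSpace 𝒵] (T : LossModel d 𝒵)

theorem LossModel.empLoss_nonneg {θ : Fin (d + 1) → ℝ} (hθ : θ ∈ T.params) {n : ℕ}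
    (Z : Fin n → Option 𝒵) : 0 ≤ T.empLoss θ Z := by
  refine mul_nonneg (by positivity) (Finset.sum_nonneg fun i _ => ?_)
  cases Z i with
  | none => exact le_rfl
  | some z => exact T.loss_nonneg θ hθ z

theorem LossModel.bddBelow (A : Set ℝ) {n : ℕ} (Z : Fin n → Option 𝒵) :
    BddBelow ((fun θ => T.empLoss θ Z) '' {θ | θ ∈ T.params ∧ θ 0 ∈ A}) :=
  ⟨0, by rintro _ ⟨θ, hθ, rfl⟩; exact T.empLoss_nonneg hθ.1 Z⟩

theorem LossModel.minLossOn_nonneg (A : Set ℝ) {n : ℕ} (Z : Fin n → Option 𝒵) :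
    0 ≤ T.minLossOn A Z :=
  Real.sInf_nonneg (by rintro _ ⟨θ, hθ, rfl⟩; exact T.empLoss_nonneg hθ.1 Z)

theorem LossModel.minLossOn_le {A : Set ℝ} {θ : Fin (d + 1) → ℝ} (hθ : θ ∈ T.params)
    (hA : θ 0 ∈ A) {n : ℕ} (Z : Fin n → Option 𝒵) : T.minLossOn A Z ≤ T.empLoss θ Z :=
  csInf_le (T.bddBelow A Z) ⟨θ, ⟨hθ, hA⟩, rfl⟩

theorem LossModel.le_minLossOn {A : Set ℝ} {n : ℕ} {Z : Fin n → Option 𝒵} {a : ℝ}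
    (hA : ∃ θ ∈ T.params, θ 0 ∈ A) (h : ∀ θ ∈ T.params, θ 0 ∈ A → a ≤ T.empLoss θ Z) :
    a ≤ T.minLossOn A Z := by
  obtain ⟨θ, hθ, hθA⟩ := hA
  refine le_csInf ⟨_, θ, ⟨hθ, hθA⟩, rfl⟩ ?_
  rintro _ ⟨θ, hθ, rfl⟩
  exact h θ hθ.1 hθ.2

theorem LossModel.minLossOn_mono_set {A B : Set ℝ} (hAB : A ⊆ B) (hA : ∃ θ ∈ T.params, θ 0 ∈ A)
    {n : ℕ} (Z : Fin n → Option 𝒵) : T.minLossOn B Z ≤ T.minLossOn A Z :=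
  T.le_minLossOn hA fun _ hθ hθA => T.minLossOn_le hθ (hAB hθA) Z

theorem LossModel.empLoss_subsample_mono {θ : Fin (d + 1) → ℝ} (hθ : θ ∈ T.params) {n : ℕ}
    (Z : Fin n → 𝒵) {S S' : Finset (Fin n)} (h : S ⊆ S') :
    T.empLoss θ (subsample Z S) ≤ T.empLoss θ (subsample Z S') := by
  refine mul_le_mul_of_nonneg_left (Finset.sum_le_sum fun i _ => ?_) (by positivity)
  unfold subsample
  by_cases h1 : i ∈ S
  · rw [if_pos h1, if_pos (h h1)]
  · rw [if_neg h1]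
    split_ifs
    exacts [T.loss_nonneg θ hθ _, le_rfl]

theorem LossModel.minLossOn_subsample_mono {A : Set ℝ} (hA : ∃ θ ∈ T.params, θ 0 ∈ A) {n : ℕ}
    (Z : Fin n → 𝒵) {S S' : Finset (Fin n)} (h : S ⊆ S') :
    T.minLossOn A (subsample Z S) ≤ T.minLossOn A (subsample Z S') :=
  T.le_minLossOn hA fun _ hθ hθA =>
    (T.minLossOn_le hθ hθA _).trans (T.empLoss_subsample_mono hθ Z h)

/-- The entries of `Z` in `S`, as a dataset of their own. -/
def restrictTo {n m : ℕ} (S : Finset (Fin n)) (h : S.card = m) (Z : Fin n → 𝒵) : Fin m → 𝒵 :=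
  fun i => Z (S.orderEmbOfFin h i)

/-- Dropped entries contribute no loss but still count in the normalization, hence the factor `m /
n`. This is how assumptions about datasets of size `m` reach subsamples. -/
theorem LossModel.empLoss_subsample (θ : Fin (d + 1) → ℝ) {n m : ℕ} (Z : Fin n → 𝒵)
    (S : Finset (Fin n)) (hS : S.card = m) :
    T.empLoss θ (subsample Z S) = (m / n : ℝ) * T.empLoss θ (full (restrictTo S hS Z)) := by
  have hsum : ∑ i, (subsample Z S i).elim 0 (T.loss θ) =
      ∑ i, (full (restrictTo S hS Z) i).elim 0 (T.loss θ) := by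
    have h1 : ∑ i, (subsample Z S i).elim 0 (T.loss θ) = ∑ i ∈ S, T.loss θ (Z i) := by
      rw [← Finset.sum_filter_add_sum_filter_not Finset.univ (· ∈ S)]
      rw [Finset.sum_congr (s₂ := S) (g := fun i => T.loss θ (Z i)) (by simp)
        fun i hi => by simp [subsample, hi]]
      refine add_eq_left.2 (Finset.sum_eq_zero fun i hi => ?_)
      simp [subsample, (Finset.mem_filter.1 hi).2]
    rw [h1]
    refine (Finset.sum_bij' (s := Finset.univ) (t := S) (fun i _ => S.orderEmbOfFin hS i)
      (fun a ha => (S.orderIsoOfFin hS).symm ⟨a, ha⟩) ?_ ?_ ?_ ?_ ?_).symm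
    · intro i _; exact S.orderEmbOfFin_mem hS i
    · intro _ _; exact Finset.mem_univ _
    · intro i _
      rw [OrderIso.symm_apply_eq]
      rfl
    · intro a ha
      exact congrArg Subtype.val ((S.orderIsoOfFin hS).apply_symm_apply ⟨a, ha⟩)
    · intro i _
      simp [full, restrictTo]
  unfold empLoss
  rw [hsum]
  rcases Nat.eq_zero_or_pos m with rfl | hm
  · simp
  · field_simp

theorem LossModel.empLoss_erase (θ : Fin (d + 1) → ℝ) {n m : ℕ} (Z : Fin n → 𝒵)
    (S : Finset (Fin n)) (hS : S.card = m) (i : Fin m) :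
    T.empLoss θ (subsample Z (S.erase (S.orderEmbOfFin hS i))) =
      (m / n : ℝ) * T.empLoss θ (dropEntry (restrictTo S hS Z) i) := by
  have hm : m ≠ 0 := by
    rintro rfl
    exact i.elim0
  have h1 : ∀ {k : ℕ} (W : Fin k → 𝒵) (A : Finset (Fin k)) (a : Fin k), a ∈ A →
      ∑ j, (subsample W (A.erase a) j).elim 0 (T.loss θ) =
        ∑ j, (subsample W A j).elim 0 (T.loss θ) - T.loss θ (W a) := by
    intro k W A a ha
    rw [eq_sub_iff_add_eq, ← Finset.sum_erase_add _ _ (Finset.mem_univ a),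
      ← Finset.sum_erase_add _ _ (Finset.mem_univ a)]
    have : ∑ j ∈ Finset.univ.erase a, (subsample W (A.erase a) j).elim 0 (T.loss θ) =
        ∑ j ∈ Finset.univ.erase a, (subsample W A j).elim 0 (T.loss θ) := by
      refine Finset.sum_congr rfl fun j hj => ?_
      have := Finset.ne_of_mem_erase hj
      simp [subsample, this]
    rw [this]
    simp [subsample, ha]
  have h2 := T.empLoss_subsample θ Z S hS
  have h3 : dropEntry (restrictTo S hS Z) i = subsample (restrictTo S hS Z) (Finset.univ.erase i) := by
    funext j
    by_cases hj : j = i <;> simp [dropEntry, subsample, hj]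
  have h4 : full (restrictTo S hS Z) = subsample (restrictTo S hS Z) Finset.univ := by
    funext j
    simp [full, subsample]
  rw [h4] at h2
  rw [h3]
  unfold empLoss at h2 ⊢
  rw [h1 _ _ _ (S.orderEmbOfFin_mem hS i), h1 _ _ _ (Finset.mem_univ i), mul_sub, h2]
  simp only [restrictTo]
  field_simp

theorem LossModel.minLossOn_scale {n m : ℕ} (A : Set ℝ) {Y : Fin n → Option 𝒵}
    {W : Fin m → Option 𝒵} {a : ℝ} (ha : 0 ≤ a)
    (h : ∀ θ, T.empLoss θ Y = a * T.empLoss θ W) : T.minLossOn A Y = a * T.minLossOn A W := by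
  unfold minLossOn
  rw [← smul_eq_mul, ← Real.sInf_smul_of_nonneg ha, ← Set.image_smul, Set.image_image]
  simp only [h, smul_eq_mul]

theorem LossModel.minLossOn_subsample (A : Set ℝ) {n m : ℕ} (Z : Fin n → 𝒵)
    (S : Finset (Fin n)) (hS : S.card = m) :
    T.minLossOn A (subsample Z S) = (m / n : ℝ) * T.minLossOn A (full (restrictTo S hS Z)) :=
  T.minLossOn_scale A (by positivity) fun θ => T.empLoss_subsample θ Z S hS

theorem LossModel.minLossOn_erase (A : Set ℝ) {n m : ℕ} (Z : Fin n → 𝒵)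
    (S : Finset (Fin n)) (hS : S.card = m) (i : Fin m) :
    T.minLossOn A (subsample Z (S.erase (S.orderEmbOfFin hS i))) =
      (m / n : ℝ) * T.minLossOn A (dropEntry (restrictTo S hS Z) i) :=
  T.minLossOn_scale A (by positivity) fun θ => T.empLoss_erase θ Z S hS i

section Partition

variable {T} {κ : ℕ} {I : Fin κ → Set ℝ}

theorem IsIntervalPartition.exists_param (hI : IsIntervalPartition I T.firstCoords) (i : Fin κ) :
    ∃ θ ∈ T.params, θ 0 ∈ I i := by
  obtain ⟨w, hw⟩ := hI.nonempty i
  have : w ∈ T.firstCoords := hI.cover ▸ Set.mem_iUnion.2 ⟨i, hw⟩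
  obtain ⟨θ, hθ, rfl⟩ := this
  exact ⟨θ, hθ, hw⟩

theorem IsIntervalPartition.exists_mem (hI : IsIntervalPartition I T.firstCoords)
    {θ : Fin (d + 1) → ℝ} (hθ : θ ∈ T.params) : ∃ i, θ 0 ∈ I i := by
  have : θ 0 ∈ ⋃ i, I i := hI.cover ▸ ⟨θ, hθ, rfl⟩
  exact Set.mem_iUnion.1 this

theorem IsIntervalPartition.pos (hI : IsIntervalPartition I T.firstCoords) : 0 < κ := by
  obtain ⟨θ, hθ⟩ := T.params_nonempty
  obtain ⟨i, -⟩ := hI.exists_mem hθ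
  exact i.pos

theorem lossOracle_erase_le (hI : IsIntervalPartition I T.firstCoords) {n : ℕ} (Z : Fin n → 𝒵)
    (i₀ : Fin n) (i : ℕ) (S : Finset (Fin n)) :
    lossOracle T I Z i (S.erase i₀) ≤ lossOracle T I Z i S := by
  unfold lossOracle
  split_ifs with h
  · exact T.minLossOn_subsample_mono (hI.exists_param _) Z (Finset.erase_subset _ _)
  · exact le_rfl

theorem lossOracle_congr {n : ℕ} {Z Z' : Fin n → 𝒵} {i₀ : Fin n} (h : ∀ j, j ≠ i₀ → Z j = Z' j)
    (i : ℕ) (S : Finset (Fin n)) (hS : i₀ ∉ S) :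
    lossOracle T I Z i S = lossOracle T I Z' i S := by
  have : subsample Z S = subsample Z' S := by
    funext j
    unfold subsample
    split_ifs with hj
    · rw [h j fun h => hS (h ▸ hj)]
    · rfl
  unfold lossOracle
  rw [this]

theorem rowMin_le_of_lt {σ : Type*} (orc : ℕ → σ → ℝ) (S : σ) {i m : ℕ} (h : i < m) :
    rowMin orc S m ≤ orc i S := by
  induction m with
  | zero => omega
  | succ m ih =>
    rcases Nat.lt_succ_iff_lt_or_eq.1 h with hlt | rfl
    exacts [(min_le_right _ _).trans (ih hlt), min_le_left _ _]

theorem le_rowMin {σ : Type*} (orc : ℕ → σ → ℝ) (S : σ) {m : ℕ} {a : ℝ} (hm : 0 < m)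
    (h : ∀ i < m, a ≤ orc i S) : a ≤ rowMin orc S m := by
  have : ∀ k ≤ m, a ≤ rowMin orc S k := by
    intro k hk
    induction k with
    | zero => exact h 0 hm
    | succ k ih => exact le_min (h k (by omega)) (ih (by omega))
  exact this m le_rfl

/-- The intervals cover all first coordinates, so the `κ` answers already determine the global
minimum. -/
theorem rowMin_lossOracle (hI : IsIntervalPartition I T.firstCoords) {n : ℕ} (Z : Fin n → 𝒵)
    (S : Finset (Fin n)) :
    rowMin (lossOracle T I Z) S κ = T.minLoss (subsample Z S) := by
  have horc : ∀ i : Fin κ, lossOracle T I Z i S = T.minLossOn (I i) (subsample Z S) := fun i => by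
    simp [lossOracle]
  apply le_antisymm
  · obtain ⟨θ, hθ⟩ := T.params_nonempty
    refine T.le_minLossOn ⟨θ, hθ, Set.mem_univ _⟩ fun θ hθ _ => ?_
    obtain ⟨i, hi⟩ := hI.exists_mem hθ
    refine (rowMin_le_of_lt _ S i.2).trans ?_
    rw [horc]
    exact T.minLossOn_le hθ hi _
  · refine le_rowMin _ S hI.pos fun i hi => ?_
    rw [horc ⟨i, hi⟩]
    exact T.minLossOn_mono_set (Set.subset_univ _) (hI.exists_param _) _

end Partition

end Losses

/-! ### Upper bounds for averages of functions that need not be measurable -/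

section Upper

variable {α : Type*} [MeasurableSpace α] {μ : Measure α}

/-- The function `F` has a measurable majorant with integral at most `q`. -/
def UpperLe (μ : Measure α) (F : α → ℝ) (q : ℝ) : Prop :=
  ∃ u : α → ℝ≥0∞, Measurable u ∧ (∀ z, ENNReal.ofReal (F z) ≤ u z) ∧ ∫⁻ z, u z ∂μ ≤ ENNReal.ofReal q

theorem UpperLe.mono {F G : α → ℝ} {q r : ℝ} (h : UpperLe μ G q) (hFG : ∀ z, F z ≤ G z)
    (hqr : q ≤ r) : UpperLe μ F r := by
  obtain ⟨u, h1, h2, h3⟩ := h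
  exact ⟨u, h1, fun z => (ENNReal.ofReal_le_ofReal (hFG z)).trans (h2 z),
    h3.trans (ENNReal.ofReal_le_ofReal hqr)⟩

theorem UpperLe.add {F G : α → ℝ} {q r : ℝ} (h : UpperLe μ F q) (h' : UpperLe μ G r)
    (hq : 0 ≤ q) (hr : 0 ≤ r) : UpperLe μ (fun z => F z + G z) (q + r) := by
  obtain ⟨u, h1, h2, h3⟩ := h
  obtain ⟨v, k1, k2, k3⟩ := h'
  refine ⟨fun z => u z + v z, h1.add k1, fun z => ENNReal.ofReal_add_le.trans
    (add_le_add (h2 z) (k2 z)), ?_⟩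
  rw [lintegral_add_left h1, ENNReal.ofReal_add hq hr]
  exact add_le_add h3 k3

theorem UpperLe.const_mul {F : α → ℝ} {q c : ℝ} (h : UpperLe μ F q) (hc : 0 ≤ c) :
    UpperLe μ (fun z => c * F z) (c * q) := by
  obtain ⟨u, h1, h2, h3⟩ := h
  refine ⟨fun z => ENNReal.ofReal c * u z, h1.const_mul _, fun z => ?_, ?_⟩
  · rw [ENNReal.ofReal_mul hc]
    exact mul_le_mul_right (h2 z) _
  · rw [lintegral_const_mul _ h1, ENNReal.ofReal_mul hc]
    exact mul_le_mul_right h3 _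

theorem UpperLe.const [IsProbabilityMeasure μ] (c : ℝ) : UpperLe μ (fun _ => c) c :=
  ⟨fun _ => ENNReal.ofReal c, measurable_const, fun _ => le_rfl, by simp⟩

theorem UpperLe.sum {ι : Type*} {s : Finset ι} {F : ι → α → ℝ} {q : ι → ℝ}
    (h : ∀ i ∈ s, UpperLe μ (F i) (q i)) (hq : ∀ i ∈ s, 0 ≤ q i) :
    UpperLe μ (fun z => ∑ i ∈ s, F i z) (∑ i ∈ s, q i) := by
  classical
  induction s using Finset.induction_on with
  | empty => exact ⟨fun _ => 0, measurable_const, by simp, by simp⟩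
  | insert a s ha ih =>
    simp only [Finset.sum_insert ha]
    exact (h a (by simp)).add (ih (fun i hi => h i (by simp [hi])) fun i hi => hq i (by simp [hi]))
      (hq a (by simp)) (Finset.sum_nonneg fun i hi => hq i (by simp [hi]))

open Classical in
-- The majorant is the indicator of a measurable hull. Measurability is an issue because losses are
-- infima over arbitrary families and the minimizer is arbitrary.
theorem UpperLe.indicator {s : Set α} {b : ℝ} (h : μ s ≤ ENNReal.ofReal b) :
    UpperLe μ (fun z => if z ∈ s then 1 else 0) b := by
  refine ⟨(toMeasurable μ s).indicator 1,
    measurable_one.indicator (measurableSet_toMeasurable μ s), fun z => ?_, ?_⟩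
  · simp only
    split_ifs with hz
    · simp [Set.indicator_of_mem (subset_toMeasurable μ s hz)]
    · simp
  · rw [lintegral_indicator_one (measurableSet_toMeasurable μ s), measure_toMeasurable]
    exact h

theorem UpperLe.subsetAvg {n : ℕ} {p : ℝ} (h0 : 0 ≤ p) (h1 : p ≤ 1)
    {F : Finset (Fin n) → α → ℝ} {q : ℝ} (hq : 0 ≤ q) (h : ∀ S, UpperLe μ (F S) q) :
    UpperLe μ (fun z => PrivEst.subsetAvg p Finset.univ fun S => F S z) q := by
  have := UpperLe.sum (s := (Finset.univ : Finset (Finset (Fin n))))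
    (F := fun S z => subsetProb p S * F S z) (q := fun S => subsetProb p S * q)
    (fun S _ => (h S).const_mul (subsetProb_nonneg h0 h1 S))
    (fun S _ => mul_nonneg (subsetProb_nonneg h0 h1 S) hq)
  simp only [sum_subsetProb_mul] at this
  rwa [subsetAvg_const] at this

/-- Integrate the inequality after replacing `F` by its measurable majorant; additivity then needs
no measurability of `G`. -/
theorem UpperLe.ofReal_le_lintegral {F G : α → ℝ} {a q : ℝ} [IsProbabilityMeasure μ]
    (h : UpperLe μ F q) (hle : ∀ z, a ≤ G z + F z) (hq : 0 ≤ q) :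
    ENNReal.ofReal (a - q) ≤ ∫⁻ z, ENNReal.ofReal (G z) ∂μ := by
  obtain ⟨u, h1, h2, h3⟩ := h
  rw [ENNReal.ofReal_sub _ hq, tsub_le_iff_right]
  calc ENNReal.ofReal a = ∫⁻ _, ENNReal.ofReal a ∂μ := by simp
    _ ≤ ∫⁻ z, (ENNReal.ofReal (G z) + u z) ∂μ := lintegral_mono fun z =>
        (ENNReal.ofReal_le_ofReal (hle z)).trans
          (ENNReal.ofReal_add_le.trans (add_le_add_right (h2 z) _))
    _ = ∫⁻ z, ENNReal.ofReal (G z) ∂μ + ∫⁻ z, u z ∂μ := lintegral_add_right _ h1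
    _ ≤ _ := add_le_add_right h3 _

/-- For a fixed `S` the kept entries are distributed as `D^m`; a measurable hull of `B` covers
events that are not measurable. -/
theorem measure_restrictTo_preimage_le {𝒵 : Type*} [MeasurableSpace 𝒵] (D : Measure 𝒵)
    [IsProbabilityMeasure D] {n m : ℕ} (S : Finset (Fin n)) (hS : S.card = m)
    {B : Set (Fin m → 𝒵)} {b : ℝ≥0∞} (hB : iid D m B ≤ b) :
    iid D n {Z | restrictTo S hS Z ∈ B} ≤ b := by
  have hmeas : Measurable (restrictTo S hS : (Fin n → 𝒵) → Fin m → 𝒵) :=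
    measurable_pi_lambda _ fun i => measurable_pi_apply _
  have hinj : Function.Injective (S.orderEmbOfFin hS) := (S.orderEmbOfFin hS).injective
  have hmap : (iid D n).map (restrictTo S hS) = iid D m := by
    refine (Measure.pi_eq fun s hs => ?_).symm
    rw [Measure.map_apply hmeas (MeasurableSet.univ_pi hs)]
    have hpre : restrictTo S hS ⁻¹' Set.univ.pi s =
        Set.univ.pi (Function.extend (S.orderEmbOfFin hS) s fun _ => (Set.univ : Set 𝒵)) := by
      ext Z
      simp only [Set.mem_preimage, Set.mem_univ_pi, restrictTo]
      constructor
      · intro h j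
        by_cases hj : ∃ i, S.orderEmbOfFin hS i = j
        · obtain ⟨i, rfl⟩ := hj
          rw [hinj.extend_apply]
          exact h i
        · rw [Function.extend_apply' _ _ _ hj]
          trivial
      · intro h i
        have := h (S.orderEmbOfFin hS i)
        rwa [hinj.extend_apply] at this
    rw [hpre, iid, Measure.pi_pi]
    refine (Fintype.prod_of_injective _ hinj _ _ (fun j hj => ?_) fun i => ?_).symm
    · rw [Function.extend_apply' _ _ _ fun ⟨i, hi⟩ => hj ⟨i, hi⟩]
      simp
    · rw [hinj.extend_apply]
  calc iid D n {Z | restrictTo S hS Z ∈ B}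
      ≤ iid D n (restrictTo S hS ⁻¹' toMeasurable (iid D m) B) :=
        measure_mono fun Z hZ => subset_toMeasurable _ _ hZ
    _ = iid D m (toMeasurable (iid D m) B) := by
        rw [← Measure.map_apply hmeas (measurableSet_toMeasurable _ _), hmap]
    _ = iid D m B := measure_toMeasurable _
    _ ≤ b := hB

end Upper

/-! ### Accuracy -/

section Separation

variable {d : ℕ} {𝒵 : Type*} [MeasurableSpace 𝒵] {T : LossModel d 𝒵}
  {θD : Fin (d + 1) → ℝ} {ϑ : Fin (d + 1) → ℝ} {mu α p : ℝ} {n : ℕ} {Z : Fin n → 𝒵}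
  {S : Finset (Fin n)}

/-- Smoothness at distance `α / (2√μ)` costs at most `α²/2`, and the scaling `|S|/n ≤ 2p` turns this
into `pα²`. -/
theorem minLossOn_le_of_mem (hθD : θD ∈ T.params) (hmu : 0 < mu) (hn : 0 < n)
    (hcard : (S.card : ℝ) ≤ 2 * (p * n)) (hϑ : |ϑ 0 - θD 0| < α / 2 / Real.sqrt mu)
    (hsc : ∀ w ∈ T.firstCoords,
      T.minLossOn {w} (full (restrictTo S rfl Z)) - T.minLoss (full (restrictTo S rfl Z)) ≤
        2 * mu * (w - ϑ 0) ^ 2) {A : Set ℝ} (hA : θD 0 ∈ A) :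
    T.minLossOn A (subsample Z S) ≤ T.minLoss (subsample Z S) + p * α ^ 2 := by
  have hn' : (0 : ℝ) < n := by exact_mod_cast hn
  have h1 := hsc _ ⟨θD, hθD, rfl⟩
  have h2 : T.minLossOn A (full (restrictTo S rfl Z)) ≤
      T.minLossOn {θD 0} (full (restrictTo S rfl Z)) :=
    T.minLossOn_mono_set (Set.singleton_subset_iff.2 hA) ⟨θD, hθD, rfl⟩ _
  have h3 : 2 * mu * (θD 0 - ϑ 0) ^ 2 ≤ α ^ 2 / 2 := by
    rw [lt_div_iff₀ (Real.sqrt_pos.2 hmu)] at hϑ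
    have h4 : (|ϑ 0 - θD 0| * Real.sqrt mu) ^ 2 ≤ (α / 2) ^ 2 :=
      pow_le_pow_left₀ (by positivity) hϑ.le 2
    rw [mul_pow, sq_abs, Real.sq_sqrt hmu.le] at h4
    nlinarith
  have h5 : (S.card / n : ℝ) ≤ 2 * p := by
    rw [div_le_iff₀ hn']; linarith
  rw [LossModel.minLoss, T.minLossOn_subsample A Z S rfl, T.minLossOn_subsample Set.univ Z S rfl]
  have h6 : (0 : ℝ) ≤ S.card / n := by positivity
  calc (S.card / n : ℝ) * T.minLossOn A (full (restrictTo S rfl Z))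
      ≤ S.card / n * (T.minLoss (full (restrictTo S rfl Z)) + α ^ 2 / 2) :=
        mul_le_mul_of_nonneg_left (by linarith) h6
    _ = S.card / n * T.minLossOn Set.univ (full (restrictTo S rfl Z)) +
        S.card / n * (α ^ 2 / 2) := by rw [LossModel.minLoss]; ring
    _ ≤ _ := by nlinarith [sq_nonneg α]

/-- The distance to the empirical minimizer is still at least `9α/√μ`, which by strong convexity
costs at least `81α²/2 ≥ 40α²`. The scaling `|S|/n ≥ p/2` leaves `20pα²`. -/
theorem le_minLossOn_of_far (hmu : 0 < mu) (hα : 0 < α) (hn : 0 < n)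
    (hcard : p * n / 2 ≤ S.card) (hϑ : |ϑ 0 - θD 0| < α / 2 / Real.sqrt mu)
    (hsc : ∀ w ∈ T.firstCoords, mu * (w - ϑ 0) ^ 2 / 2 ≤
      T.minLossOn {w} (full (restrictTo S rfl Z)) - T.minLoss (full (restrictTo S rfl Z)))
    {A : Set ℝ} (hA : ∃ θ ∈ T.params, θ 0 ∈ A)
    (hfar : ∀ w ∈ A, 10 * α / Real.sqrt mu ≤ |θD 0 - w|) :
    T.minLoss (subsample Z S) + 20 * (p * α ^ 2) ≤ T.minLossOn A (subsample Z S) := by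
  have hn' : (0 : ℝ) < n := by exact_mod_cast hn
  have hs := Real.sqrt_pos.2 hmu
  have h5 : p / 2 ≤ (S.card / n : ℝ) := by
    rw [le_div_iff₀ hn']; linarith
  have h6 : (0 : ℝ) ≤ S.card / n := by positivity
  have key : T.minLoss (full (restrictTo S rfl Z)) + 40 * α ^ 2 ≤
      T.minLossOn A (full (restrictTo S rfl Z)) := by
    refine T.le_minLossOn hA fun θ hθ hθA => ?_
    have h1 := hsc _ ⟨θ, hθ, rfl⟩
    have h2 := T.minLossOn_le (A := {θ 0}) hθ rfl (full (restrictTo S rfl Z))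
    have h3 : 40 * α ^ 2 ≤ mu * (θ 0 - ϑ 0) ^ 2 / 2 := by
      have h7 : (9 * α) / Real.sqrt mu ≤ |θ 0 - ϑ 0| := by
        have h8 := hfar _ hθA
        have h9 : |θD 0 - θ 0| ≤ |ϑ 0 - θD 0| + |θ 0 - ϑ 0| := by
          rw [abs_sub_comm (ϑ 0) (θD 0), abs_sub_comm (θ 0) (ϑ 0)]
          exact abs_sub_le _ _ _
        have h10 : 10 * α / Real.sqrt mu - α / 2 / Real.sqrt mu ≥ 9 * α / Real.sqrt mu := by
          rw [ge_iff_le, ← sub_div]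
          gcongr
          linarith
        linarith
      rw [div_le_iff₀ hs] at h7
      have h4 : (9 * α) ^ 2 ≤ (|θ 0 - ϑ 0| * Real.sqrt mu) ^ 2 :=
        pow_le_pow_left₀ (by positivity) h7 2
      rw [mul_pow |θ 0 - ϑ 0|, sq_abs, Real.sq_sqrt hmu.le] at h4
      nlinarith
    linarith
  rw [LossModel.minLoss, T.minLossOn_subsample A Z S rfl, T.minLossOn_subsample Set.univ Z S rfl]
  have := mul_le_mul_of_nonneg_left key h6
  rw [LossModel.minLoss, mul_add] at this
  nlinarith [sq_nonneg α]

end Separation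

section Selection

variable {n : ℕ}

theorem sum_prod_subsetProb_mul {N : ℕ} (p : ℝ) (j : Fin N) (G : Finset (Fin n) → ℝ) :
    ∑ η : Fin N → Finset (Fin n), (∏ i, subsetProb p (η i)) * G (η j) =
      ∑ S, subsetProb p S * G S := by
  classical
  have := Finset.prod_univ_sum (fun _ : Fin N => (Finset.univ : Finset (Finset (Fin n))))
    (fun i S => subsetProb p S * if i = j then G S else 1)
  rw [Fintype.piFinset_univ] at this
  simp only [Finset.prod_mul_distrib, Finset.prod_ite_eq', Finset.mem_univ, if_true] at this
  rw [← this, Finset.prod_eq_single j]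
  · simp
  · intro i _ hi
    simp [hi, sum_subsetProb]
  · simp

theorem cnt_eq_of_forall {N : ℕ} {x : ℕ → ℝ} {t : ℝ} (h : ∀ j < N, x j ≤ t) : cnt N x t = N := by
  rw [cnt, Finset.filter_true_of_mem fun j hj => h j (Finset.mem_range.1 hj), Finset.card_range]

theorem cnt_eq_zero {N : ℕ} {x : ℕ → ℝ} {t : ℝ} (h : ∀ j < N, t < x j) : cnt N x t = 0 := by
  rw [cnt, Finset.filter_false_of_mem fun j hj => not_le.2 (h j (Finset.mem_range.1 hj)),
    Finset.card_empty]

theorem score_eq_div {N : ℕ} {r h : ℝ} (hr : 0 < r) {x y : ℕ → ℝ}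
    (hxy : ∀ i < N, ∀ j < N, y i ≤ x j + h) : score N r h x y = N / r := by
  refine le_antisymm score_le_div (le_scoreTo_iff.2 ⟨le_rfl, fun j hj => le_trans ?_ (le_max_left _ _)⟩)
  rw [cnt_eq_of_forall fun i hi => hxy i hi j hj]
  gcongr
  exact le_max_left _ _

/-- At the largest entry of `x` as threshold, all of `x` and none of `y` is counted, so both ratios
equal `1`. -/
theorem score_eq_one {N : ℕ} {r h : ℝ} (hr : 0 < r) (hN : r ≤ N) {x y : ℕ → ℝ}
    (hxy : ∀ i < N, ∀ j < N, x j + h < y i) : score N r h x y = 1 := by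
  refine le_antisymm ?_ (one_le_score hr hN)
  have hN0 : 0 < N := by
    have : (0 : ℝ) < N := hr.trans_le hN
    exact_mod_cast this
  obtain ⟨j, hj, hmax⟩ := Finset.exists_max_image (Finset.range N) x ⟨0, by simpa using hN0⟩
  refine ((le_scoreTo_iff.1 le_rfl).2 j (Finset.mem_range.1 hj)).trans ?_
  unfold level
  rw [cnt_eq_zero fun i hi => hxy i hi j (Finset.mem_range.1 hj),
    cnt_eq_of_forall fun i hi => hmax i (Finset.mem_range.2 hi), Nat.cast_zero, max_eq_right hr.le,
    max_eq_left hN, div_self hr.ne', div_self (hr.trans_le hN).ne', max_self]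

/-- At most `κ - 1` indices lie outside `E`, each of weight `1`, against a total of at least `w i₀`.
-/
theorem selProb_ge {w : ℕ → ℝ} {κ i₀ : ℕ} {E : Set ℕ} {a : ℝ} (hw : ∀ i, 0 < w i) (hi₀ : i₀ < κ)
    (hi₀E : i₀ ∈ E) (hout : ∀ i < κ, i ∉ E → w i = 1) (ha : ((κ : ℝ) - 1) ≤ a * w i₀) (ha0 : 0 ≤ a) :
    1 - a ≤ selProb w κ E := by
  classical
  have htot : 0 < ∑ i ∈ Finset.range κ, w i :=
    Finset.sum_pos (fun i _ => hw i) (by simp; omega)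
  rw [selProb_eq, le_div_iff₀ htot]
  have hsplit : ∑ i ∈ Finset.range κ, w i = (∑ i ∈ Finset.range κ, if i ∈ E then w i else 0) +
      ∑ i ∈ Finset.range κ, if i ∈ E then 0 else w i := by
    rw [← Finset.sum_add_distrib]
    exact Finset.sum_congr rfl fun i _ => by split_ifs <;> simp
  have hbad : (∑ i ∈ Finset.range κ, if i ∈ E then 0 else w i) ≤ κ - 1 := by
    rw [← Finset.sum_erase_add _ _ (Finset.mem_range.2 hi₀), if_pos hi₀E, add_zero]
    calc _ ≤ ∑ i ∈ (Finset.range κ).erase i₀, (1 : ℝ) := Finset.sum_le_sum fun i hi => by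
          split_ifs with h
          · exact zero_le_one
          · exact (hout i (Finset.mem_range.1 (Finset.mem_of_mem_erase hi)) h).le
      _ = κ - 1 := by
          rw [Finset.sum_const, Finset.card_erase_of_mem (Finset.mem_range.2 hi₀), Finset.card_range,
            nsmul_eq_mul, mul_one, Nat.cast_sub (by omega), Nat.cast_one]
  have hone : w i₀ ≤ ∑ i ∈ Finset.range κ, w i :=
    Finset.single_le_sum (f := w) (fun i _ => (hw i).le) (Finset.mem_range.2 hi₀)
  nlinarith [mul_le_mul_of_nonneg_left hone ha0]

open Classical in
/-- The mechanism is accurate if most subsamples are typical. -/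
theorem mechProb_ge {orc : ℕ → Finset (Fin n) → ℝ} {κ : ℕ} {ε δ β α p c : ℝ} (hε : 0 < ε)
    (hδ : 0 < δ) (hβ0 : 0 < β) (hβ1 : β < 1) (hp0 : 0 < p) (hp1 : p < 1 / 4) (hα : 0 < α)
    {typ : Finset (Fin n) → Prop} {i₀ : ℕ} (hi₀ : i₀ < κ) {E : Set ℕ} (hi₀E : i₀ ∈ E)
    (hconc : ∀ S, typ S → |rowMin orc S κ - c| < 7 / 2 * (p * α ^ 2))
    (hgood : ∀ S, typ S → orc i₀ S ≤ rowMin orc S κ + p * α ^ 2)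
    (hbad : ∀ S, typ S → ∀ i < κ, i ∉ E → rowMin orc S κ + 20 * (p * α ^ 2) ≤ orc i S) :
    1 - β / 2 ≤ mechProb orc κ ε δ β α p E + numSamples κ ε δ β p *
      subsetAvg p Finset.univ (fun S => if typ S then 0 else 1) := by
  set N := numSamples κ ε δ β p with hNdef
  set r := minCount κ δ p with hrdef
  have hr : 0 < r := minCount_pos hδ hp0 hp1
  have hraw : r ≤ rawCount κ ε δ β p := minCount_le_rawCount hε hδ hβ0 hβ1 hp0 hp1
  have hN : r ≤ N := hraw.trans rawCount_le_numSamples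
  have hlg := logGap_pos hp0 hp1
  have hpα : 0 < p * α ^ 2 := by positivity
  have hP : ∀ η : Fin N → Finset (Fin n), 0 ≤ ∏ i, subsetProb p (η i) :=
    fun η => Finset.prod_nonneg fun i _ => subsetProb_nonneg hp0.le (by linarith) _
  have hsel : ∀ η : Fin N → Finset (Fin n), (∀ j, typ (η j)) →
      1 - β / 2 ≤ selProb (weight orc κ N r (8 * p * α * α) (ε / 2 / logGap p) (extendList η)) κ E := by
    intro η hη
    have htyp : ∀ j < N, typ (extendList η j) := fun j hj => by
      have := hη ⟨j, hj⟩
      simpa [extendList, hj] using this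
    have hcol : ∀ i < κ, ∀ S, column orc κ i S = orc i S := fun i hi S => by
      rw [column, if_neg hi.ne]
    have hmin : ∀ S, column orc κ κ S = rowMin orc S κ := fun S => by rw [column, if_pos rfl]
    refine selProb_ge (weight_pos _ _ _ _ _ _ _) hi₀ hi₀E (fun i hi hiE => ?_) ?_ (by positivity)
    · unfold weight
      rw [score_eq_one hr hN, Real.log_one, mul_zero, Real.exp_zero]
      intro a ha b hb
      rw [hcol i hi, hmin]
      have h1 := hbad _ (htyp a ha) i hi hiE
      have h2 := abs_lt.1 (hconc _ (htyp a ha))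
      have h3 := abs_lt.1 (hconc _ (htyp b hb))
      -- In units of `pα²`: two minima differ by less than `7`, the shift is `8`, and the gap is `20
      -- > 7 + 8`.
      nlinarith [h2.1, h3.2]
    · have hw : weight orc κ N r (8 * p * α * α) (ε / 2 / logGap p) (extendList η) i₀ =
          Real.exp (ε / 2 / logGap p * Real.log (N / r)) := by
        unfold weight
        rw [score_eq_div hr]
        intro a ha b hb
        rw [hcol i₀ hi₀, hmin]
        have h1 := hgood _ (htyp a ha)
        have h2 := abs_lt.1 (hconc _ (htyp a ha))
        have h3 := abs_lt.1 (hconc _ (htyp b hb))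
        -- In the same units, `1 + 7 ≤ 8`; this is what fixes the shift.
        nlinarith [h2.2, h3.1]
      have hlog : 8 / ε * logGap p * Real.log κ * Real.log (2 / β) ≤ Real.log (N / r) := by
        rw [Real.le_log_iff_exp_le (div_pos (hr.trans_le hN) hr), le_div_iff₀' hr]
        exact rawCount_le_numSamples
      have hge : 4 * Real.log κ * Real.log (2 / β) ≤ ε / 2 / logGap p * Real.log (N / r) := by
        refine le_trans (le_of_eq ?_) (mul_le_mul_of_nonneg_left hlog
          (show 0 ≤ ε / 2 / logGap p by positivity))
        field_simp
        ring
      rw [hw]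
      -- For `κ = 1` the logarithm of `κ` vanishes and the weight may be small, but there is no
      -- wrong answer.
      rcases Nat.lt_or_ge κ 2 with hκ | hκ
      · have : (κ : ℝ) - 1 ≤ 0 := by
          have : (κ : ℝ) ≤ 1 := by exact_mod_cast (by omega : κ ≤ 1)
          linarith
        exact this.trans (by positivity)
      · have hκ' : (2 : ℝ) ≤ κ := by exact_mod_cast hκ
        have hβ2 : 2 ≤ 2 / β := by rw [le_div_iff₀ hβ0]; linarith
        have l2 := Real.log_two_gt_d9
        have l3 : Real.log 2 ≤ Real.log κ := Real.log_le_log two_pos hκ'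
        have l4 : Real.log 2 ≤ Real.log (2 / β) := Real.log_le_log two_pos hβ2
        -- Both logarithms are at least `log 2 > 1/2`, so four times their product dominates their
        -- sum.
        have l5 : Real.log κ + Real.log (2 / β) ≤ 4 * Real.log κ * Real.log (2 / β) := by nlinarith
        have l6 : κ * (2 / β) ≤ Real.exp (ε / 2 / logGap p * Real.log (N / r)) := by
          rw [← Real.exp_log (show (0 : ℝ) < κ by linarith),
            ← Real.exp_log (show (0 : ℝ) < 2 / β by positivity), ← Real.exp_add, Real.exp_le_exp]
          linarith
        have l7 := mul_le_mul_of_nonneg_left l6 (show 0 ≤ β / 2 by positivity)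
        have l8 : β / 2 * (κ * (2 / β)) = κ := by field_simp
        linarith
  have hunion : ∀ η : Fin N → Finset (Fin n), 1 - β / 2 ≤
      selProb (weight orc κ N r (8 * p * α * α) (ε / 2 / logGap p) (extendList η)) κ E +
        ∑ j, if typ (η j) then (0 : ℝ) else 1 := by
    intro η
    have h0 := selProb_nonneg (weight_pos orc κ N r (8 * p * α * α) (ε / 2 / logGap p)
      (extendList η)) κ E
    by_cases hη : ∀ j, typ (η j)
    · simp only [hη, if_true, Finset.sum_const_zero, add_zero]
      exact hsel η hη
    · push Not at hη
      obtain ⟨j, hj⟩ := hη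
      have := Finset.single_le_sum (f := fun j => if typ (η j) then (0 : ℝ) else 1)
        (fun i _ => by split_ifs <;> simp) (Finset.mem_univ j)
      simp only [hj, if_false] at this
      linarith
  calc 1 - β / 2 = ∑ η : Fin N → Finset (Fin n), (∏ i, subsetProb p (η i)) * (1 - β / 2) := by
        rw [← Finset.sum_mul, sum_prod_subsetProb, one_mul]
    _ ≤ ∑ η : Fin N → Finset (Fin n), (∏ i, subsetProb p (η i)) *
        (selProb (weight orc κ N r (8 * p * α * α) (ε / 2 / logGap p) (extendList η)) κ E +
        ∑ j, if typ (η j) then (0 : ℝ) else 1) :=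
        Finset.sum_le_sum fun η _ => mul_le_mul_of_nonneg_left (hunion η) (hP η)
    _ = _ := by
        simp only [mul_add, Finset.sum_add_distrib, Finset.mul_sum]
        rw [Finset.sum_comm]
        simp only [sum_prod_subsetProb_mul p _ fun S => if typ S then (0 : ℝ) else 1,
          sum_subsetProb_mul, Finset.sum_const, Finset.card_univ, Fintype.card_fin, nsmul_eq_mul]
        rfl

end Selection

/-! ### Most subsamples are typical -/

section Typical

variable {d : ℕ} {𝒵 : Type*} [MeasurableSpace 𝒵] {T : LossModel d 𝒵} {D : Measure 𝒵}
  {θD : Fin (d + 1) → ℝ} {θE : (n : ℕ) → (Fin n → 𝒵) → Fin (d + 1) → ℝ} {N : ℝ → ℝ}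
  {M K lam mu sig : ℝ} {n : ℕ} {p b : ℝ}

instance [IsProbabilityMeasure D] : IsProbabilityMeasure (iid D n) := by
  unfold iid
  infer_instance

open Classical in
theorem ite_not_le_sum {ι : Type*} (s : Finset ι) {P : Prop} {Q : ι → Prop}
    (h : ¬ P → ∃ i ∈ s, Q i) : (if P then (0 : ℝ) else 1) ≤ ∑ i ∈ s, if Q i then 1 else 0 := by
  have hQ : ∀ i ∈ s, (0 : ℝ) ≤ if Q i then 1 else 0 := fun i _ => by split_ifs <;> simp
  by_cases hP : P
  · rw [if_pos hP]
    exact Finset.sum_nonneg hQ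
  · obtain ⟨i, hi, hQi⟩ := h hP
    rw [if_neg hP]
    refine le_trans (le_of_eq ?_) (Finset.single_le_sum hQ hi)
    rw [if_pos hQi]

/-- The least loss of a subsample, truncated at `R`. -/
def truncLoss (T : LossModel d 𝒵) (R : ℝ) (Z : Fin n → 𝒵) (S : Finset (Fin n)) : ℝ :=
  min (T.minLoss (subsample Z S)) R

/-- A subsample of about the expected size on which the events of the concentration assumption
hold and whose least loss is close to the average. -/
structure Typical (T : LossModel d 𝒵) (θD : Fin (d + 1) → ℝ)
    (θE : (n : ℕ) → (Fin n → 𝒵) → Fin (d + 1) → ℝ) (mu a p R u : ℝ) (Z : Fin n → 𝒵)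
    (S : Finset (Fin n)) : Prop where
  card_ge : p * n / 2 ≤ S.card
  card_le : (S.card : ℝ) ≤ 2 * (p * n)
  param_close : |θE S.card (restrictTo S rfl Z) 0 - θD 0| < a / Real.sqrt mu
  smooth_convex : ∀ w ∈ T.firstCoords,
    mu * (w - θE S.card (restrictTo S rfl Z) 0) ^ 2 / 2 ≤
      T.minLossOn {w} (full (restrictTo S rfl Z)) - T.minLoss (full (restrictTo S rfl Z)) ∧
    T.minLossOn {w} (full (restrictTo S rfl Z)) - T.minLoss (full (restrictTo S rfl Z)) ≤
      2 * mu * (w - θE S.card (restrictTo S rfl Z) 0) ^ 2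
  loss_le : T.minLoss (subsample Z S) ≤ R
  dev_lt : |truncLoss T R Z S - subsetAvg p Finset.univ (truncLoss T R Z)| < u

open Classical in
theorem upperLe_restrictTo [IsProbabilityMeasure D] (hp0 : 0 ≤ p) (hp1 : p ≤ 1) {k : ℝ}
    (hb : 0 ≤ b) {B : (m : ℕ) → Set (Fin m → 𝒵)}
    (hB : ∀ m : ℕ, k ≤ m → iid D m (B m) ≤ ENNReal.ofReal b) :
    UpperLe (iid D n) (fun Z => subsetAvg p Finset.univ fun S =>
      if k ≤ S.card ∧ restrictTo S rfl Z ∈ B S.card then 1 else 0) b := by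
  refine UpperLe.subsetAvg hp0 hp1 hb fun S => ?_
  by_cases hS : k ≤ S.card
  · simp only [hS, true_and]
    exact UpperLe.indicator (measure_restrictTo_preimage_le D S rfl (hB _ hS))
  · simp only [hS, false_and, if_false]
    exact UpperLe.mono (UpperLe.indicator (s := ∅) (b := b) (by simp)) (fun z => by simp) le_rfl

theorem abs_truncLoss_sub_le (R : ℝ) (Z : Fin n → 𝒵) (S S' : Finset (Fin n)) :
    |truncLoss T R Z S - truncLoss T R Z S'| ≤
      |T.minLoss (subsample Z S) - T.minLoss (subsample Z S')| := by
  refine (abs_min_sub_min_le_max _ _ _ _).trans ?_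
  simp

/-- Apart from subsets that are too small, `insert a S` is an i.i.d. sample and erasing `a` drops
one of its entries, so leave-one-out stability applies. Truncation at `R` cannot enlarge
differences. -/
theorem upperLe_influential [IsProbabilityMeasure D]
    (hA : IdentConcStab T D θD θE N M K lam mu sig) (hp0 : 0 ≤ p) (hp1 : p ≤ 1) (hn : 0 < n)
    (hb : 0 < b) {c R : ℝ} (hc : lam * Real.log (2 / b) / n ≤ c)
    (hM : ∀ m : ℕ, p * n / 2 ≤ m → M + K * Real.log (1 / b) ≤ m) (a : Fin n) :
    UpperLe (iid D n) (fun Z => subsetAvg p Finset.univ (influential (truncLoss T R Z) c a))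
      (Real.exp (-(p * n / 8)) + b) := by
  classical
  have hn' : (0 : ℝ) < n := by exact_mod_cast hn
  have h1 : UpperLe (iid D n) (fun _ => subsetAvg p Finset.univ
      fun S : Finset (Fin n) => if (S.card : ℝ) < p * n / 2 then 1 else 0)
      (Real.exp (-(p * n / 8))) :=
    (UpperLe.const (Real.exp (-(p * n / 8)))).mono
      (fun _ => subsetAvg_card_small hp0 hp1) le_rfl
  have h2 : UpperLe (iid D n) (fun Z => subsetAvg p Finset.univ fun S =>
      if p * n / 2 ≤ S.card ∧ c < |truncLoss T R Z (insert a S) - truncLoss T R Z (S.erase a)|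
        then 1 else 0) b := by
    refine UpperLe.subsetAvg hp0 hp1 hb.le fun S => ?_
    by_cases hS : p * n / 2 ≤ S.card
    swap
    · simp only [hS, false_and, if_false]
      exact UpperLe.mono (UpperLe.indicator (s := ∅) (b := b) (by simp)) (fun z => by simp) le_rfl
    have hS' : p * n / 2 ≤ (insert a S).card := hS.trans (by
      exact_mod_cast Finset.card_le_card (Finset.subset_insert a S))
    have hmem : a ∈ Set.range ((insert a S).orderEmbOfFin rfl) := by
      rw [Finset.range_orderEmbOfFin]
      simp
    obtain ⟨i, hi⟩ := hmem
    have hm0 : (0 : ℝ) < (insert a S).card := by exact_mod_cast Finset.card_pos.2 ⟨a, by simp⟩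
    refine (UpperLe.indicator (measure_restrictTo_preimage_le D (insert a S) rfl
      (hA.leave_one_out b hb _ (hM _ hS') i))).mono (fun Z => ?_) le_rfl
    split_ifs with g1 g2 g2
    · exact le_rfl
    · refine absurd ?_ g2
      have g3 := g1.2.trans_le (abs_truncLoss_sub_le R Z _ _)
      have he : (insert a S).erase ((insert a S).orderEmbOfFin rfl i) = S.erase a := by
        rw [hi, Finset.erase_insert_eq_erase]
      rw [← he, LossModel.minLoss, LossModel.minLoss, T.minLossOn_erase _ Z _ rfl i,
        T.minLossOn_subsample _ Z (insert a S) rfl, ← mul_sub, abs_mul,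
        abs_of_pos (div_pos hm0 hn')] at g3
      -- The size `m` of the subsample cancels: stability gives `lam log(2/b) / m`, and the losses
      -- carry the factor `m / n`.
      have g4 := hc.trans g3.le
      rw [div_mul_eq_mul_div, div_le_div_iff_of_pos_right hn', mul_comm ((insert a S).card : ℝ),
        ← div_le_iff₀ hm0] at g4
      exact g4
    · exact zero_le_one
    · exact le_rfl
  refine (h1.add h2 (Real.exp_pos _).le hb.le).mono (fun Z => ?_) le_rfl
  rw [← subsetAvg_add]
  refine subsetAvg_mono hp0 hp1 fun S _ => ?_
  unfold influential
  by_cases hS : (S.card : ℝ) < p * n / 2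
  · rw [if_pos hS]
    split_ifs <;> norm_num
  · have hS' := not_lt.1 hS
    simp only [hS, hS', if_false, true_and, zero_add]
    exact le_rfl

open Classical in
/-- The average number of atypical subsamples. -/
theorem upperLe_not_typical [IsProbabilityMeasure D]
    (hA : IdentConcStab T D θD θE N M K lam mu sig) (hp0 : 0 < p) (hp1 : p ≤ 1) (hn : 0 < n)
    (hb : 0 < b) (hb1 : b ≤ 1) {a c R u : ℝ} (ha : 0 < a) (hc0 : 0 < c)
    (hc : lam * Real.log (2 / b) / n ≤ c) (hR0 : 0 < R)
    (hR : sig ^ 2 * (1 + Real.log (1 / b)) ≤ R) (hu0 : 0 ≤ u) (hu : u ≤ 4 * c * (p * n))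
    (hN : N a + K * Real.log (1 / b) / a ^ 2 ≤ p * n / 2)
    (hM : M + K * Real.log (1 / b) ≤ p * n / 2) :
    UpperLe (iid D n) (fun Z => subsetAvg p Finset.univ fun S =>
        if Typical T θD θE mu a p R u Z S then 0 else 1)
      (2 * Real.exp (-(p * n / 8)) + 3 * b + (2 * Real.exp (-(u ^ 2 / (16 * c ^ 2 * (p * n)))) +
        R / c * (n * (Real.exp (-(p * n / 8)) + b)))) := by
  have hn' : (0 : ℝ) < n := by exact_mod_cast hn
  have hpn : 0 < p * n / 2 := by positivity
  have hlog : 0 ≤ Real.log (1 / b) := Real.log_nonneg (by rw [le_div_iff₀ hb]; linarith)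
  have e1 : UpperLe (iid D n) (fun _ => subsetAvg p Finset.univ
      fun S : Finset (Fin n) => if (S.card : ℝ) < p * n / 2 then 1 else 0)
      (Real.exp (-(p * n / 8))) :=
    (UpperLe.const (Real.exp (-(p * n / 8)))).mono
      (fun _ => subsetAvg_card_small hp0.le hp1) le_rfl
  have e2 : UpperLe (iid D n) (fun _ => subsetAvg p Finset.univ
      fun S : Finset (Fin n) => if 2 * (p * n) < S.card then 1 else 0)
      (Real.exp (-(p * n / 8))) :=
    (UpperLe.const (Real.exp (-(p * n / 8)))).mono
      (fun _ => subsetAvg_card_large hp0.le hp1) le_rfl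
  have e3 := upperLe_restrictTo (n := n) hp0.le hp1 hb.le
    fun m (hm : p * n / 2 ≤ (m : ℝ)) => hA.param_conc a b ha hb m (hN.trans hm)
  have e4 := upperLe_restrictTo (n := n) hp0.le hp1 hb.le
    fun m (hm : p * n / 2 ≤ (m : ℝ)) => hA.smooth_convex b hb m (hM.trans hm)
  have e5 := upperLe_restrictTo (n := n) hp0.le hp1 hb.le
    fun m (hm : p * n / 2 ≤ (m : ℝ)) => hA.tail b hb m (by exact_mod_cast hpn.trans_le hm)
  have e6 : UpperLe (iid D n) (fun Z => subsetAvg p Finset.univ fun S =>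
      if u ≤ |truncLoss T R Z S - subsetAvg p Finset.univ (truncLoss T R Z)| then 1 else 0)
      (2 * Real.exp (-(u ^ 2 / (16 * c ^ 2 * (p * n)))) +
        R / c * (n * (Real.exp (-(p * n / 8)) + b))) := by
    have f1 := UpperLe.sum (s := Finset.univ) (fun i _ => upperLe_influential (R := R) hA hp0.le hp1
      hn hb hc (fun m hm => hM.trans hm) i)
      fun _ _ => add_nonneg (Real.exp_pos _).le hb.le
    simp only [Finset.sum_const, Finset.card_univ, Fintype.card_fin, nsmul_eq_mul] at f1
    have f2 := (UpperLe.const (μ := iid D n)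
      (2 * Real.exp (-(u ^ 2 / (16 * c ^ 2 * (p * n)))))).add
      (f1.const_mul (div_pos hR0 hc0).le) (by positivity) (by positivity)
    refine f2.mono (fun Z => ?_) le_rfl
    have f3 := subsetAvg_deviation hp0 hp1 hR0 hc0 (s := (Finset.univ : Finset (Fin n)))
      (by simpa using hn) (h := truncLoss T R Z)
      (fun S => le_min (T.minLossOn_nonneg _ _) hR0.le) (fun S => min_le_right _ _) hu0
      (by simpa using hu)
    simpa only [Finset.card_univ, Fintype.card_fin] using f3
  have e := (((((e1.add e2 (by positivity) (by positivity)).add e3 (by positivity) hb.le).add e4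
    (by positivity) hb.le).add e5 (by positivity) hb.le).add e6 (by positivity) (by positivity))
  refine e.mono (fun Z => ?_) (le_of_eq (by ring))
  simp only [← subsetAvg_add]
  refine subsetAvg_mono hp0.le hp1 fun S _ => ?_
  -- The six ways to be atypical. The tail event concerns the untruncated loss; excluding it makes
  -- the truncation inactive.
  have hcases : ¬ Typical T θD θE mu a p R u Z S → ∃ i ∈ (Finset.univ : Finset (Fin 6)),
      (![(S.card : ℝ) < p * n / 2, 2 * (p * n) < S.card,
        p * n / 2 ≤ S.card ∧ restrictTo S rfl Z ∈ {Z | a / Real.sqrt mu ≤ |θE S.card Z 0 - θD 0|},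
        p * n / 2 ≤ S.card ∧ restrictTo S rfl Z ∈ {Z | ¬ ∀ w ∈ T.firstCoords,
          mu * (w - θE S.card Z 0) ^ 2 / 2 ≤ T.minLossOn {w} (full Z) - T.minLoss (full Z) ∧
          T.minLossOn {w} (full Z) - T.minLoss (full Z) ≤ 2 * mu * (w - θE S.card Z 0) ^ 2},
        p * n / 2 ≤ S.card ∧ restrictTo S rfl Z ∈
          {Z | sig ^ 2 * (1 + Real.log (1 / b) / S.card) ≤ T.minLoss (full Z)},
        u ≤ |truncLoss T R Z S - subsetAvg p Finset.univ (truncLoss T R Z)|] :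
          Fin 6 → Prop) i := by
    intro htyp
    by_contra hcon
    have hcon' := fun i hi => hcon ⟨i, Finset.mem_univ _, hi⟩
    have g1 := not_lt.1 (hcon' 0)
    have g2 := not_lt.1 (hcon' 1)
    have g3 : ¬ a / Real.sqrt mu ≤ |θE S.card (restrictTo S rfl Z) 0 - θD 0| :=
      fun h => hcon' 2 ⟨g1, h⟩
    have g4 := not_not.1 fun h => hcon' 3 ⟨g1, h⟩
    have g5 : ¬ sig ^ 2 * (1 + Real.log (1 / b) / S.card) ≤ T.minLoss (full (restrictTo S rfl Z)) :=
      fun h => hcon' 4 ⟨g1, h⟩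
    have g6 := not_le.1 (hcon' 5)
    refine htyp ⟨g1, g2, not_le.1 g3, g4, ?_, g6⟩
    have hS0 : (0 : ℝ) < S.card := hpn.trans_le g1
    have hS1 : (1 : ℝ) ≤ S.card := by exact_mod_cast hS0
    have g8 : (S.card : ℝ) ≤ n := by
      exact_mod_cast (Finset.card_le_univ S).trans_eq (Fintype.card_fin n)
    have g9 : Real.log (1 / b) / S.card ≤ Real.log (1 / b) := div_le_self hlog hS1
    rw [LossModel.minLoss, T.minLossOn_subsample _ Z S rfl]
    refine (mul_le_of_le_one_left (T.minLossOn_nonneg _ _) ((div_le_one hn').2 g8)).trans ?_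
    refine ((not_le.1 g5).le.trans ?_).trans hR
    exact mul_le_mul_of_nonneg_left (by linarith) (sq_nonneg sig)
  refine (ite_not_le_sum _ hcases).trans (le_of_eq ?_)
  rw [Fin.sum_univ_six]
  congr!

end Typical

/-! ### Bounds for the number of rounds and for the sample size -/

section Rounds

variable {κ : ℕ} {ε δ β α ρ p : ℝ}

theorem log_two_le_log_div (hβ0 : 0 < β) (hβ1 : β < 1) : Real.log 2 ≤ Real.log (2 / β) :=
  Real.log_le_log two_pos (by rw [le_div_iff₀ hβ0]; linarith)

theorem log_two_le_log_delta (hκ : 0 < κ) (hδ : 0 < δ) :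
    Real.log 2 ≤ Real.log (κ * (2 + 1 / δ)) := by
  have h1 : (1 : ℝ) ≤ κ := by exact_mod_cast hκ
  have h2 : 0 < 1 / δ := by positivity
  exact Real.log_le_log two_pos (by nlinarith)

theorem minCount_le (hκ : 0 < κ) (hδ : 0 < δ) (hp0 : 0 < p) :
    minCount κ δ p ≤ 8 / p * (32 / p + Real.log (κ * (2 + 1 / δ))) := by
  have h1 : (1 : ℝ) ≤ κ := by exact_mod_cast hκ
  have h2 : 0 < 1 / δ := by positivity
  refine mul_le_mul_of_nonneg_left ?_ (by positivity)
  have h3 : 16 * ((κ : ℝ) + 1) * (1 + 1 / δ) / p ≤ 32 / p * (κ * (2 + 1 / δ)) := by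
    rw [div_mul_eq_mul_div, div_le_div_iff_of_pos_right hp0]
    nlinarith
  refine (Real.log_le_log (by positivity) h3).trans ?_
  rw [Real.log_mul (by positivity) (by positivity)]
  linarith [Real.log_le_sub_one_of_pos (show 0 < 32 / p by positivity)]

theorem exponent_le (hε : 0 < ε) (hβ0 : 0 < β) (hβ1 : β < 1) (hp0 : 0 < p) (hp1 : p < 1 / 4) :
    8 / ε * logGap p * Real.log κ * Real.log (2 / β) ≤
      32 * ((p / ε) * Real.log (2 / β) * Real.log κ) := by
  have h2 : 0 ≤ Real.log κ := Real.log_natCast_nonneg κ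
  have h3 := (Real.log_pos one_lt_two).le.trans (log_two_le_log_div hβ0 hβ1)
  have h4 := mul_le_mul_of_nonneg_left (logGap_le hp0 hp1)
    (show 0 ≤ 8 / ε * Real.log κ * Real.log (2 / β) by positivity)
  calc _ = 8 / ε * Real.log κ * Real.log (2 / β) * logGap p := by ring
    _ ≤ _ := h4
    _ = _ := by ring

theorem one_le_minCount (hδ : 0 < δ) (hp0 : 0 < p) (hp1 : p < 1 / 4) : 1 ≤ minCount κ δ p := by
  have h1 := Real.log_le_log two_pos
    ((show (2 : ℝ) ≤ 64 by norm_num).trans (minCount_arg_gt (κ := κ) hδ hp0 hp1))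
  have h2 := Real.log_two_gt_d9
  have h3 : 32 ≤ 8 / p := by rw [le_div_iff₀ hp0]; linarith
  unfold minCount
  nlinarith

theorem numSamples_le (hε : 0 < ε) (hδ : 0 < δ) (hβ0 : 0 < β) (hβ1 : β < 1) (hp0 : 0 < p)
    (hp1 : p < 1 / 4) : (numSamples κ ε δ β p : ℝ) ≤ 2 * rawCount κ ε δ β p := by
  have h1 := (one_le_minCount (κ := κ) hδ hp0 hp1).trans
    (minCount_le_rawCount hε hδ hβ0 hβ1 hp0 hp1)
  have h2 := Nat.floor_le (zero_le_one.trans h1)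
  unfold numSamples
  push_cast
  linarith

theorem minCount_le_sq (hκ : 0 < κ) (hδ : 0 < δ) (hβ0 : 0 < β) (hβ1 : β < 1) (hp0 : 0 < p)
    (hp1 : p < 1 / 4) :
    1 ≤ Real.log (κ * (2 + 1 / δ)) * Real.log (2 / β) / p ∧
    minCount κ δ p ≤ 1300 * (Real.log (κ * (2 + 1 / δ)) * Real.log (2 / β) / p) ^ 2 := by
  have h1 := log_two_le_log_div hβ0 hβ1
  have h2 := log_two_le_log_delta hκ hδ
  have h3 := Real.log_two_gt_d9
  have h4 := minCount_le hκ hδ hp0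
  set G := Real.log (κ * (2 + 1 / δ))
  set H := Real.log (2 / β)
  set Y := G * H / p with hY
  have g1 : 0.69 ≤ G := by linarith
  have g2 : 0.69 ≤ H := by linarith
  have g3 : 0.69 * 0.69 ≤ G * H := by gcongr
  have hYp : Y * p = G * H := by rw [hY]; field_simp
  have hY1 : 1 ≤ Y := by nlinarith
  have hp' : 1 / p ≤ 2.2 * Y := by
    rw [div_le_iff₀ hp0]; nlinarith
  have hG : G ≤ Y := by nlinarith
  refine ⟨hY1, h4.trans ?_⟩
  have e1 : 8 / p = 8 * (1 / p) := by ring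
  have e2 : 32 / p = 32 * (1 / p) := by ring
  have hp'' : 0 < 1 / p := by positivity
  rw [e1, e2]
  calc 8 * (1 / p) * (32 * (1 / p) + G) ≤ 8 * (2.2 * Y) * (32 * (2.2 * Y) + Y) := by gcongr
    _ ≤ 1300 * Y ^ 2 := by nlinarith [sq_nonneg Y]

/-- The running time of the mechanism is within the claimed bound. -/
theorem steps_le (hκ : 0 < κ) (hε : 0 < ε) (hδ : 0 < δ) (hβ0 : 0 < β) (hβ1 : β < 1) (hα : 0 < α)
    (hp0 : 0 < p) (hp1 : p < 1 / 4) (hρ : α ^ 2 ≤ ρ) {C : ℕ} (hC : 2 ^ 31 ≤ C) :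
    ((numSamples κ ε δ β p * (κ * 16 + 21) + (κ * (numSamples κ ε δ β p *
      (numSamples κ ε δ β p * 26 + 41) + 31) + 90) : ℕ) : ℝ) ≤
      C * Real.exp (C * ((p / ε) * Real.log (2 / β) * Real.log (κ * ρ / α ^ 2))) * κ *
        (Real.log (κ * (2 + 1 / δ)) * Real.log (2 / β) / p) ^ C := by
  have hκ1 : (1 : ℝ) ≤ κ := by exact_mod_cast hκ
  have hN := numSamples_le (κ := κ) hε hδ hβ0 hβ1 hp0 hp1
  have hN1 : (1 : ℝ) ≤ numSamples κ ε δ β p := by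
    unfold numSamples
    push_cast
    linarith [Nat.cast_nonneg (α := ℝ) ⌊rawCount κ ε δ β p⌋₊]
  obtain ⟨hY1, hr⟩ := minCount_le_sq hκ hδ hβ0 hβ1 hp0 hp1
  have hr1 := one_le_minCount (κ := κ) hδ hp0 hp1
  have hE := exponent_le (κ := κ) hε hβ0 hβ1 hp0 hp1
  have hC' : (2 : ℝ) ^ 31 ≤ C := by exact_mod_cast hC
  have hlog : Real.log κ ≤ Real.log (κ * ρ / α ^ 2) := by
    refine Real.log_le_log (by linarith) ?_
    rw [le_div_iff₀ (by positivity)]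
    gcongr
  have hH := (Real.log_pos one_lt_two).le.trans (log_two_le_log_div hβ0 hβ1)
  have hlogκ : 0 ≤ Real.log κ := Real.log_natCast_nonneg κ
  set Y := Real.log (κ * (2 + 1 / δ)) * Real.log (2 / β) / p
  set F := (p / ε) * Real.log (2 / β) * Real.log (κ * ρ / α ^ 2) with hF
  have hF0 : 0 ≤ F := by
    have := hlogκ.trans hlog
    positivity
  have hEF : 2 * (8 / ε * logGap p * Real.log κ * Real.log (2 / β)) ≤ C * F := by
    have : (p / ε) * Real.log (2 / β) * Real.log κ ≤ F := by rw [hF]; gcongr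
    nlinarith
  set n := (numSamples κ ε δ β p : ℝ) with hn
  have hn2 : n ^ 2 ≤ 4 * (1300 * Y ^ 2) ^ 2 * Real.exp (C * F) := by
    calc n ^ 2 ≤ (2 * rawCount κ ε δ β p) ^ 2 := by gcongr
      _ = 4 * minCount κ δ p ^ 2 *
          Real.exp (2 * (8 / ε * logGap p * Real.log κ * Real.log (2 / β))) := by
        rw [rawCount, two_mul (8 / ε * _ * _ * _), Real.exp_add]
        ring
      _ ≤ 4 * (1300 * Y ^ 2) ^ 2 * Real.exp (C * F) := by gcongr
  have hYC : Y ^ 4 ≤ Y ^ C := pow_le_pow_right₀ hY1 ((by norm_num : 4 ≤ 2 ^ 31).trans hC)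
  push_cast
  rw [← hn]
  have hnn : n ≤ n ^ 2 := by nlinarith
  calc n * (κ * 16 + 21) + (κ * (n * (n * 26 + 41) + 31) + 90) ≤ 225 * κ * n ^ 2 := by
        have a1 : (1 : ℝ) ≤ κ * n ^ 2 := by nlinarith
        have a2 : n * κ ≤ κ * n ^ 2 := by nlinarith
        have a3 : n ≤ κ * n ^ 2 := by nlinarith
        have a4 : (κ : ℝ) ≤ κ * n ^ 2 := by nlinarith
        nlinarith
    _ ≤ 225 * κ * (4 * (1300 * Y ^ 2) ^ 2 * Real.exp (C * F)) := by gcongr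
    -- `225 · 4 · 1300²`, which is below `2 ^ 31`.
    _ = 1521000000 * Real.exp (C * F) * κ * Y ^ 4 := by ring
    _ ≤ C * Real.exp (C * F) * κ * Y ^ C := by
        have : (1521000000 : ℝ) ≤ C := le_trans (by norm_num) hC'
        gcongr

end Rounds

/-! ### The sample size against the logarithm of the failure probability -/

section SampleSize

variable {κ : ℕ} {n ε δ β t p : ℝ}

/-- The quantity whose logarithm occurs in the sample size. -/
def logArg (κ : ℕ) (n ε δ β t : ℝ) : ℝ :=
  n * κ * t * (2 + 1 / ε) * Real.log (2 + 1 / δ) / β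

theorem logArg_ge (hκ : 0 < κ) (hn : 1 ≤ n) (hε : 0 < ε) (hδ : 0 < δ) (hβ0 : 0 < β)
    (ht : 1 ≤ t) :
    n * κ * t / β ≤ logArg κ n ε δ β t ∧
      (n * κ * t / β) * (2 * Real.log (2 + 1 / δ)) ≤ logArg κ n ε δ β t := by
  have h1 : (1 : ℝ) ≤ κ := by exact_mod_cast hκ
  have h2 : 0 < 1 / ε := by positivity
  have h3 : 0 < 1 / δ := by positivity
  have h4 : Real.log 2 ≤ Real.log (2 + 1 / δ) := Real.log_le_log two_pos (by linarith)
  have h5 := Real.log_two_gt_d9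
  have h6 : 0 ≤ n * κ * t / β := by positivity
  have h7 : (n * κ * t / β) * (2 * Real.log (2 + 1 / δ)) ≤ logArg κ n ε δ β t := by
    have : logArg κ n ε δ β t = (n * κ * t / β) * ((2 + 1 / ε) * Real.log (2 + 1 / δ)) := by
      unfold logArg; ring
    rw [this]
    refine mul_le_mul_of_nonneg_left ?_ h6
    nlinarith
  exact ⟨(le_mul_of_one_le_right h6 (by linarith)).trans h7, h7⟩

theorem minCount_le_logArg_sq (hκ : 0 < κ) (hn : 1 ≤ n) (hε : 0 < ε) (hδ : 0 < δ) (hβ0 : 0 < β)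
    (hβ1 : β < 1) (ht : 1 ≤ t) (hp0 : 0 < p) (hpn : 52 ≤ p * n) :
    minCount κ δ p ≤ logArg κ n ε δ β t ^ 2 := by
  have h1 : (1 : ℝ) ≤ κ := by exact_mod_cast hκ
  have h3 : 0 < 1 / δ := by positivity
  have h4 : Real.log 2 ≤ Real.log (2 + 1 / δ) := Real.log_le_log two_pos (by linarith)
  have h5 := Real.log_two_gt_d9
  have h6 := (logArg_ge hκ hn hε hδ hβ0 ht).2
  have h7 := minCount_le hκ hδ hp0
  rw [Real.log_mul (by positivity) (by positivity)] at h7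
  have h8 : Real.log κ ≤ κ := (Real.log_le_sub_one_of_pos (by positivity)).trans (by linarith)
  set v := Real.log (2 + 1 / δ)
  have hv : 0.69 ≤ v := by linarith
  have hp' : 1 / p ≤ n / 52 := by
    rw [div_le_div_iff₀ hp0 (by norm_num)]; linarith
  have h9 : n * κ * v ≤ logArg κ n ε δ β t := by
    refine le_trans ?_ h6
    have a1 : n * κ ≤ n * κ * t / β := by
      rw [le_div_iff₀ hβ0]
      have : 0 ≤ n * κ := by positivity
      nlinarith
    nlinarith [mul_le_mul_of_nonneg_right a1 (show 0 ≤ 2 * v by linarith),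
      mul_nonneg (show 0 ≤ n * κ by positivity) (show 0 ≤ v by linarith)]
  refine h7.trans (le_trans ?_ (pow_le_pow_left₀ (by positivity) h9 2))
  have e1 : 8 / p = 8 * (1 / p) := by ring
  have e2 : 32 / p = 32 * (1 / p) := by ring
  rw [e1, e2]
  have hp'' : 0 < 1 / p := by positivity
  set w := κ * v with hw
  have c1 : 0.69 ≤ w := by nlinarith
  have c2 : (κ : ℝ) ≤ 1.45 * w := by nlinarith
  have c3 : v ≤ w := by nlinarith
  have c4 : 32 * (1 / p) + (Real.log κ + v) ≤ 3.4 * (n * w) := by nlinarith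
  calc 8 * (1 / p) * (32 * (1 / p) + (Real.log κ + v)) ≤ 8 * (n / 52) * (3.4 * (n * w)) := by
        have : 0 ≤ n * w := by positivity
        gcongr
    _ ≤ n ^ 2 * w * w := by
        have : 0 ≤ n ^ 2 * w := by positivity
        nlinarith
    _ = (n * κ * v) ^ 2 := by rw [hw]; ring

/-- The logarithm of the inverse failure probability. -/
theorem one_add_log_le (hκ : 0 < κ) (hn : 1 ≤ n) (hε : 0 < ε) (hδ : 0 < δ) (hβ0 : 0 < β)
    (hβ1 : β < 1) (ht : 1 ≤ t) (hp0 : 0 < p) (hp1 : p < 1 / 4) (hpn : 52 ≤ p * n) :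
    1 + Real.log (1 / (β / (44 * n ^ 2 * t * rawCount κ ε δ β p))) ≤
        64 * (1 + p / ε) * (1 + Real.log (logArg κ n ε δ β t)) ^ 2 := by
  have h1 : (1 : ℝ) ≤ κ := by exact_mod_cast hκ
  have hr1 := one_le_minCount (κ := κ) hδ hp0 hp1
  have hr := minCount_le_logArg_sq hκ hn hε hδ hβ0 hβ1 ht hp0 hpn
  have hE := exponent_le (κ := κ) hε hβ0 hβ1 hp0 hp1
  have hX := (logArg_ge hκ hn hε hδ hβ0 ht).1
  set X := logArg κ n ε δ β t
  have hX0 : 0 < X := lt_of_lt_of_le (by positivity) hX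
  have x1 : n * t / β ≤ X := le_trans (by gcongr; nlinarith) hX
  have x2 : (κ : ℝ) ≤ X := by
    refine le_trans ?_ hX
    rw [le_div_iff₀ hβ0]
    have : (κ : ℝ) ≤ n * κ * t := by nlinarith [mul_le_mul hn ht zero_le_one (by linarith)]
    nlinarith
  have x3 : n ≤ X := by
    refine le_trans ?_ x1
    rw [le_div_iff₀ hβ0]
    nlinarith
  have x4 : 1 / β ≤ X := by
    refine le_trans ?_ x1
    gcongr
    nlinarith
  have l0 := Real.log_two_lt_d9
  have l1 : Real.log κ ≤ Real.log X := Real.log_le_log (by positivity) x2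
  have l2 : Real.log n ≤ Real.log X := Real.log_le_log (by positivity) x3
  have l3 : Real.log (2 / β) ≤ 1 + Real.log X := by
    have := Real.log_le_log (by positivity) x4
    rw [div_eq_mul_one_div, Real.log_mul two_ne_zero (by positivity)]
    linarith
  have l4 : Real.log (n * t / β) ≤ Real.log X := Real.log_le_log (by positivity) x1
  have l5 : Real.log (minCount κ δ p) ≤ 2 * Real.log X := by
    have := Real.log_le_log (by linarith) hr
    rwa [Real.log_pow, Nat.cast_two] at this
  have l6 : Real.log 44 ≤ 43 := (Real.log_le_sub_one_of_pos (by norm_num)).trans (by norm_num)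
  have l7 : 0 ≤ Real.log X := Real.log_nonneg (by linarith)
  have l8 : 0 ≤ Real.log (2 / β) := (Real.log_pos one_lt_two).le.trans (log_two_le_log_div hβ0 hβ1)
  have l9 : 0 ≤ Real.log κ := Real.log_natCast_nonneg κ
  -- The first four terms are linear in `1 + log X`. The last, from the exponential number of
  -- subsamples, contributes `(p/ε)(1 + log X)²`.
  have hlog : Real.log (1 / (β / (44 * n ^ 2 * t * rawCount κ ε δ β p))) =
      Real.log 44 + Real.log n + Real.log (n * t / β) + Real.log (minCount κ δ p) +
        8 / ε * logGap p * Real.log κ * Real.log (2 / β) := by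
    have hm : 0 < minCount κ δ p := by linarith
    have ht0 : 0 < t := by linarith
    have hn0 : 0 < n := by linarith
    rw [← Real.log_mul (by positivity) (by positivity), ← Real.log_mul (by positivity)
      (by positivity), ← Real.log_mul (by positivity) hm.ne',
      ← Real.log_exp (8 / ε * logGap p * Real.log κ * Real.log (2 / β)),
      ← Real.log_mul (by positivity) (by positivity), rawCount]
    congr 1
    field_simp
  have hy : 0 < p / ε := by positivity
  set L := 1 + Real.log X
  have hL : 1 ≤ L := by linarith
  have k1 : (p / ε) * Real.log (2 / β) * Real.log κ ≤ (p / ε) * L * L := by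
    gcongr
    linarith
  have k2 : L ≤ L ^ 2 := by nlinarith
  have k3 : 0 ≤ (p / ε) * L ^ 2 := by positivity
  rw [hlog]
  nlinarith

end SampleSize

section SampleSize

variable {κ n C : ℕ} {ε δ β α ρ p N₀ M K lam : ℝ}

/-- Consequences of the lower bound for the sample size, with `B` in place of the logarithm of
the inverse failure probability. -/
theorem sampleSize_consequences (hκ : 0 < κ) (hε : 0 < ε) (hδ : 0 < δ) (hβ0 : 0 < β) (hβ1 : β < 1)
    (hα : 0 < α) (hp0 : 0 < p) (hρ : α ^ 2 ≤ ρ) (hN₀ : 0 ≤ N₀) (hM : 0 < M) (hK : 0 < K)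
    (hC : 2 ^ 31 ≤ C)
    (hn : C * ((N₀ + M) / p + (K * (1 + α ^ 2) / α ^ 2 + (ρ ^ 2 + lam ^ 2) / α ^ 4) *
      (p ^ 2 / ε ^ 3 + 1 / p) * (1 + Real.log (logArg κ n ε δ β (ρ / α ^ 2))) ^ C) ≤ n) :
    0 < n ∧ ∀ B : ℝ, B = 64 * (1 + p / ε) * (1 + Real.log (logArg κ n ε δ β (ρ / α ^ 2))) ^ 2 →
      64 ≤ B ∧ 16 * (N₀ + M + (K / α ^ 2 + K + (ρ ^ 2 + lam ^ 2) / α ^ 4) * B ^ 3) ≤ p * n := by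
  have hC' : (2 : ℝ) ^ 31 ≤ C := by exact_mod_cast hC
  have ht : 1 ≤ ρ / α ^ 2 := by rwa [one_le_div (by positivity)]
  have hα2 : 0 < α ^ 2 := by positivity
  have hW : 0 < K / α ^ 2 + K + (ρ ^ 2 + lam ^ 2) / α ^ 4 := by positivity
  have hWeq : K * (1 + α ^ 2) / α ^ 2 = K / α ^ 2 + K := by field_simp
  rw [hWeq] at hn
  set W := K / α ^ 2 + K + (ρ ^ 2 + lam ^ 2) / α ^ 4
  have hn0 : 0 < n := by
    -- For `n = 0` the argument of the logarithm is `0` and `Real.log 0 = 0`, so the sample size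
    -- bound still has a positive left side.
    rcases Nat.eq_zero_or_pos n with rfl | h
    · exfalso
      simp only [logArg, Nat.cast_zero, zero_mul, zero_div, Real.log_zero, add_zero, one_pow,
        mul_one] at hn
      have : 0 < (C : ℝ) * ((N₀ + M) / p + W * (p ^ 2 / ε ^ 3 + 1 / p)) :=
        mul_pos (by linarith) (by positivity)
      linarith
    · exact h
  have hn1 : (1 : ℝ) ≤ n := by exact_mod_cast hn0
  have hX := (logArg_ge hκ hn1 hε hδ hβ0 ht).1
  have hκ1 : (1 : ℝ) ≤ κ := by exact_mod_cast hκ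
  have hX1 : 1 ≤ logArg κ n ε δ β (ρ / α ^ 2) := by
    refine le_trans ?_ hX
    rw [one_le_div hβ0]
    nlinarith [mul_le_mul (mul_le_mul hn1 hκ1 zero_le_one (by linarith)) ht zero_le_one
      (by positivity)]
  set L := 1 + Real.log (logArg κ n ε δ β (ρ / α ^ 2)) with hL
  have hL1 : 1 ≤ L := by linarith [Real.log_nonneg hX1]
  refine ⟨hn0, fun B hB => ?_⟩
  set y := p / ε with hy
  have hy0 : 0 < y := by positivity
  constructor
  · rw [hB]
    nlinarith [mul_le_mul (show 1 ≤ 1 + y by linarith) (one_le_pow₀ hL1 : 1 ≤ L ^ 2) zero_le_one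
      (by linarith)]
  have hLC : L ^ 6 ≤ L ^ C := pow_le_pow_right₀ hL1 ((by norm_num : 6 ≤ 2 ^ 31).trans hC)
  -- Convexity of the cube; here `1 + (p/ε)³` becomes `p` times the factor `p²/ε³ + 1/p` of the
  -- theorem.
  have hQ : (1 + y) ^ 3 ≤ 4 * (p * (p ^ 2 / ε ^ 3 + 1 / p)) := by
    have : p * (p ^ 2 / ε ^ 3 + 1 / p) = y ^ 3 + 1 := by rw [hy]; field_simp
    rw [this]
    nlinarith [mul_nonneg (show 0 ≤ 1 + y by linarith) (sq_nonneg (y - 1))]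
  have hB3 : B ^ 3 ≤ 2 ^ 20 * (p * (p ^ 2 / ε ^ 3 + 1 / p)) * L ^ C := by
    calc B ^ 3 = 2 ^ 18 * (1 + y) ^ 3 * L ^ 6 := by rw [hB]; ring
      _ ≤ 2 ^ 18 * (4 * (p * (p ^ 2 / ε ^ 3 + 1 / p))) * L ^ C := by gcongr
      _ = _ := by ring
  have hpn := mul_le_mul_of_nonneg_left hn hp0.le
  refine le_trans ?_ hpn
  have hLC0 : 0 < L ^ C := by positivity
  calc 16 * (N₀ + M + W * B ^ 3)
      ≤ 16 * (N₀ + M + W * (2 ^ 20 * (p * (p ^ 2 / ε ^ 3 + 1 / p)) * L ^ C)) := by gcongr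
    _ ≤ 2 ^ 31 * (N₀ + M + W * (p * (p ^ 2 / ε ^ 3 + 1 / p)) * L ^ C) := by
        have : 0 ≤ W * (p * (p ^ 2 / ε ^ 3 + 1 / p)) * L ^ C := by positivity
        linarith
    _ ≤ C * (N₀ + M + W * (p * (p ^ 2 / ε ^ 3 + 1 / p)) * L ^ C) := by gcongr
    _ = C * (p * ((N₀ + M) / p) + W * (p * (p ^ 2 / ε ^ 3 + 1 / p)) * L ^ C) := by
        rw [mul_div_cancel₀ _ hp0.ne']
    _ = _ := by ring

/-- With sensitivity `c = m log(2/b) / n`, a deviation of order `pα²` has a sub-Gaussian exponent of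
order `p n α⁴ / (m² log(2/b)²)`. Making this at least `log(1/b)` costs three logarithms, which is
the origin of `B ^ 3`. The number `m` dominates `lam` for stability and `α²` so that the deviation
is in the sub-Gaussian range. -/
theorem failure_prob_bounds {n t r m B N b : ℝ} (hβ0 : 0 < β) (hβ1 : β < 1) (hα : 0 < α)
    (hp0 : 0 < p) (hN₀ : 0 ≤ N₀) (hK : 0 < K) (hn1 : 1 ≤ n) (ht : 1 ≤ t) (hr1 : 1 ≤ r)
    (hN : N ≤ 2 * r) (hm0 : 0 < m) (hm1 : lam ≤ m) (hm2 : α ^ 2 ≤ m)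
    (q1 : 16 * (m ^ 2 / α ^ 4 * B ^ 3) ≤ p * n) (q2 : 16 * B ≤ p * n)
    (q3 : 16 * (N₀ + K / α ^ 2 * B) ≤ p * n) (q4 : 16 * (M + K * B) ≤ p * n)
    (hb : b = β / (44 * n ^ 2 * t * r)) (hlogb : 1 + Real.log (1 / b) ≤ B) :
    0 < b ∧ b ≤ 1 ∧ ∃ c : ℝ, 0 < c ∧ lam * Real.log (2 / b) / n ≤ c ∧
      7 / 2 * (p * α ^ 2) ≤ 4 * c * (p * n) ∧
      N₀ + K * Real.log (1 / b) / (α / 2) ^ 2 ≤ p * n / 2 ∧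
      M + K * Real.log (1 / b) ≤ p * n / 2 ∧
      N * (2 * Real.exp (-(p * n / 8)) + 3 * b +
        (2 * Real.exp (-((7 / 2 * (p * α ^ 2)) ^ 2 / (16 * c ^ 2 * (p * n)))) +
        α ^ 2 * t * (1 + Real.log (1 / b)) / c * (n * (Real.exp (-(p * n / 8)) + b)))) ≤ β / 2 := by
  have hα2 : 0 < α ^ 2 := by positivity
  have hden : 1 ≤ n ^ 2 * t * r :=
    one_le_mul_of_one_le_of_one_le
      (one_le_mul_of_one_le_of_one_le (one_le_pow₀ hn1) ht) hr1
  have ht0 : 0 < t := by linarith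
  have hr0 : 0 < r := by linarith
  have hn' : 0 < n := by linarith
  have hK2 : 0 < K / α ^ 2 := by positivity
  have hb0 : 0 < b := by rw [hb]; positivity
  have hb1 : b ≤ 1 / 44 := by
    rw [hb, div_le_div_iff₀ (by positivity) (by norm_num)]
    linarith
  set Λ := Real.log (1 / b) with hΛ
  have hΛe : Real.exp (-Λ) = b := by
    rw [hΛ, one_div, Real.log_inv, neg_neg, Real.exp_log hb0]
  have hΛ1 : 1 ≤ Λ := by
    rw [hΛ, Real.le_log_iff_exp_le (by positivity), le_div_iff₀ hb0]
    exact (mul_le_mul Real.exp_one_lt_d9.le hb1 hb0.le (by norm_num)).trans (by norm_num)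
  have hL : Real.log (2 / b) = Real.log 2 + Λ := by
    rw [hΛ, ← Real.log_mul two_ne_zero (by positivity)]
    congr 1
    ring
  have l1 := Real.log_two_gt_d9
  have l2 := Real.log_two_lt_d9
  set ℓ := Real.log (2 / b) with hℓ
  have hℓ0 : 0 < ℓ := by linarith
  refine ⟨hb0, by linarith, m * ℓ / n, by positivity, by gcongr, ?_, ?_, ?_, ?_⟩
  · have : 4 * (m * ℓ / n) * (p * n) = 4 * p * (m * ℓ) := by field_simp
    rw [this]
    have := mul_le_mul_of_nonneg_left (mul_le_mul hm2 (show 1 ≤ ℓ by linarith) zero_le_one hm0.le)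
      hp0.le
    linarith [mul_pos hp0 hα2]
  · have : K * Λ / (α / 2) ^ 2 = 4 * (K / α ^ 2 * Λ) := by field_simp; norm_num
    rw [this]
    linarith [mul_le_mul_of_nonneg_left (show Λ ≤ B by linarith) hK2.le]
  · linarith [mul_le_mul_of_nonneg_left (show Λ ≤ B by linarith) hK.le]
  have e1 : Real.exp (-(p * n / 8)) ≤ b := by
    rw [← hΛe, Real.exp_le_exp]
    linarith
  have e2 : Real.exp (-((7 / 2 * (p * α ^ 2)) ^ 2 / (16 * (m * ℓ / n) ^ 2 * (p * n)))) ≤ b := by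
    rw [← hΛe, Real.exp_le_exp, neg_le_neg_iff]
    have : (7 / 2 * (p * α ^ 2)) ^ 2 / (16 * (m * ℓ / n) ^ 2 * (p * n)) =
        49 / 64 * (p * n) / (m ^ 2 / α ^ 4 * ℓ ^ 2) := by
      field_simp
      norm_num
    rw [this, le_div_iff₀ (by positivity)]
    have : Λ * (m ^ 2 / α ^ 4 * ℓ ^ 2) ≤ B * (m ^ 2 / α ^ 4 * B ^ 2) := by
      gcongr <;> linarith
    linarith
  -- The ratio `R / c` is only linear in `n`: the logarithm in the truncation level `R` cancels
  -- against the one in `c`.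
  have e3 : α ^ 2 * t * (1 + Λ) / (m * ℓ / n) ≤ 2 * n * t := by
    rw [div_le_iff₀ (by positivity)]
    have : 2 * n * t * (m * ℓ / n) = m * t * (2 * ℓ) := by field_simp
    rw [this]
    gcongr
    linarith
  have hnt : 1 ≤ n ^ 2 * t := one_le_mul_of_one_le_of_one_le (one_le_pow₀ hn1) ht
  -- Every exponential is at most `b`. The total is at most `22 r n² t b`, whence the `44` in the
  -- choice of `b`.
  calc _ ≤ 2 * r * (2 * b + 3 * b + (2 * b + 2 * n * t * (n * (b + b)))) := by
        gcongr
    _ = 2 * r * (7 * b + 4 * (n ^ 2 * t) * b) := by ring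
    _ ≤ 2 * r * (11 * (n ^ 2 * t) * b) := by
        have := mul_le_mul_of_nonneg_right hnt hb0.le
        refine mul_le_mul_of_nonneg_left ?_ (by positivity)
        linarith
    _ = β / 2 := by
        rw [hb]
        field_simp
        norm_num

/-- The choice of the failure probability `b` and of the sensitivity `c`. -/
theorem exists_failure_prob (hκ : 0 < κ) (hε : 0 < ε) (hδ : 0 < δ) (hβ0 : 0 < β) (hβ1 : β < 1)
    (hα : 0 < α) (hp0 : 0 < p) (hp1 : p < 1 / 4) (hρ : α ^ 2 ≤ ρ) (hN₀ : 0 ≤ N₀) (hM : 0 < M)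
    (hK : 0 < K) (hlam : 0 < lam) (hC : 2 ^ 31 ≤ C)
    (hn : C * ((N₀ + M) / p + (K * (1 + α ^ 2) / α ^ 2 + (ρ ^ 2 + lam ^ 2) / α ^ 4) *
      (p ^ 2 / ε ^ 3 + 1 / p) * (1 + Real.log (logArg κ n ε δ β (ρ / α ^ 2))) ^ C) ≤ n) :
    0 < n ∧ ∃ b c : ℝ, 0 < b ∧ b ≤ 1 ∧ 0 < c ∧ lam * Real.log (2 / b) / n ≤ c ∧
      7 / 2 * (p * α ^ 2) ≤ 4 * c * (p * n) ∧
      N₀ + K * Real.log (1 / b) / (α / 2) ^ 2 ≤ p * n / 2 ∧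
      M + K * Real.log (1 / b) ≤ p * n / 2 ∧
      numSamples κ ε δ β p * (2 * Real.exp (-(p * n / 8)) + 3 * b +
        (2 * Real.exp (-((7 / 2 * (p * α ^ 2)) ^ 2 / (16 * c ^ 2 * (p * n)))) +
        ρ * (1 + Real.log (1 / b)) / c * (n * (Real.exp (-(p * n / 8)) + b)))) ≤ β / 2 := by
  obtain ⟨hn0, hcons⟩ := sampleSize_consequences hκ hε hδ hβ0 hβ1 hα hp0 hρ hN₀ hM hK hC hn
  obtain ⟨hB64, hpn⟩ := hcons _ rfl
  have hn1 : (1 : ℝ) ≤ n := by exact_mod_cast hn0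
  have hα2 : 0 < α ^ 2 := by positivity
  have ht : 1 ≤ ρ / α ^ 2 := by rwa [one_le_div (by positivity)]
  set t := ρ / α ^ 2 with ht'
  set r := rawCount κ ε δ β p with hr
  set B := 64 * (1 + p / ε) * (1 + Real.log (logArg κ n ε δ β t)) ^ 2
  have hr1 : 1 ≤ r := (one_le_minCount (κ := κ) hδ hp0 hp1).trans
    (minCount_le_rawCount hε hδ hβ0 hβ1 hp0 hp1)
  -- The larger of `lam` and `α²`; the square of `α²` is absorbed by `ρ²`.
  have hm : ∃ m : ℝ, 0 < m ∧ lam ≤ m ∧ α ^ 2 ≤ m ∧ m ^ 2 ≤ ρ ^ 2 + lam ^ 2 := by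
    rcases le_total lam (α ^ 2) with h | h
    · exact ⟨α ^ 2, hα2, h, le_rfl, by
        linarith [pow_le_pow_left₀ hα2.le hρ 2, sq_nonneg lam]⟩
    · exact ⟨lam, hlam, le_rfl, h, by linarith [sq_nonneg ρ]⟩
  obtain ⟨m, hm0, hm1, hm2, hm3⟩ := hm
  have hW : m ^ 2 / α ^ 4 ≤ (ρ ^ 2 + lam ^ 2) / α ^ 4 := by gcongr
  have hW1 : 1 ≤ m ^ 2 / α ^ 4 := by
    rw [one_le_div (by positivity)]
    linarith [pow_le_pow_left₀ hα2.le hm2 2, show (α ^ 2) ^ 2 = α ^ 4 by ring]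
  have hK2 : 0 < K / α ^ 2 := by positivity
  have hBB : B ≤ B ^ 3 := le_self_pow₀ (by linarith) (by norm_num)
  have hB3 : 0 < B ^ 3 := by positivity
  have v1 : 0 ≤ K / α ^ 2 * B ^ 3 := by positivity
  have v2 : 0 ≤ K * B ^ 3 := by positivity
  have v3 := mul_le_mul_of_nonneg_right hW hB3.le
  have v4 := mul_le_mul_of_nonneg_right hW1 hB3.le
  have v5 := mul_le_mul_of_nonneg_left hBB hK2.le
  have v6 := mul_le_mul_of_nonneg_left hBB hK.le
  rw [add_mul, add_mul] at hpn
  have q1 : 16 * (m ^ 2 / α ^ 4 * B ^ 3) ≤ p * n := by linarith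
  have q2 : 16 * B ≤ p * n := by linarith
  have q3 : 16 * (N₀ + K / α ^ 2 * B) ≤ p * n := by linarith
  have q4 : 16 * (M + K * B) ≤ p * n := by linarith
  have hlogb : 1 + Real.log (1 / (β / (44 * n ^ 2 * t * r))) ≤ B :=
    one_add_log_le hκ hn1 hε hδ hβ0 hβ1 ht hp0 hp1 (by linarith)
  have hbounds := failure_prob_bounds hβ0 hβ1 hα hp0 hN₀ hK hn1 ht hr1
    (numSamples_le hε hδ hβ0 hβ1 hp0 hp1) hm0 hm1 hm2 q1 q2 q3 q4 rfl hlogb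
  rw [ht', mul_div_cancel₀ _ hα2.ne'] at hbounds
  obtain ⟨hb0, hb1, c, hc⟩ := hbounds
  exact ⟨hn0, _, c, hb0, hb1, hc⟩

end SampleSize

/-! ### The properties of the mechanism -/

section Mechanism

variable {d : ℕ} {𝒵 : Type*} [MeasurableSpace 𝒵] {T : LossModel d 𝒵} {κ : ℕ} {I : Fin κ → Set ℝ}
  {ε δ β α ρ p : ℝ}

theorem rawCount_nonneg (hδ : 0 < δ) (hp0 : 0 < p) (hp1 : p < 1 / 4) :
    0 ≤ rawCount κ ε δ β p :=
  mul_nonneg (minCount_pos hδ hp0 hp1).le (Real.exp_pos _).le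

theorem outputProb_mechanism (hI : IsIntervalPartition I T.firstCoords) (hδ : 0 < δ) (hp0 : 0 < p)
    (hp1 : p < 1 / 4) {n : ℕ} (Z : Fin n → 𝒵) (E : Set ℕ) :
    outputProb (lossOracle T I Z) mechanism (inputMem κ n ε δ β α ρ p) E =
      ENNReal.ofReal (mechProb (lossOracle T I Z) κ ε δ β α p E) :=
  (mechanism_ends hp0.le (by linarith) hI.pos (rawCount_nonneg hδ hp0 hp1)).outputProb_eq E

theorem mechanism_runningTime (hI : IsIntervalPartition I T.firstCoords) (hε : 0 < ε) (hδ : 0 < δ)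
    (hβ0 : 0 < β) (hβ1 : β < 1) (hα : 0 < α) (hp0 : 0 < p) (hp1 : p < 1 / 4) (hρ : α ^ 2 ≤ ρ)
    {C : ℕ} (hC : 2 ^ 31 ≤ C) {n : ℕ} (Z : Fin n → 𝒵) :
    expectedTime (lossOracle T I Z) mechanism (inputMem κ n ε δ β α ρ p) ≤
      ENNReal.ofReal
        (C * Real.exp (C * ((p / ε) * Real.log (2 / β) * Real.log (κ * ρ / α ^ 2))) * κ *
          (Real.log (κ * (2 + 1 / δ)) * Real.log (2 / β) / p) ^ C) := by
  refine ((mechanism_ends hp0.le (by linarith) hI.pos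
    (rawCount_nonneg hδ hp0 hp1)).expectedTime_le ?_).trans ?_
  · rw [mechProb_range hI.pos fun i _ => Set.mem_univ i, ENNReal.ofReal_one]
  · rw [← ENNReal.ofReal_natCast]
    exact ENNReal.ofReal_le_ofReal (steps_le hI.pos hε hδ hβ0 hβ1 hα hp0 hp1 hρ hC)

theorem mechanism_private (hI : IsIntervalPartition I T.firstCoords) (hε : 0 < ε) (hδ : 0 < δ)
    (hβ0 : 0 < β) (hβ1 : β < 1) (hp0 : 0 < p) (hp1 : p < 1 / 4) (n : ℕ) :
    IsDP ε δ fun Z : Fin n → 𝒵 =>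
      outputProb (lossOracle T I Z) mechanism (inputMem κ n ε δ β α ρ p) := by
  rintro Z Z' ⟨i₀, -, huniq⟩ E
  have hne : ∀ j, j ≠ i₀ → Z j = Z' j := fun j hj => by
    by_contra h
    exact hj (huniq j h)
  have h := mechProb_le (α := α) hε hδ hβ0 hβ1 hp0 hp1 hI.pos (lossOracle_erase_le hI Z i₀)
    (lossOracle_erase_le hI Z' i₀) (lossOracle_congr hne) E
  simp only [outputProb_mechanism hI hδ hp0 hp1]
  rw [← ENNReal.ofReal_mul (Real.exp_pos ε).le]
  exact (ENNReal.ofReal_le_ofReal h).trans ENNReal.ofReal_add_le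

theorem mechanism_accurate (hI : IsIntervalPartition I T.firstCoords) (hε : 0 < ε) (hδ : 0 < δ)
    (hβ0 : 0 < β) (hβ1 : β < 1) (hα : 0 < α) (hp0 : 0 < p) (hp1 : p < 1 / 4) (hρ : α ^ 2 ≤ ρ)
    {C : ℕ} (hC : 2 ^ 31 ≤ C) {D : Measure 𝒵} [IsProbabilityMeasure D] {θD : Fin (d + 1) → ℝ}
    {θE : (n : ℕ) → (Fin n → 𝒵) → Fin (d + 1) → ℝ} {N : ℝ → ℝ} {M K lam mu sig : ℝ}
    (hA : IdentConcStab T D θD θE N M K lam mu sig) (hsig : 2 * sig ^ 2 + α ^ 2 ≤ ρ) {n : ℕ}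
    (hn : C * ((N (α / 2) + M) / p + (K * (1 + α ^ 2) / α ^ 2 + (ρ ^ 2 + lam ^ 2) / α ^ 4) *
      (p ^ 2 / ε ^ 3 + 1 / p) * (1 + Real.log (logArg κ n ε δ β (ρ / α ^ 2))) ^ C) ≤ n) :
    ENNReal.ofReal (1 - β) ≤
      ∫⁻ Z, outputProb (lossOracle T I Z) mechanism (inputMem κ n ε δ β α ρ p)
        {i | ∃ h : i < κ, Metric.infDist (θD 0) (I ⟨i, h⟩) < 10 * α / Real.sqrt mu} ∂(iid D n) := by
  classical
  obtain ⟨hn0, b, c, hb0, hb1, hc0, hc, hu, hN, hM, hfail⟩ := exists_failure_prob hI.pos hε hδ hβ0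
    hβ1 hα hp0 hp1 hρ (hA.N_nonneg _) hA.M_pos hA.K_pos hA.lam_pos hC hn
  have hρ0 : 0 < ρ := lt_of_lt_of_le (by positivity) hρ
  have hΛ : 0 ≤ Real.log (1 / b) := Real.log_nonneg (by rw [le_div_iff₀ hb0]; linarith)
  set R := ρ * (1 + Real.log (1 / b))
  set u := 7 / 2 * (p * α ^ 2)
  have hR : sig ^ 2 * (1 + Real.log (1 / b)) ≤ R :=
    mul_le_mul_of_nonneg_right (by nlinarith [sq_nonneg sig]) (by linarith)
  have hupper := upperLe_not_typical hA hp0 (by linarith) hn0 hb0 hb1 (half_pos hα) hc0 hc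
    (show 0 < R by positivity) hR (show 0 ≤ u by positivity) hu hN hM
  have hupper' := (hupper.const_mul (Nat.cast_nonneg (numSamples κ ε δ β p))).mono
    (fun _ => le_rfl) hfail
  simp only [outputProb_mechanism hI hδ hp0 hp1]
  -- One half of `β` pays for a wrong selection from typical subsamples, the other for the expected
  -- number of atypical ones.
  rw [show 1 - β = 1 - β / 2 - β / 2 by ring]
  obtain ⟨hθD, -⟩ := hA.pop_min
  obtain ⟨i₀, hi₀⟩ := hI.exists_mem hθD
  have hmu := hA.mu_pos
  refine hupper'.ofReal_le_lintegral (fun Z => ?_) (by positivity)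
  refine mechProb_ge (c := subsetAvg p Finset.univ (truncLoss T R Z)) hε hδ hβ0 hβ1 hp0 hp1 hα
    i₀.2 ⟨i₀.2, ?_⟩ (fun S hS => ?_) (fun S hS => ?_) (fun S hS i hi hiE => ?_)
  · rw [Metric.infDist_zero_of_mem hi₀]
    exact div_pos (by positivity) (Real.sqrt_pos.2 hmu)
  · rw [rowMin_lossOracle hI]
    have := hS.dev_lt
    rwa [truncLoss, min_eq_left hS.loss_le] at this
  · rw [rowMin_lossOracle hI, lossOracle, dif_pos i₀.2]
    exact minLossOn_le_of_mem hθD hmu hn0 hS.card_le hS.param_close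
      (fun w hw => (hS.smooth_convex w hw).2) hi₀
  · rw [rowMin_lossOracle hI, lossOracle, dif_pos hi]
    refine le_minLossOn_of_far hmu hα hn0 hS.card_ge hS.param_close
      (fun w hw => (hS.smooth_convex w hw).1) (hI.exists_param _) fun w hw => ?_
    have hfar : 10 * α / Real.sqrt mu ≤ Metric.infDist (θD 0) (I ⟨i, hi⟩) :=
      not_lt.1 fun h => hiE ⟨hi, h⟩
    exact hfar.trans (Metric.infDist_le_dist_of_mem hw)

end Mechanism

end PrivEst

end

theorem theorem5p4 :
    ∃ (prog : Prog) (C : ℕ),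
      ∀ (d : ℕ) (𝒵 : Type*) [MeasurableSpace 𝒵] (T : LossModel d 𝒵)
        (κ : ℕ) (I : Fin κ → Set ℝ), IsIntervalPartition I T.firstCoords →
      ∀ ε δ β α ρ p : ℝ, 0 < ε → 0 < δ → 0 < β → β < 1 → 0 < α → 0 < p → p < 1 / 4 →
        α ^ 2 ≤ ρ →
        -- privacy, for every loss and every dataset size
        (∀ n : ℕ, IsDP ε δ fun Z : Fin n → 𝒵 =>
          outputProb (lossOracle T I Z) prog (inputMem κ n ε δ β α ρ p)) ∧
        -- the output is always an interval of the partition, and the expected running time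
        (∀ (n : ℕ) (Z : Fin n → 𝒵),
          outputProb (lossOracle T I Z) prog (inputMem κ n ε δ β α ρ p) {i | i < κ} = 1 ∧
          expectedTime (lossOracle T I Z) prog (inputMem κ n ε δ β α ρ p) ≤
            ENNReal.ofReal
              (C * Real.exp (C * ((p / ε) * Real.log (2 / β) * Real.log (κ * ρ / α ^ 2))) * κ *
                (Real.log (κ * (2 + 1 / δ)) * Real.log (2 / β) / p) ^ C)) ∧
        -- accuracy
        (∀ (D : MeasureTheory.Measure 𝒵) [MeasureTheory.IsProbabilityMeasure D]
          (θD : Fin (d + 1) → ℝ) (θE : (n : ℕ) → (Fin n → 𝒵) → Fin (d + 1) → ℝ)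
          (N : ℝ → ℝ) (M K lam mu sig : ℝ), IdentConcStab T D θD θE N M K lam mu sig →
          2 * sig ^ 2 + α ^ 2 ≤ ρ →
          ∀ n : ℕ,
            C * ((N (α / 2) + M) / p +
              (K * (1 + α ^ 2) / α ^ 2 + (ρ ^ 2 + lam ^ 2) / α ^ 4) *
                (p ^ 2 / ε ^ 3 + 1 / p) *
                (1 + Real.log (n * κ * (ρ / α ^ 2) * (2 + 1 / ε) *
                  Real.log (2 + 1 / δ) / β)) ^ C) ≤ n →
            ENNReal.ofReal (1 - β) ≤
              ∫⁻ Z, outputProb (lossOracle T I Z) prog (inputMem κ n ε δ β α ρ p)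
                {i | ∃ h : i < κ,
                  Metric.infDist (θD 0) (I ⟨i, h⟩) < 10 * α / Real.sqrt mu} ∂(iid D n)) := by
  -- The running time dictates this size; the sample size would be content with `2 ^ 24`.
  obtain ⟨C, hC⟩ : ∃ C : ℕ, 2 ^ 31 ≤ C := ⟨_, le_rfl⟩
  refine ⟨mechanism, C, ?_⟩
  intro d 𝒵 _ T κ I hI ε δ β α ρ p hε hδ hβ0 hβ1 hα hp0 hp1 hρ
  refine ⟨mechanism_private hI hε hδ hβ0 hβ1 hp0 hp1, fun n Z =>
    ⟨?_, mechanism_runningTime hI hε hδ hβ0 hβ1 hα hp0 hp1 hρ hC Z⟩, ?_⟩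
  · rw [outputProb_mechanism hI hδ hp0 hp1, mechProb_range hI.pos (E := {i | i < κ}) fun i hi => hi,
      ENNReal.ofReal_one]
  · intro D _ θD θE N M K lam mu sig hA hsig n hn
    exact mechanism_accurate hI hε hδ hβ0 hβ1 hα hp0 hp1 hρ hC hA hsig hn
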